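/- Let $(\mathbf C,|\cdot|)$ be either $\mathbb C$ with its usual absolute value or an algebraically closed field with an ultrametric absolute value. Let $q\in\mathbf C$ with $|q|=1$, $q$ not a root of unity, let $q^{1/n}\in\mathbf C$ ($n\ge 1$) be chosen with $(q^{1/n})^n=q$, and put $(a;q)_n=\prod_{i=0}^{n-1}(1-q^ia)$. Assume that $\sum_{n\ge0}x^n/(q;q)_n$ is convergent (i.e. has positive radius of convergence). Let $\mathbf C\{x\}$ be the ring of convergent power series, $\mathbf K=\mathbf C(\{x\})$ its fraction field, $\sigma_q f(x)=f(qx)$. A $q$-difference module is a finite-dimensional $\mathbf K$-vector space $M$ with a bijective additive map $\Sigma_q$ such that $\Sigma_q(fm)=\sigma_q(f)\Sigma_q(m)$; submodules, direct sums, extensions, simple and indecomposable modules are meant in this category. For $\mathcal L=\sum_{i=0}^\nu a_i(x)\sigma_q^i$ with $a_i\in\mathbf C\{x\}$, $a_\nu\ne0$, the Newton polygon is the convex hull of $\{(i,k): a_i\neq0,\ k\ge\operatorname{ord}_x a_i\}$; it is recorded as the set of pairs $(\mu,r)$, $\mu\in\mathbb Q$ a finite slope and $r>0$ the length of the projection on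 the horizontal axis of the edge of slope $\mu$. $\mathcal L$ is pure of slope $\mu$ if $\mu$ is its only slope. For a slope $d\in\mathbb Z$ let $E$ be the set of indices $i$ of the points $(i,\operatorname{ord}_xa_i)$ on the edge of slope $d$, and let the exponents of $d$ be the nonzero roots of $\sum_{i\in E}q^{-d\,i(i-1)/2}\,\alpha_i\,T^i$, $\alpha_i$ being the leading (lowest order) coefficient of $a_i$. The slope $d$ is admissible if, with $\Lambda$ the set of the quotients $\lambda\lambda'^{-1}$ of exponents of $d$ that are not in $q^{\mathbb Z_{\le0}}$, the series $\sum_{n\ge0}x^n/\prod_{a\in\Lambda}(a;q)_n$ is convergent. A slope $\mu\in\mathbb Q$ is almost admissible if for some $n\ge1$ with $n\mu\in\mathbb Z$ the slope $n\mu$ of $\sum_i a_i(t^n)\sigma_{q^{1/n}}^i$ (an operator in the variable $t=x^{1/n}$, with $q^{1/n}$ in the place of $q$) is admissible. $\mathcal L$ is almost admissible if all its slopes are. An operator $\mathcal L$ is associated to $M$ if $M\cong\mathbf K[\sigma_q]/\mathbf K[\sigma_q]\mathcal L$; the Newton polygon of $M$ is that of an associated operator, and $M$ is almost admissible (resp.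 pure of slope $\mu$) if it has an associated operator with this property. Theorem. Let $(M,\Sigma_q)$ be an almost admissible $q$-difference module over $\mathbf K$ with Newton polygon $\{(\mu_1,r_1),\dots,(\mu_k,r_k)\}$, $\mu_1<\dots<\mu_k$. Then $M=M_1\oplus\dots\oplus M_k$, where each $M_i$ is a $q$-difference submodule of $M$ that is almost admissible, pure of slope $\mu_i$ and of rank $r_i$. Moreover each $M_i$ is a finite direct sum of almost admissible indecomposable $q$-difference submodules $P$, each of which is an iterated nontrivial extension of a simple almost admissible $q$-difference module $S$ by itself: there is a chain of submodules $0=F_0\subset F_1\subset\dots\subset F_l=P$, $l\ge1$, with $F_{j}/F_{j-1}\cong S$ for $1\le j\le l$, such that $0\to F_{j-1}\to F_{j}\to S\to0$ does not split for $2\le j\le l$. -/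

import Mathlib

open scoped BigOperators

namespace QDiff

/-! ## Convergent power series, germs of meromorphic functions, and the `q`-shift -/

section Series

variable {C : Type*} [NormedField C]

/-- A formal power series converges (has positive radius of convergence) if its coefficients
grow at most geometrically. -/
def IsConvergent (f : PowerSeries C) : Prop :=
  ∃ A B : ℝ, 0 < B ∧ ∀ n : ℕ, ‖PowerSeries.coeff n f‖ ≤ A * B ^ n

theorem IsConvergent.exists_one_le {f : PowerSeries C} (h : IsConvergent f) :
    ∃ A B : ℝ, 0 ≤ A ∧ 1 ≤ B ∧ ∀ n : ℕ, ‖PowerSeries.coeff n f‖ ≤ A * B ^ n := by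
  obtain ⟨A, B, hB, h⟩ := h
  have hA : 0 ≤ A := by simpa using (norm_nonneg _).trans (h 0)
  refine ⟨A, max B 1, hA, le_max_right _ _, fun n => (h n).trans ?_⟩
  gcongr
  exact le_max_left _ _

theorem isConvergent_algebraMap (c : C) : IsConvergent (PowerSeries.C c) := by
  refine ⟨‖c‖, 1, one_pos, fun n => ?_⟩
  rw [PowerSeries.coeff_C]
  split_ifs <;> simp

theorem IsConvergent.add {f g : PowerSeries C} (hf : IsConvergent f) (hg : IsConvergent g) :
    IsConvergent (f + g) := by
  obtain ⟨A, B, hA, hB, hf⟩ := hf.exists_one_le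
  obtain ⟨A', B', hA', hB', hg⟩ := hg.exists_one_le
  refine ⟨A + A', max B B', lt_of_lt_of_le one_pos (hB.trans (le_max_left _ _)), fun n => ?_⟩
  rw [map_add, add_mul]
  refine (norm_add_le _ _).trans (add_le_add ((hf n).trans ?_) ((hg n).trans ?_))
  · gcongr
    exact le_max_left _ _
  · gcongr
    exact le_max_right _ _

theorem IsConvergent.neg {f : PowerSeries C} (hf : IsConvergent f) : IsConvergent (-f) := by
  obtain ⟨A, B, hB, hf⟩ := hf
  exact ⟨A, B, hB, fun n => by simpa using hf n⟩

theorem IsConvergent.mul {f g : PowerSeries C} (hf : IsConvergent f) (hg : IsConvergent g) :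
    IsConvergent (f * g) := by
  obtain ⟨A, B, hA, hB, hf⟩ := hf.exists_one_le
  obtain ⟨A', B', hA', hB', hg⟩ := hg.exists_one_le
  have hD : 1 ≤ max B B' := hB.trans (le_max_left _ _)
  refine ⟨A * A', 2 * max B B', by linarith, fun n => ?_⟩
  rw [PowerSeries.coeff_mul]
  have key : ∀ p ∈ Finset.HasAntidiagonal.antidiagonal n,
      ‖PowerSeries.coeff p.1 f * PowerSeries.coeff p.2 g‖ ≤ A * A' * max B B' ^ n := by
    intro p hp
    rw [Finset.HasAntidiagonal.mem_antidiagonal] at hp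
    rw [norm_mul, ← hp, pow_add]
    calc ‖PowerSeries.coeff p.1 f‖ * ‖PowerSeries.coeff p.2 g‖
        ≤ (A * max B B' ^ p.1) * (A' * max B B' ^ p.2) := by
          refine mul_le_mul ((hf _).trans ?_) ((hg _).trans ?_) (norm_nonneg _) (by positivity)
          · gcongr
            exact le_max_left _ _
          · gcongr
            exact le_max_right _ _
      _ = A * A' * (max B B' ^ p.1 * max B B' ^ p.2) := by ring
  refine (norm_sum_le_of_le _ key).trans ?_
  rw [Finset.sum_const, Finset.Nat.card_antidiagonal, nsmul_eq_mul, mul_pow]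
  have h2 : ((n + 1 : ℕ) : ℝ) ≤ 2 ^ n := by exact_mod_cast Nat.lt_two_pow_self
  have h3 : 0 ≤ A * A' * max B B' ^ n := by positivity
  nlinarith [mul_le_mul_of_nonneg_right h2 h3]

theorem IsConvergent.rescale {f : PowerSeries C} (hf : IsConvergent f) (q : C) :
    IsConvergent (PowerSeries.rescale q f) := by
  obtain ⟨A, B, hA, hB, hf⟩ := hf.exists_one_le
  refine ⟨A, (‖q‖ + 1) * B, by positivity, fun n => ?_⟩
  rw [PowerSeries.coeff_rescale, norm_mul, norm_pow, mul_pow]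
  calc ‖q‖ ^ n * ‖PowerSeries.coeff n f‖ ≤ (‖q‖ + 1) ^ n * (A * B ^ n) := by
        gcongr
        · linarith
        · exact hf n
    _ = A * ((‖q‖ + 1) ^ n * B ^ n) := by ring

theorem IsConvergent.expand {f : PowerSeries C} (hf : IsConvergent f) (n : ℕ) (hn : n ≠ 0) :
    IsConvergent (PowerSeries.expand n hn f) := by
  obtain ⟨A, B, hA, hB, hf⟩ := hf.exists_one_le
  refine ⟨A, B, by linarith, fun m => ?_⟩
  rw [PowerSeries.coeff_expand]
  split_ifs with h
  · refine (hf _).trans ?_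
    exact mul_le_mul_of_nonneg_left (pow_le_pow_right₀ hB (Nat.div_le_self _ _)) hA
  · rw [norm_zero]
    positivity

variable (C) in
/-- The ring `C{x}` of convergent power series, i.e. of germs at `0` of analytic functions. -/
def convergentSubring : Subring (PowerSeries C) where
  carrier := {f | IsConvergent f}
  mul_mem' := IsConvergent.mul
  one_mem' := by simpa using isConvergent_algebraMap (1 : C)
  add_mem' := IsConvergent.add
  zero_mem' := by simpa using isConvergent_algebraMap (0 : C)
  neg_mem' := IsConvergent.neg

variable (C) in
/-- `C{x}` as a type. -/
abbrev Germ : Type _ := convergentSubring C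

variable (C) in
/-- The field `K = C({x})` of germs of meromorphic functions at `0`: the fraction field
of `C{x}`. -/
abbrev MeroGerm : Type _ := FractionRing (Germ C)

/-- The automorphism `f(x) ↦ f(qx)` of `C{x}`. -/
noncomputable def germShift (q : Cˣ) : Germ C ≃+* Germ C where
  toFun f := ⟨PowerSeries.rescale (q : C) f.1, IsConvergent.rescale f.2 _⟩
  invFun f := ⟨PowerSeries.rescale ((q⁻¹ : Cˣ) : C) f.1, IsConvergent.rescale f.2 _⟩
  left_inv f := by
    apply Subtype.ext
    simp [PowerSeries.rescale_rescale, PowerSeries.rescale_one]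
  right_inv f := by
    apply Subtype.ext
    simp [PowerSeries.rescale_rescale, PowerSeries.rescale_one]
  map_mul' f g := by
    apply Subtype.ext
    simp
  map_add' f g := by
    apply Subtype.ext
    simp

/-- The automorphism `σ_q : f(x) ↦ f(qx)` of `K = C({x})`. -/
noncomputable def shift (q : Cˣ) : MeroGerm C ≃+* MeroGerm C :=
  IsFractionRing.ringEquivOfRingEquiv (germShift q)

/-- The `q`-Pochhammer symbol `(a; q)_n = (1 - a)(1 - q a) ⋯ (1 - q^(n-1) a)`. -/
def qPochhammer (a q : C) (n : ℕ) : C := ∏ i ∈ Finset.range n, (1 - q ^ i * a)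

/-- The series `φ_{(q;Λ)}(x) = ∑ xⁿ / ∏_{a ∈ Λ} (a; q)_n`. -/
noncomputable def phi (q : C) (Λ : Finset C) : PowerSeries C :=
  PowerSeries.mk fun n => (∏ a ∈ Λ, qPochhammer a q n)⁻¹

end Series

/-! ## `q`-difference operators, Newton polygon, exponents, admissibility -/

/-- An operator `∑_{i ≤ ν} a_i(x) σ^i` with coefficients in `C{x}` and `a_ν ≠ 0`;
`ν` is its order. -/
structure Operator (C : Type*) [NormedField C] where
  order : ℕ
  coeff : ℕ → Germ C
  coeff_order_ne_zero : coeff order ≠ 0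
  coeff_eq_zero : ∀ i, order < i → coeff i = 0

namespace Operator

variable {C : Type*} [NormedField C]

/-- The order of vanishing at `0` of the `i`-th coefficient (used only if `a_i ≠ 0`). -/
noncomputable def ord (L : Operator C) (i : ℕ) : ℕ := (L.coeff i).1.order.toNat

/-- The indices `i` for which `(i, ord a_i)` lies on the supporting line of slope `μ` from below
of the Newton polygon, which is the convex hull of
`{(i, k) : a_i ≠ 0, k ≥ ord a_i}`. -/
def edge (L : Operator C) (μ : ℚ) : Set ℕ :=
  {i | L.coeff i ≠ 0 ∧ ∀ j, L.coeff j ≠ 0 → (L.ord i : ℚ) - μ * i ≤ (L.ord j : ℚ) - μ * j}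

/-- The Newton polygon of `L`, as the set of pairs `(μ, r)` where `μ` is a finite slope of the
lower boundary and `r > 0` is the length of the projection of the edge of slope `μ`
on the horizontal axis. -/
def newtonPolygon (L : Operator C) : Set (ℚ × ℕ) :=
  {P | 0 < P.2 ∧ ∃ i, IsLeast (L.edge P.1) i ∧ IsGreatest (L.edge P.1) (i + P.2)}

/-- `μ` is a slope of (the Newton polygon of) `L`. -/
def IsSlope (L : Operator C) (μ : ℚ) : Prop := ∃ r, (μ, r) ∈ L.newtonPolygon

/-- `L` is pure of slope `μ`: its Newton polygon has exactly one slope, equal to `μ`. -/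
def IsPure (L : Operator C) (μ : ℚ) : Prop := ∀ s, L.IsSlope s ↔ s = μ

open Classical in
/-- The characteristic polynomial of the integral slope `d` of `L`, seen as an operator in the
`q`-shift. The operator `x^c θ^d L θ^{-d}`, where `θ(qx) = x θ(x)`, has coefficients
`q^{-d i(i-1)/2} x^{c - d i} a_i(x)`; with `c` chosen so that the edge of slope `d` goes to the
horizontal axis, the characteristic polynomial is `∑ b_i(0) T^i`, `b_i` being these
coefficients. -/
noncomputable def charPoly (L : Operator C) (q : Cˣ) (d : ℤ) : Polynomial C :=
  ∑ i ∈ Finset.range (L.order + 1),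
    if i ∈ L.edge d then
      Polynomial.monomial i
        (((q ^ (-(d * (i.choose 2 : ℤ))) : Cˣ) : C) * PowerSeries.coeff (L.ord i) (L.coeff i).1)
    else 0

open Classical in
/-- The exponents of the integral slope `d`: the nonzero roots, with multiplicity, of the
characteristic polynomial. -/
noncomputable def exponents (L : Operator C) (q : Cˣ) (d : ℤ) : Multiset C :=
  (L.charPoly q d).roots.filter (· ≠ 0)

open Classical in
/-- The set of the quotients `a b⁻¹` of exponents of the slope `d` that are not in
`q^{ℤ_{≤ 0}}`. -/
noncomputable def exponentRatios (L : Operator C) (q : Cˣ) (d : ℤ) : Finset C :=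
  (((L.exponents q d).toFinset ×ˢ (L.exponents q d).toFinset).image
    (fun z => z.1 * z.2⁻¹)).filter (fun z => ¬ ∃ m : ℕ, z = ((q ^ (-(m : ℤ)) : Cˣ) : C))

/-- The integral slope `d` of `L` (an operator in the `q`-shift) is admissible. -/
def IsAdmissibleSlope (L : Operator C) (q : Cˣ) (d : ℤ) : Prop :=
  IsConvergent (phi (q : C) (L.exponentRatios q d))

/-- The ramified operator `∑ a_i(tⁿ) σ^i`, with coefficients in `C{t}`, `t = x^{1/n}`. -/
noncomputable def ramify (L : Operator C) (n : ℕ) (hn : n ≠ 0) : Operator C where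
  order := L.order
  coeff i := ⟨PowerSeries.expand n hn (L.coeff i).1, IsConvergent.expand (L.coeff i).2 n hn⟩
  coeff_order_ne_zero := by
    intro h
    apply L.coeff_order_ne_zero
    have h' : PowerSeries.expand n hn (L.coeff L.order).1 = 0 := congrArg Subtype.val h
    apply Subtype.ext
    ext m
    have := congrArg (PowerSeries.coeff (n * m)) h'
    simpa [PowerSeries.coeff_expand_mul] using this
  coeff_eq_zero i hi := by
    apply Subtype.ext
    simp [L.coeff_eq_zero i hi]

/-- The slope `μ` of `L` is almost admissible, where `rt n` is the chosen `n`-th root `q^{1/n}`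
of `q`: for some `n > 0` the slope `nμ` of the ramified operator, which is an operator in the
`q^{1/n}`-shift of the variable `t = x^{1/n}`, is an integer and is admissible. -/
def IsAlmostAdmissibleSlope (L : Operator C) (rt : ℕ → Cˣ) (μ : ℚ) : Prop :=
  ∃ (n : ℕ) (hn : n ≠ 0) (d : ℤ), (d : ℚ) = n * μ ∧ (L.ramify n hn).IsAdmissibleSlope (rt n) d

/-- `L` is almost admissible: all its slopes are. -/
def IsAlmostAdmissible (L : Operator C) (rt : ℕ → Cˣ) : Prop :=
  ∀ μ, L.IsSlope μ → L.IsAlmostAdmissibleSlope rt μ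

end Operator

/-! ## `q`-difference modules -/

/-- A structure of `q`-difference module on a (finite-dimensional) vector space `M` over
`K = C({x})`: a bijective additive map `Σ` such that `Σ(f m) = σ_q(f) Σ(m)`. -/
structure DiffModule {C : Type*} [NormedField C] (q : Cˣ)
    (M : Type*) [AddCommGroup M] [Module (MeroGerm C) M] where
  Sig : M →ₛₗ[(shift q : MeroGerm C →+* MeroGerm C)] M
  bijective : Function.Bijective Sig

namespace DiffModule

variable {C : Type*} [NormedField C] {q : Cˣ}
variable {M : Type*} [AddCommGroup M] [Module (MeroGerm C) M]
variable {W : Type*} [AddCommGroup W] [Module (MeroGerm C) W]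

/-- `M` is associated to `L`, i.e. `M ≅ K[σ_q] / K[σ_q] L`: there is an element `m` (the image of
`1`) such that `m, Σ m, …, Σ^{ν-1} m`, with `ν` the order of `L`, is a `K`-basis of `M` and
`L m = ∑ a_i Σ^i m = 0`. -/
def IsAssociated (D : DiffModule q M) (L : Operator C) : Prop :=
  ∃ m : M, LinearIndependent (MeroGerm C) (fun i : Fin L.order => D.Sig^[i] m) ∧
    Submodule.span (MeroGerm C) (Set.range fun i : Fin L.order => D.Sig^[i] m) = ⊤ ∧
    ∑ i ∈ Finset.range (L.order + 1),
      algebraMap (Germ C) (MeroGerm C) (L.coeff i) • D.Sig^[i] m = 0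

/-- The set `P` of pairs `(slope, length)` is the Newton polygon of `M`: that of an operator
associated to `M`. -/
def HasNewtonPolygon (D : DiffModule q M) (P : Set (ℚ × ℕ)) : Prop :=
  ∃ L, D.IsAssociated L ∧ L.newtonPolygon = P

/-- `M` is almost admissible: it is associated to an almost admissible operator. -/
def IsAlmostAdmissible (D : DiffModule q M) (rt : ℕ → Cˣ) : Prop :=
  ∃ L, D.IsAssociated L ∧ L.IsAlmostAdmissible rt

/-- `M` is pure of slope `μ`: it is associated to an operator which is pure of slope `μ`. -/
def IsPure (D : DiffModule q M) (μ : ℚ) : Prop :=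
  ∃ L, D.IsAssociated L ∧ L.IsPure μ

/-- A sub-`q`-difference module: a subspace `N` with `Σ(N) = N`. -/
def IsSub (D : DiffModule q M) (N : Submodule (MeroGerm C) M) : Prop :=
  ∀ m, D.Sig m ∈ N ↔ m ∈ N

/-- The `q`-difference module `(N, Σ|_N)` defined by a sub-`q`-difference module `N`. -/
noncomputable def restrict (D : DiffModule q M) (N : Submodule (MeroGerm C) M) (h : D.IsSub N) :
    DiffModule q N where
  Sig :=
    { toFun := fun m => ⟨D.Sig m, (h m).2 m.2⟩
      map_add' := fun a b => Subtype.ext (by simp)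
      map_smul' := fun a b => Subtype.ext (by simp) }
  bijective := by
    constructor
    · intro a b hab
      exact Subtype.ext (D.bijective.1 (congrArg Subtype.val hab))
    · rintro ⟨b, hb⟩
      obtain ⟨a, rfl⟩ := D.bijective.2 b
      exact ⟨⟨a, (h a).1 hb⟩, rfl⟩

/-- `M` is simple: it is nonzero and has no sub-`q`-difference modules besides `0` and `M`. -/
def IsSimple (D : DiffModule q M) : Prop :=
  Nontrivial M ∧ ∀ N, D.IsSub N → N = ⊥ ∨ N = ⊤

/-- `M` is indecomposable: it is nonzero and is not the direct sum of two nonzero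
sub-`q`-difference modules. -/
def IsIndecomposable (D : DiffModule q M) : Prop :=
  Nontrivial M ∧ ∀ A B, D.IsSub A → D.IsSub B → IsCompl A B → A = ⊥ ∨ B = ⊥

/-- For sub-`q`-difference modules `N`, `N'` of `M`: `N ⊆ N'` and the quotient `N' / N` is
isomorphic to `S`, i.e. there is an exact sequence `0 → N → N' → S → 0` of
`q`-difference modules. -/
def IsExtension (D : DiffModule q M) (S : DiffModule q W) (N N' : Submodule (MeroGerm C) M) : Prop :=
  N ≤ N' ∧ ∃ h' : D.IsSub N', ∃ φ : N' →ₗ[MeroGerm C] W, Function.Surjective φ ∧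
    (∀ x, φ ((D.restrict N' h').Sig x) = S.Sig (φ x)) ∧ ∀ x : N', φ x = 0 ↔ (x : M) ∈ N

/-- The inclusion `N ⊆ N'` splits: `N' = N ⊕ T` for some sub-`q`-difference module `T`. -/
def IsSplit (D : DiffModule q M) (N N' : Submodule (MeroGerm C) M) : Prop :=
  ∃ T, D.IsSub T ∧ N ⊔ T = N' ∧ N ⊓ T = ⊥

/-- The sub-`q`-difference modules of `M` which are obtained from a copy of `S` by iterated
non-split extensions `0 → N → N' → S → 0`. -/
inductive IsIteratedSub (D : DiffModule q M) (S : DiffModule q W) : Submodule (MeroGerm C) M → Prop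
  | base (N : Submodule (MeroGerm C) M) : D.IsExtension S ⊥ N → IsIteratedSub D S N
  | step (N N' : Submodule (MeroGerm C) M) : IsIteratedSub D S N → D.IsExtension S N N' →
      ¬ D.IsSplit N N' → IsIteratedSub D S N'

/-- `M` is an iterated nontrivial extension of a simple almost admissible `q`-difference module
`S` by itself. (Such an `S` is isomorphic to a submodule of `M`, and is taken as such.) -/
def IsIteratedSelfExtension (D : DiffModule q M) (rt : ℕ → Cˣ) : Prop :=
  ∃ (S : Submodule (MeroGerm C) M) (h : D.IsSub S),
    (D.restrict S h).IsSimple ∧ (D.restrict S h).IsAlmostAdmissible rt ∧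
      D.IsIteratedSub (D.restrict S h) ⊤

end DiffModule

end QDiff

set_option linter.unusedSectionVars false
set_option linter.unusedVariables false

namespace QDiff

/-! ## Sequences with geometrically bounded products -/

section GeoBdd

/-! Operators are skew polynomials, stored in `K[X]` with `comp` as product, and they act on modules
through `ev`. For a slope μ = d/n in lowest terms and a nonzero constant c, the basic module is
C({t}), tⁿ = x, with Σf(t) = c t^{-d} f(pt), pⁿ = q (`RamK`, `tw`). It is simple: coprimality of d
and n forces every nonzero operator killing a nonzero element to have order at least n
(`le_natDegree_of_ev_tw`, `isMin_tw`). The annihilator of its element 1 is generated by x^d σⁿ - λ,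
where λ = cⁿ p^{-d n(n-1)/2} (`isMin_tau`).

On a basic module an operator becomes a recursion on the coefficients in t, with divisors P(c p^m),
where P is the initial form of the operator along the slope (`HasInit`). As |q| = 1, nothing makes
these divisors large, and convergence of the solution follows once the products of their inverses
grow geometrically (`GeoBdd`, `exists_germ_solution`). Almost admissibility supplies this bound for
all differences of exponents (`exists_exponentData`).

Three consequences carry the theorem. An operator of positive order killing an element has a nonzero
solution in some basic module, hence a right factor whose quotient is basic (`exists_slope_root`,
`exists_ev_tw_eq_zero`). An operator x^{d₂} σ^{n₂} - λ₂ is surjective on a basic module of another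
slope, or of the same slope with λ and λ₂ different modulo q^ℤ, so such modules do not extend each
other (`exists_model_eq`). If slopes and multipliers agree, the image together with the constants is
everything (`exists_ev_tau_add_const`), while no nonzero constant lies in the image
(`eq_zero_of_ev_tau_eq_const`): a basic module has, up to scalars, one nontrivial self-extension.

So the module admits a Jordan form. By induction on the order of an annihilating operator,
generators are found on which powers of the operators x^d σⁿ - λ vanish, a new generator either
opening a block or lengthening the longest block it interacts with (`exists_jordanSystem`,
`JordanSystem.extend`). The dimensions add up to that of M, so the blocks are in direct sum, and
grouping them by slope gives the M_i. Every submodule meeting a block contains its socle, so blocks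
are indecomposable, and their layers do not split because 1 is not in the image above
(`iterate_act_mem`, `inf_ne_bot_of_sup_eq`).

Ranks are read off by multiplicativity of initial forms: each layer of slope μ contributes its
dimension to the edge of slope μ and nothing elsewhere (`JordanSystem.natDegree_eq`). Almost
admissibility descends to summands because the roots of the initial form of a right factor are among
those of the product (`IsAlmostAdmissiblePoly.of_comp`, `IsAAGenerated.of_isInternal`). -/

/-- The products of the numbers `max 1 (s i)`, `i < k`, grow at most geometrically. -/
def GeoBdd (s : ℕ → ℝ) : Prop :=
  ∃ A B : ℝ, 0 ≤ A ∧ 0 ≤ B ∧ ∀ k, ∏ i ∈ Finset.range k, max 1 (s i) ≤ A * B ^ k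

theorem GeoBdd.mono {s u : ℕ → ℝ} (hu : GeoBdd u) (h : ∀ i, s i ≤ max 1 (u i)) : GeoBdd s := by
  obtain ⟨A, B, hA, hB, hk⟩ := hu
  refine ⟨A, B, hA, hB, fun k => le_trans ?_ (hk k)⟩
  exact Finset.prod_le_prod (fun i _ => zero_le_one.trans (le_max_left _ _))
    fun i _ => max_le (le_max_left _ _) (h i)

theorem geoBdd_of_le {s : ℕ → ℝ} (c : ℝ) (h : ∀ i, s i ≤ c) : GeoBdd s := by
  refine ⟨1, max 1 c, zero_le_one, zero_le_one.trans (le_max_left _ _), fun k => ?_⟩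
  rw [one_mul]
  calc ∏ i ∈ Finset.range k, max 1 (s i) ≤ ∏ _i ∈ Finset.range k, max 1 c :=
        Finset.prod_le_prod (fun i _ => zero_le_one.trans (le_max_left _ _))
          fun i _ => max_le_max le_rfl (h i)
    _ = max 1 c ^ k := by simp

theorem GeoBdd.mul {s u : ℕ → ℝ} (hs : GeoBdd s) (hu : GeoBdd u) (hs0 : ∀ i, 0 ≤ s i) :
    GeoBdd fun i => s i * u i := by
  obtain ⟨A, B, hA, hB, hk⟩ := hs
  obtain ⟨A', B', hA', hB', hk'⟩ := hu
  refine ⟨A * A', B * B', by positivity, by positivity, fun k => ?_⟩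
  calc ∏ i ∈ Finset.range k, max 1 (s i * u i)
      ≤ ∏ i ∈ Finset.range k, (max 1 (s i) * max 1 (u i)) := by
        refine Finset.prod_le_prod (fun i _ => zero_le_one.trans (le_max_left _ _)) fun i _ => ?_
        refine max_le (one_le_mul_of_one_le_of_one_le (le_max_left _ _) (le_max_left _ _)) ?_
        calc s i * u i ≤ s i * max 1 (u i) :=
              mul_le_mul_of_nonneg_left (le_max_right _ _) (hs0 i)
          _ ≤ _ := mul_le_mul_of_nonneg_right (le_max_right _ _)
              (zero_le_one.trans (le_max_left _ _))
    _ ≤ (A * B ^ k) * (A' * B' ^ k) := by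
        rw [Finset.prod_mul_distrib]
        refine mul_le_mul (hk k) (hk' k) ?_ (by positivity)
        exact Finset.prod_nonneg fun i _ => zero_le_one.trans (le_max_left _ _)
    _ = _ := by ring

theorem GeoBdd.multiset_prod {ι : Type*} (t : Multiset ι) {s : ι → ℕ → ℝ}
    (h : ∀ a ∈ t, GeoBdd (s a)) (h0 : ∀ a ∈ t, ∀ i, 0 ≤ s a i) :
    GeoBdd fun i => (t.map fun a => s a i).prod := by
  induction t using Multiset.induction_on with
  | empty => exact geoBdd_of_le 1 fun i => by simp
  | cons a t ih =>
    simp only [Multiset.map_cons, Multiset.prod_cons]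
    exact (h a (Multiset.mem_cons_self _ _)).mul
      (ih (fun b hb => h b (Multiset.mem_cons_of_mem hb))
        fun b hb => h0 b (Multiset.mem_cons_of_mem hb)) (h0 a (Multiset.mem_cons_self _ _))

/-- The product over the multiples of g is a partial product of g * k factors, and the omitted
factors are at least 1 thanks to the `max`. It serves to pass from a root of `q` to its g-th power.
-/
theorem GeoBdd.comp_mul {s : ℕ → ℝ} (hs : GeoBdd s) {g : ℕ} (hg : g ≠ 0) :
    GeoBdd fun i => s (g * i) := by
  obtain ⟨A, B, hA, hB, hk⟩ := hs
  refine ⟨A, B ^ g, hA, by positivity, fun k => ?_⟩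
  rw [← pow_mul]
  refine le_trans ?_ (hk (g * k))
  calc ∏ i ∈ Finset.range k, max 1 (s (g * i))
      = ∏ j ∈ (Finset.range k).image (g * ·), max 1 (s j) := by
        rw [Finset.prod_image]
        intro a _ b _ hab
        exact Nat.eq_of_mul_eq_mul_left (Nat.pos_of_ne_zero hg) hab
    _ ≤ _ := by
        have hsub : (Finset.range k).image (g * ·) ⊆ Finset.range (g * k) := by
          intro j hj
          simp only [Finset.mem_image, Finset.mem_range] at hj ⊢
          obtain ⟨i, hi, rfl⟩ := hj
          exact Nat.mul_lt_mul_of_pos_left hi (Nat.pos_of_ne_zero hg)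
        rw [← Finset.prod_sdiff hsub]
        refine le_mul_of_one_le_left
          (Finset.prod_nonneg fun i _ => zero_le_one.trans (le_max_left _ _)) ?_
        exact Finset.one_le_prod (fun i _ => le_max_left _ _)

theorem GeoBdd.succ {s : ℕ → ℝ} (hs : GeoBdd s) : GeoBdd fun i => s (i + 1) := by
  obtain ⟨A, B, hA, hB, hk⟩ := hs
  refine ⟨A * B, B, by positivity, hB, fun k => ?_⟩
  have h := hk (k + 1)
  rw [Finset.prod_range_succ'] at h
  have h1 : 1 ≤ max 1 (s 0) := le_max_left _ _
  have h2 : 0 ≤ ∏ i ∈ Finset.range k, max 1 (s (i + 1)) :=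
    Finset.prod_nonneg fun i _ => zero_le_one.trans (le_max_left _ _)
  calc _ ≤ _ := le_mul_of_one_le_right h2 h1
    _ ≤ _ := h
    _ = _ := by ring

theorem GeoBdd.of_succ {s : ℕ → ℝ} (hs : GeoBdd fun i => s (i + 1)) : GeoBdd s := by
  obtain ⟨A, B, hA, hB, hk⟩ := hs
  refine ⟨max 1 (A * max 1 (s 0)), max B 1, by positivity, by positivity, fun k => ?_⟩
  cases k with
  | zero => simp
  | succ k =>
    rw [Finset.prod_range_succ']
    calc _ ≤ (A * B ^ k) * max 1 (s 0) :=
          mul_le_mul_of_nonneg_right (hk k) (zero_le_one.trans (le_max_left _ _))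
      _ = (A * max 1 (s 0)) * B ^ k := by ring
      _ ≤ max 1 (A * max 1 (s 0)) * max B 1 ^ (k + 1) := by
          refine mul_le_mul (le_max_right _ _) ?_ (by positivity) (by positivity)
          calc B ^ k ≤ max B 1 ^ k := pow_le_pow_left₀ hB (le_max_left _ _) _
            _ ≤ _ := pow_le_pow_right₀ (le_max_right _ _) (Nat.le_succ k)

end GeoBdd

/-! ## Solving linear `q`-difference equations in convergent power series -/

section Adams

variable {C : Type*} [NormedField C]

theorem sum_pow_recursion (A : ℝ) (m : ℕ) :
    1 + A * ∑ k ∈ Finset.range m, (1 + A) ^ k = (1 + A) ^ m := by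
  induction m with
  | zero => simp
  | succ m ih => rw [Finset.sum_range_succ, mul_add, ← add_assoc, ih, pow_succ]; ring

/-- A sequence of geometric growth. -/
theorem growth_of_recursion {s : ℕ → ℝ} (hs : GeoBdd s) (y : ℕ → C) {A₁ A₂ B : ℝ} (hA₁ : 0 ≤ A₁)
    (hB : 0 ≤ B) (hA₂ : 0 ≤ A₂)
    (hy : ∀ m, ‖y m‖ ≤ max 1 (s m) *
      (A₂ * B ^ m + ∑ k ∈ Finset.range m, A₁ * B ^ (m - k) * ‖y k‖)) :
    ∃ A B' : ℝ, 0 < B' ∧ ∀ m, ‖y m‖ ≤ A * B' ^ m := by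
  set w : ℕ → ℝ := fun m => ∏ i ∈ Finset.range m, max 1 (s i) with hw
  have hw1 : ∀ m, 1 ≤ w m := fun m => by
    rw [hw]; exact Finset.one_le_prod (fun i _ => le_max_left _ _)
  have hwm : Monotone w := monotone_nat_of_le_succ fun m => by
    simp only [hw, Finset.prod_range_succ]
    exact le_mul_of_one_le_right (zero_le_one.trans (hw1 m)) (le_max_left _ _)
  -- The weight `w` is monotone, so each divisor is paid for once rather than once per term of the
  -- convolution; the base 1 + A₁ is the one for which `sum_pow_recursion` closes the induction
  -- exactly.
  have key : ∀ m, ‖y m‖ ≤ w (m + 1) * (A₂ * ((1 + A₁) * B) ^ m) := by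
    intro m
    induction m using Nat.strong_induction_on with
    | _ m ih =>
      have h1 : A₂ * B ^ m + ∑ k ∈ Finset.range m, A₁ * B ^ (m - k) * ‖y k‖ ≤
          w m * (A₂ * ((1 + A₁) * B) ^ m) := by
        calc _ ≤ w m * (A₂ * B ^ m) + ∑ k ∈ Finset.range m,
              A₁ * B ^ (m - k) * (w m * (A₂ * ((1 + A₁) * B) ^ k)) := by
              refine add_le_add (le_mul_of_one_le_left (by positivity) (hw1 m))
                (Finset.sum_le_sum fun k hk => ?_)
              refine mul_le_mul_of_nonneg_left ((ih k (Finset.mem_range.1 hk)).trans ?_)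
                (by positivity)
              refine mul_le_mul_of_nonneg_right (hwm (Finset.mem_range.1 hk)) (by positivity)
          _ = w m * (A₂ * B ^ m * (1 + A₁ * ∑ k ∈ Finset.range m, (1 + A₁) ^ k)) := by
              rw [mul_add, mul_add, mul_one, Finset.mul_sum, Finset.mul_sum, Finset.mul_sum]
              congr 1
              refine Finset.sum_congr rfl fun k hk => ?_
              have : B ^ m = B ^ (m - k) * B ^ k := by
                rw [← pow_add, Nat.sub_add_cancel (Finset.mem_range.1 hk).le]
              rw [this, mul_pow]; ring
          _ = _ := by rw [sum_pow_recursion, mul_pow]; ring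
      calc ‖y m‖ ≤ _ := hy m
        _ ≤ max 1 (s m) * (w m * (A₂ * ((1 + A₁) * B) ^ m)) :=
            mul_le_mul_of_nonneg_left h1 (zero_le_one.trans (le_max_left _ _))
        _ = _ := by simp only [hw, Finset.prod_range_succ]; ring
  obtain ⟨A, D, hA, hD, hk⟩ := hs
  refine ⟨A * D * A₂, max 1 (D * ((1 + A₁) * B)), by positivity, fun m => ?_⟩
  calc ‖y m‖ ≤ _ := key m
    _ ≤ (A * D ^ (m + 1)) * (A₂ * ((1 + A₁) * B) ^ m) :=
        mul_le_mul_of_nonneg_right (hk _) (by positivity)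
    _ = A * D * A₂ * (D * ((1 + A₁) * B)) ^ m := by rw [mul_pow D]; ring
    _ ≤ _ := by
        refine mul_le_mul_of_nonneg_left ?_ (by positivity)
        exact pow_le_pow_left₀ (by positivity) (le_max_right _ _) _

theorem coeff_germShift_iterate (r : Cˣ) (i : ℕ) (y : Germ C) (k : ℕ) :
    PowerSeries.coeff k ((germShift r)^[i] y).1 = (r : C) ^ (i * k) * PowerSeries.coeff k y.1 := by
  induction i with
  | zero => simp
  | succ i ih =>
    rw [Function.iterate_succ_apply']
    change PowerSeries.coeff k (PowerSeries.rescale (r : C) _) = _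
    rw [PowerSeries.coeff_rescale, ih]; ring

/-- The inhomogeneous equation `∑ b_i(x) y(r^i x) = f(x)`, under a small divisors condition. -/
theorem exists_germ_solution (b : ℕ → Germ C) (ν : ℕ) (r : Cˣ) (hr : ‖(r : C)‖ = 1)
    (P : ℕ → C)
    (hP : ∀ m, P m = ∑ i ∈ Finset.range ν, PowerSeries.constantCoeff (b i).1 * (r : C) ^ (i * m))
    (hP0 : ∀ m, P m ≠ 0) (hG : GeoBdd fun m => ‖P m‖⁻¹) (f : Germ C) :
    ∃ y : Germ C, ∑ i ∈ Finset.range ν, b i * (germShift r)^[i] y = f := by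
  -- `c j k` is the factor with which the k-th coefficient of y enters the coefficient of index j +
  -- k; as |r| = 1 its bound is uniform in k, and `c 0 m` is the divisor `P m`.
  let c : ℕ → ℕ → C := fun j k =>
    ∑ i ∈ Finset.range ν, PowerSeries.coeff j (b i).1 * (r : C) ^ (i * k)
  have hc : ∃ A B : ℝ, 0 ≤ A ∧ 1 ≤ B ∧ ∀ j k, ‖c j k‖ ≤ A * B ^ j := by
    have : ∀ i, ∃ A B : ℝ, 0 ≤ A ∧ 1 ≤ B ∧ ∀ j, ‖PowerSeries.coeff j (b i).1‖ ≤ A * B ^ j :=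
      fun i => (b i).2.exists_one_le
    choose A B hA hB h using this
    have hB' : ∀ i ∈ Finset.range ν, B i ≤ 1 + ∑ l ∈ Finset.range ν, B l := fun i hi => by
      have := Finset.single_le_sum (fun l _ => zero_le_one.trans (hB l)) hi
      linarith
    have h0 : 0 ≤ ∑ l ∈ Finset.range ν, B l :=
      Finset.sum_nonneg fun l _ => zero_le_one.trans (hB l)
    refine ⟨∑ i ∈ Finset.range ν, A i, 1 + ∑ i ∈ Finset.range ν, B i,
      Finset.sum_nonneg fun i _ => hA i, by linarith, fun j k => ?_⟩
    rw [Finset.sum_mul]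
    refine (norm_sum_le _ _).trans (Finset.sum_le_sum fun i hi => ?_)
    rw [norm_mul, norm_pow, hr, one_pow, mul_one]
    refine (h i j).trans (mul_le_mul_of_nonneg_left ?_ (hA i))
    exact pow_le_pow_left₀ (zero_le_one.trans (hB i)) (hB' i hi) _
  obtain ⟨A₁, B₁, hA₁, hB₁, hc⟩ := hc
  obtain ⟨A₂, B₂, hA₂, hB₂, hf⟩ := f.2.exists_one_le
  let rec_ : (m : ℕ) → ((k : ℕ) → k < m → C) → C := fun m g =>
    (P m)⁻¹ * (PowerSeries.coeff m f.1 -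
      ∑ k : Fin m, c (m - k) k * g k k.2)
  let y : ℕ → C := fun m => Nat.strongRecOn m rec_
  have hy : ∀ m, y m = (P m)⁻¹ * (PowerSeries.coeff m f.1 -
      ∑ k ∈ Finset.range m, c (m - k) k * y k) := by
    intro m
    have h1 : y m = rec_ m (fun k _ => y k) := Nat.strongRecOn_eq _ _
    rw [h1, Finset.sum_range]
  have hconv : IsConvergent (PowerSeries.mk y) := by
    obtain ⟨A, B', hB', h⟩ := growth_of_recursion hG y (A₁ := A₁) (A₂ := A₂) (B := max B₁ B₂) hA₁
      (by positivity) hA₂ (fun m => by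
        rw [hy m, norm_mul, norm_inv]
        refine mul_le_mul (le_max_right _ _) ?_ (norm_nonneg _)
          (zero_le_one.trans (le_max_left _ _))
        refine (norm_sub_le _ _).trans (add_le_add ((hf m).trans ?_) ((norm_sum_le _ _).trans
          (Finset.sum_le_sum fun k _ => ?_)))
        · exact mul_le_mul_of_nonneg_left (pow_le_pow_left₀ (zero_le_one.trans hB₂)
            (le_max_right _ _) _) hA₂
        · rw [norm_mul]
          refine mul_le_mul_of_nonneg_right ((hc _ _).trans ?_) (norm_nonneg _)
          exact mul_le_mul_of_nonneg_left (pow_le_pow_left₀ (zero_le_one.trans hB₁)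
            (le_max_left _ _) _) hA₁)
    exact ⟨A, B', hB', fun n => by simpa using h n⟩
  refine ⟨⟨PowerSeries.mk y, hconv⟩, Subtype.ext (PowerSeries.ext fun m => ?_)⟩
  have e1 : ((∑ i ∈ Finset.range ν, b i * (germShift r)^[i] ⟨PowerSeries.mk y, hconv⟩ : Germ C)).1 =
      ∑ i ∈ Finset.range ν, (b i).1 * ((germShift r)^[i] ⟨PowerSeries.mk y, hconv⟩).1 := by
    push_cast; rfl
  rw [e1, map_sum]
  have e2 : ∀ i ∈ Finset.range ν, PowerSeries.coeff m
      ((b i).1 * ((germShift r)^[i] ⟨PowerSeries.mk y, hconv⟩).1) =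
      ∑ k ∈ Finset.range (m + 1), PowerSeries.coeff (m - k) (b i).1 * (r : C) ^ (i * k) * y k := by
    intro i _
    rw [mul_comm, PowerSeries.coeff_mul, Finset.Nat.sum_antidiagonal_eq_sum_range_succ_mk]
    refine Finset.sum_congr rfl fun k _ => ?_
    rw [coeff_germShift_iterate, PowerSeries.coeff_mk]; ring
  rw [Finset.sum_congr rfl e2, Finset.sum_comm]
  simp only [← Finset.sum_mul]
  change ∑ k ∈ Finset.range (m + 1), c (m - k) k * y k = _
  rw [Finset.sum_range_succ, Nat.sub_self]
  have e3 : c 0 m = P m := by rw [hP]; simp [c]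
  rw [e3, hy m, mul_inv_cancel_left₀ (hP0 m)]
  ring

/-- The inverse is the solution of u y = 1, an equation of order zero with constant divisor u(0). -/
theorem isUnit_germ (u : Germ C) (hu : PowerSeries.constantCoeff u.1 ≠ 0) : IsUnit u := by
  obtain ⟨y, hy⟩ := exists_germ_solution (fun _ => u) 1 1 (by simp)
    (fun _ => PowerSeries.constantCoeff u.1) (fun m => by simp) (fun _ => hu)
    (geoBdd_of_le _ fun _ => le_rfl) 1
  rw [Finset.sum_range_one] at hy
  exact IsUnit.of_mul_eq_one _ hy

end Adams

/-! ## Skew polynomials acting on modules with a semilinear operator -/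

section Ops

open Polynomial

variable {K : Type*} [Field K] {σ : K ≃+* K}
variable {M : Type*} [AddCommGroup M] [Module K M] (S : M →ₛₗ[(σ : K →+* K)] M)
variable {M' : Type*} [AddCommGroup M'] [Module K M'] (S' : M' →ₛₗ[(σ : K →+* K)] M')

/-- The action `A ↦ A m = ∑ a_i S^i m` of operators on an element `m`. -/
noncomputable def ev (m : M) : K[X] →ₗ[K] M :=
  Polynomial.lsum fun i => LinearMap.toSpanSingleton K M (S^[i] m)

theorem ev_apply (m : M) (A : K[X]) : ev S m A = A.sum fun i a => a • S^[i] m := by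
  simp [ev]

@[simp]
theorem ev_monomial (m : M) (i : ℕ) (a : K) : ev S m (monomial i a) = a • S^[i] m := by
  rw [ev_apply, sum_monomial_index _ _ (by simp)]

@[simp]
theorem ev_C (m : M) (a : K) : ev S m (C a) = a • m := by
  rw [← monomial_zero_left, ev_monomial]; rfl

theorem ev_one (m : M) : ev S m 1 = m := by rw [← C_1, ev_C, one_smul]

theorem ev_eq_sum_range (m : M) (A : K[X]) {n : ℕ} (hn : A.natDegree < n) :
    ev S m A = ∑ i ∈ Finset.range n, A.coeff i • S^[i] m := by
  rw [ev_apply, Polynomial.sum_over_range' _ _ _ hn]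
  simp

theorem ev_zero_left (A : K[X]) : ev S 0 A = 0 := by
  rw [ev_apply]
  have : ∀ i, S^[i] 0 = 0 := fun i => Function.iterate_fixed (map_zero S) i
  simp [this, Polynomial.sum]

theorem ev_add_left (m m' : M) (A : K[X]) : ev S (m + m') A = ev S m A + ev S m' A := by
  have : ∀ i, S^[i] (m + m') = S^[i] m + S^[i] m' := fun i => iterate_map_add S i m m'
  simp only [ev_apply, Polynomial.sum, this, smul_add, Finset.sum_add_distrib]

variable (σ) in
/-- The product `X R` of skew polynomials. -/
noncomputable def skewX (R : K[X]) : K[X] := X * R.map (σ : K →+* K)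

variable (σ) in
/-- The composition of operators. -/
noncomputable def comp (Q R : K[X]) : K[X] := Q.sum fun i a => C a * (skewX σ)^[i] R

theorem ev_skewX (m : M) (R : K[X]) : ev S m (skewX σ R) = S (ev S m R) := by
  induction R using Polynomial.induction_on' with
  | add p q hp hq =>
    have : skewX σ (p + q) = skewX σ p + skewX σ q := by simp [skewX, mul_add]
    rw [this, map_add, hp, hq, map_add, map_add]
  | monomial i a =>
    have : skewX σ (monomial i a) = monomial (i + 1) (σ a) := by
      simp [skewX, X_mul_monomial]
    rw [this, ev_monomial, ev_monomial, LinearMap.map_smulₛₗ, Function.iterate_succ_apply']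
    rfl

theorem ev_skewX_iterate (m : M) (R : K[X]) (i : ℕ) :
    ev S m ((skewX σ)^[i] R) = S^[i] (ev S m R) := by
  induction i with
  | zero => rfl
  | succ i ih => rw [Function.iterate_succ_apply', Function.iterate_succ_apply', ev_skewX, ih]

/-- This identity is what makes `comp` the right product: left multiples of an operator killing m
also kill m. -/
theorem ev_comp (m : M) (Q R : K[X]) : ev S m (comp σ Q R) = ev S (ev S m R) Q := by
  rw [comp, Polynomial.sum, map_sum, ev_apply, Polynomial.sum]
  refine Finset.sum_congr rfl fun i _ => ?_
  rw [← smul_eq_C_mul, map_smul, ev_skewX_iterate]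

theorem coeff_skewX_iterate (R : K[X]) (i j : ℕ) :
    ((skewX σ)^[i] R).coeff j = if i ≤ j then σ^[i] (R.coeff (j - i)) else 0 := by
  induction i generalizing j with
  | zero => simp
  | succ i ih =>
    rw [Function.iterate_succ_apply', skewX]
    cases j with
    | zero => simp
    | succ j =>
      rw [coeff_X_mul, coeff_map, ih, Nat.add_sub_add_right, Function.iterate_succ_apply']
      by_cases h : i ≤ j <;> simp [h]

theorem coeff_comp (Q R : K[X]) (k : ℕ) :
    (comp σ Q R).coeff k =
      ∑ i ∈ Finset.range (k + 1), Q.coeff i * σ^[i] (R.coeff (k - i)) := by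
  rw [comp, Polynomial.sum_over_range' _ _ (max (Q.natDegree + 1) (k + 1)) (by simp),
    finsetSum_coeff]
  · simp only [coeff_C_mul, coeff_skewX_iterate]
    symm
    apply Finset.sum_subset_zero_on_sdiff
    · intro i hi
      simp only [Finset.mem_range] at hi ⊢
      omega
    · intro i hi
      simp only [Finset.mem_sdiff, Finset.mem_range] at hi
      rw [if_neg (by omega), mul_zero]
    · intro i hi
      simp only [Finset.mem_range] at hi
      rw [if_pos (by omega)]
  · simp

theorem iterate_ne_zero {a : K} (ha : a ≠ 0) (i : ℕ) : σ^[i] a ≠ 0 := by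
  induction i with
  | zero => exact ha
  | succ i ih => rw [Function.iterate_succ_apply']; simpa using ih

theorem iterate_map_zero' (i : ℕ) : σ^[i] (0 : K) = 0 := Function.iterate_fixed (map_zero σ) i

theorem coeff_comp_add (Q R : K[X]) :
    (comp σ Q R).coeff (Q.natDegree + R.natDegree) =
      Q.leadingCoeff * σ^[Q.natDegree] R.leadingCoeff := by
  rw [coeff_comp, Finset.sum_eq_single Q.natDegree]
  · rw [Nat.add_sub_cancel_left]; rfl
  · intro i _ hi
    rcases lt_or_gt_of_ne hi with h | h
    · rw [coeff_eq_zero_of_natDegree_lt (show R.natDegree < _ by omega), iterate_map_zero',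
        mul_zero]
    · rw [coeff_eq_zero_of_natDegree_lt h, zero_mul]
  · intro h
    exact absurd (Finset.mem_range.2 (by omega)) h

theorem natDegree_comp_le (Q R : K[X]) :
    (comp σ Q R).natDegree ≤ Q.natDegree + R.natDegree := by
  rw [natDegree_le_iff_coeff_eq_zero]
  intro k hk
  rw [coeff_comp]
  refine Finset.sum_eq_zero fun i _ => ?_
  rcases le_or_gt i Q.natDegree with h | h
  · rw [coeff_eq_zero_of_natDegree_lt (show R.natDegree < _ by omega), iterate_map_zero', mul_zero]
  · rw [coeff_eq_zero_of_natDegree_lt h, zero_mul]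

theorem natDegree_comp {Q R : K[X]} (hQ : Q ≠ 0) (hR : R ≠ 0) :
    (comp σ Q R).natDegree = Q.natDegree + R.natDegree := by
  refine le_antisymm (natDegree_comp_le Q R) (le_natDegree_of_ne_zero ?_)
  rw [coeff_comp_add]
  exact mul_ne_zero (leadingCoeff_ne_zero.2 hQ) (iterate_ne_zero (leadingCoeff_ne_zero.2 hR) _)

theorem comp_ne_zero {Q R : K[X]} (hQ : Q ≠ 0) (hR : R ≠ 0) : comp σ Q R ≠ 0 := by
  intro h
  have := coeff_comp_add (σ := σ) Q R
  rw [h, coeff_zero] at this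
  exact mul_ne_zero (leadingCoeff_ne_zero.2 hQ) (iterate_ne_zero (leadingCoeff_ne_zero.2 hR) _)
    this.symm

theorem comp_zero_left (R : K[X]) : comp σ 0 R = 0 := by simp [comp]

theorem comp_add_left (P Q R : K[X]) : comp σ (P + Q) R = comp σ P R + comp σ Q R := by
  ext k
  simp only [coeff_add, coeff_comp, add_mul, Finset.sum_add_distrib]

theorem comp_C_left (a : K) (R : K[X]) : comp σ (C a) R = C a * R := by
  rw [comp, sum_C_index (by simp)]; rfl

/-- Stability of a submodule under a semilinear operator. -/
def Stable (N : Submodule K M) : Prop := ∀ w ∈ N, S w ∈ N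

variable {S}

theorem Stable.iterate {N : Submodule K M} (h : Stable S N) (i : ℕ) {w : M} (hw : w ∈ N) :
    S^[i] w ∈ N := by
  induction i with
  | zero => exact hw
  | succ i ih => rw [Function.iterate_succ_apply']; exact h _ ih

theorem Stable.ev_mem {N : Submodule K M} (h : Stable S N) {w : M} (hw : w ∈ N) (A : K[X]) :
    ev S w A ∈ N := by
  rw [ev_apply]
  exact Submodule.sum_mem _ fun i _ => N.smul_mem _ (h.iterate i hw)

theorem Stable.range_le {N : Submodule K M} (h : Stable S N) {w : M} (hw : w ∈ N) :
    LinearMap.range (ev S w) ≤ N := by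
  rintro _ ⟨A, rfl⟩
  exact h.ev_mem hw A

theorem stable_range (m : M) : Stable S (LinearMap.range (ev S m)) := by
  rintro _ ⟨A, rfl⟩
  exact ⟨skewX σ A, ev_skewX S m A⟩

theorem mem_range_ev (m : M) : m ∈ LinearMap.range (ev S m) := ⟨1, ev_one S m⟩

theorem stable_bot : Stable S ⊥ := by
  intro w hw
  rw [Submodule.mem_bot] at hw ⊢
  rw [hw, map_zero]

theorem Stable.iSup {ι : Sort*} {N : ι → Submodule K M} (h : ∀ i, Stable S (N i)) :
    Stable S (⨆ i, N i) := by
  intro w hw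
  induction hw using Submodule.iSup_induction' with
  | mem i x hx => exact Submodule.mem_iSup_of_mem i (h i x hx)
  | zero => rw [map_zero]; exact Submodule.zero_mem _
  | add x y _ _ hx hy => rw [map_add]; exact Submodule.add_mem _ hx hy

theorem map_ev {φ : M →ₗ[K] M'} (hφ : ∀ w, φ (S w) = S' (φ w)) (m : M) (A : K[X]) :
    φ (ev S m A) = ev S' (φ m) A := by
  rw [ev_apply, ev_apply, Polynomial.sum, Polynomial.sum, map_sum]
  refine Finset.sum_congr rfl fun i _ => ?_
  rw [map_smul]
  congr 1
  clear * - hφ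
  induction i with
  | zero => rfl
  | succ i ih => rw [Function.iterate_succ_apply', Function.iterate_succ_apply', hφ, ih]

variable (S)

/-- `R` is a nonzero operator of minimal degree with `R m ∈ N`. -/
structure IsMin (N : Submodule K M) (m : M) (R : K[X]) : Prop where
  ne_zero : R ≠ 0
  mem : ev S m R ∈ N
  le : ∀ B, ev S m B ∈ N → B ≠ 0 → R.natDegree ≤ B.natDegree

variable {S}

theorem exists_isMin_of_mem {N : Submodule K M} {m : M} {B : K[X]} (hB : B ≠ 0)
    (h : ev S m B ∈ N) : ∃ R, IsMin S N m R := by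
  classical
  have hex : ∃ k, ∃ R : K[X], R ≠ 0 ∧ ev S m R ∈ N ∧ R.natDegree = k := ⟨_, B, hB, h, rfl⟩
  obtain ⟨R, h1, h2, h3⟩ := Nat.find_spec hex
  exact ⟨R, h1, h2, fun B hB hB0 => h3 ▸ Nat.find_min' hex ⟨B, hB0, hB, rfl⟩⟩

theorem exists_ne_zero_ev_eq_zero [FiniteDimensional K M] (m : M) :
    ∃ B : K[X], B ≠ 0 ∧ ev S m B = 0 := by
  by_contra h
  push Not at h
  have hinj : Function.Injective (ev S m) := by
    rw [injective_iff_map_eq_zero]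
    intro B hB
    by_contra h0
    exact h B h0 hB
  have := FiniteDimensional.of_injective (ev S m) hinj
  exact Polynomial.not_finite this

theorem exists_isMin [FiniteDimensional K M] (N : Submodule K M) (m : M) :
    ∃ R, IsMin S N m R := by
  obtain ⟨B, hB, h⟩ := exists_ne_zero_ev_eq_zero (S := S) m
  exact exists_isMin_of_mem hB (by rw [h]; exact N.zero_mem)

/-- Right Euclidean division: the coefficients form a field and σ is injective, so the leading term
of B is cancelled by a monomial multiple of R, whose leading coefficient has been twisted by a power
of σ. -/
theorem exists_comp_add {R : K[X]} (hR : R ≠ 0) (B : K[X]) :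
    ∃ Q B' : K[X], B = comp σ Q R + B' ∧ B'.degree < R.degree := by
  induction hk : B.natDegree using Nat.strong_induction_on generalizing B with
  | _ k ih =>
    by_cases hlt : B.degree < R.degree
    · exact ⟨0, B, by rw [comp_zero_left, zero_add], hlt⟩
    have hB : B ≠ 0 := by
      rintro rfl
      exact hlt (by rw [degree_zero]; exact bot_lt_iff_ne_bot.2 (degree_ne_bot.2 hR))
    have hle : R.natDegree ≤ B.natDegree := natDegree_le_natDegree (not_lt.1 hlt)
    set i := B.natDegree - R.natDegree with hi
    set a := B.leadingCoeff / σ^[i] R.leadingCoeff with ha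
    have hl : σ^[i] R.leadingCoeff ≠ 0 := iterate_ne_zero (leadingCoeff_ne_zero.2 hR) _
    have ha0 : a ≠ 0 := div_ne_zero (leadingCoeff_ne_zero.2 hB) hl
    have hQ0 : (monomial i a : K[X]) ≠ 0 := by simpa using ha0
    have hQdeg : (monomial i a : K[X]).natDegree = i := natDegree_monomial_eq _ ha0
    have hdeg : (comp σ (monomial i a) R).natDegree = B.natDegree := by
      rw [natDegree_comp hQ0 hR, hQdeg]; omega
    have hlc : (comp σ (monomial i a) R).leadingCoeff = B.leadingCoeff := by
      have := coeff_comp_add (σ := σ) (monomial i a) R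
      rw [← natDegree_comp hQ0 hR, hQdeg, leadingCoeff_monomial] at this
      rw [leadingCoeff, this, ha, div_mul_cancel₀ _ hl]
    have hc0 := comp_ne_zero (σ := σ) hQ0 hR
    set B₁ := B - comp σ (monomial i a) R with hB₁
    have hdlt : B₁.degree < B.degree :=
      degree_sub_lt_left (by rw [degree_eq_natDegree hB, degree_eq_natDegree hc0, hdeg]) hB hlc.symm
    by_cases hB₁0 : B₁ = 0
    · refine ⟨monomial i a, 0, ?_, ?_⟩
      · rw [add_zero]; exact sub_eq_zero.1 hB₁0
      · rw [degree_zero]; exact bot_lt_iff_ne_bot.2 (degree_ne_bot.2 hR)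
    · obtain ⟨Q, B', h1, h2⟩ := ih _ (hk ▸ natDegree_lt_natDegree hB₁0 hdlt) B₁ rfl
      refine ⟨monomial i a + Q, B', ?_, h2⟩
      rw [comp_add_left, add_assoc, ← h1, hB₁]; ring

/-- The operators sending m into a stable subspace form a left ideal, generated by an element of
least degree. -/
theorem IsMin.eq_comp {N : Submodule K M} (hN : Stable S N) {m : M} {R : K[X]}
    (h : IsMin S N m R) {B : K[X]} (hB : ev S m B ∈ N) : ∃ Q, B = comp σ Q R := by
  obtain ⟨Q, B', h1, h2⟩ := exists_comp_add (σ := σ) h.ne_zero B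
  have h3 : ev S m B' ∈ N := by
    have : B' = B - comp σ Q R := by rw [h1]; ring
    rw [this, map_sub, ev_comp]
    exact N.sub_mem hB (hN.ev_mem h.mem _)
  have h4 : B' = 0 := by
    by_contra h0
    exact absurd h2 (not_lt.2 ((degree_eq_natDegree h.ne_zero).le.trans
      ((Nat.cast_le.2 (h.le _ h3 h0)).trans (degree_eq_natDegree h0).ge)))
  exact ⟨Q, by rw [h1, h4, add_zero]⟩

/-- Modulo N, the operators of degree less than that of R represent each element of the cyclic
module exactly once, by division by R. -/
theorem IsMin.finrank_sup [FiniteDimensional K M] {N : Submodule K M} (hN : Stable S N) {m : M}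
    {R : K[X]} (h : IsMin S N m R) :
    Module.finrank K ↥(N ⊔ LinearMap.range (ev S m)) = Module.finrank K N + R.natDegree := by
  let f : N × degreeLT K R.natDegree →ₗ[K] M :=
    N.subtype.coprod ((ev S m).comp (degreeLT K R.natDegree).subtype)
  have hf : Function.Injective f := by
    rw [injective_iff_map_eq_zero]
    rintro ⟨⟨w, hw⟩, ⟨B, hB⟩⟩ h0
    have h0 : w + ev S m B = 0 := by simpa [f] using h0
    have h1 : ev S m B ∈ N := by
      rw [← neg_eq_of_add_eq_zero_right h0]; exact N.neg_mem hw
    have h2 : B = 0 := by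
      by_contra hB0
      rw [mem_degreeLT] at hB
      have := h.le B h1 hB0
      rw [degree_eq_natDegree hB0] at hB
      exact absurd (Nat.cast_lt.1 hB) (not_lt.2 this)
    subst h2
    rw [map_zero, add_zero] at h0
    subst h0
    rfl
  have hr : LinearMap.range f = N ⊔ LinearMap.range (ev S m) := by
    rw [LinearMap.range_coprod, Submodule.range_subtype]
    refine le_antisymm (sup_le_sup_left ?_ _) (sup_le le_sup_left ?_)
    · rintro _ ⟨B, rfl⟩
      exact ⟨B.1, rfl⟩
    · rintro _ ⟨B, rfl⟩
      obtain ⟨Q, B', h1, h2⟩ := exists_comp_add (σ := σ) h.ne_zero B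
      rw [h1, map_add, ev_comp]
      refine Submodule.add_mem _ (Submodule.mem_sup_left (hN.ev_mem h.mem _))
        (Submodule.mem_sup_right ⟨⟨B', ?_⟩, rfl⟩)
      rw [mem_degreeLT, ← degree_eq_natDegree h.ne_zero]
      exact h2
  rw [← hr, LinearMap.finrank_range_of_inj hf, Module.finrank_prod,
    (degreeLTEquiv K R.natDegree).finrank_eq]
  simp

theorem IsMin.finrank_range [FiniteDimensional K M] {m : M} {R : K[X]} (h : IsMin S ⊥ m R) :
    Module.finrank K (LinearMap.range (ev S m)) = R.natDegree := by
  have := h.finrank_sup stable_bot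
  rwa [bot_sup_eq, finrank_bot, zero_add] at this

theorem IsMin.ev_eq_zero {m : M} {R : K[X]} (h : IsMin S ⊥ m R) : ev S m R = 0 :=
  (Submodule.mem_bot K).1 h.mem

/-- An operator killing `m` modulo a stable submodule `N` gives a right factor, and the left
factor describes `N`. -/
theorem IsMin.factor {m : M} {A : K[X]} (hA : IsMin S ⊥ m A) {N : Submodule K M}
    (hN : Stable S N) {R : K[X]} (hR : IsMin S N m R) :
    ∃ Q, A = comp σ Q R ∧ IsMin S ⊥ (ev S m R) Q ∧
      N ⊓ LinearMap.range (ev S m) = LinearMap.range (ev S (ev S m R)) := by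
  obtain ⟨Q, hQ⟩ := hR.eq_comp hN (B := A) (by rw [hA.ev_eq_zero]; exact N.zero_mem)
  have hQ0 : Q ≠ 0 := by
    rintro rfl
    exact hA.ne_zero (by rw [hQ, comp_zero_left])
  refine ⟨Q, hQ, ⟨hQ0, ?_, fun B hB hB0 => ?_⟩, le_antisymm ?_ (le_inf (hN.range_le hR.mem) ?_)⟩
  · rw [Submodule.mem_bot, ← ev_comp, ← hQ, hA.ev_eq_zero]
  · have := hA.le (comp σ B R) (by rwa [ev_comp]) (comp_ne_zero hB0 hR.ne_zero)
    rw [hQ, natDegree_comp hQ0 hR.ne_zero, natDegree_comp hB0 hR.ne_zero] at this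
    omega
  · rintro _ ⟨hw, B, rfl⟩
    obtain ⟨Q', rfl⟩ := hR.eq_comp hN hw
    exact ⟨Q', (ev_comp S m Q' R).symm⟩
  · rintro _ ⟨B, rfl⟩
    exact ⟨comp σ B R, ev_comp S m B R⟩

theorem IsMin.linearIndependent {m : M} {R : K[X]} (h : IsMin S ⊥ m R) :
    LinearIndependent K fun i : Fin R.natDegree => S^[i] m := by
  rw [Fintype.linearIndependent_iff]
  intro g hg
  by_contra hne
  push Not at hne
  obtain ⟨i, hi⟩ := hne
  let B : K[X] := ∑ j : Fin R.natDegree, monomial (j : ℕ) (g j)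
  have hB0 : B ≠ 0 := by
    intro h0
    have h1 : B.coeff i = g i := by
      simp only [B, finsetSum_coeff, coeff_monomial]
      rw [Finset.sum_eq_single i]
      · simp
      · intro j _ hj
        rw [if_neg (fun hh => hj (Fin.ext hh))]
      · simp
    rw [h0, coeff_zero] at h1
    exact hi h1.symm
  have h1 : ev S m B ∈ (⊥ : Submodule K M) := by
    rw [Submodule.mem_bot, ← hg]
    simp [B]
  have h2 := h.le B h1 hB0
  have h3 : B.degree < R.natDegree := by
    refine (degree_sum_le _ _).trans_lt ?_
    rw [Finset.sup_lt_iff (WithBot.bot_lt_coe _)]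
    intro j _
    exact (degree_monomial_le _ _).trans_lt (Nat.cast_lt.2 j.2)
  rw [degree_eq_natDegree hB0] at h3
  exact absurd (Nat.cast_lt.1 h3) (not_lt.2 h2)

theorem range_ev_eq_span {m : M} {R : K[X]} (hR : R ≠ 0) (h : ev S m R = 0) :
    LinearMap.range (ev S m) =
      Submodule.span K (Set.range fun i : Fin R.natDegree => S^[i] m) := by
  refine le_antisymm ?_ (Submodule.span_le.2 ?_)
  · rintro _ ⟨B, rfl⟩
    obtain ⟨Q, B', h1, h2⟩ := exists_comp_add (σ := σ) hR B
    rw [h1, map_add, ev_comp, h, ev_zero_left, zero_add, ev_apply]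
    refine Submodule.sum_mem _ fun i hi => Submodule.smul_mem _ _ (Submodule.subset_span ?_)
    have : i < R.natDegree := by
      have h3 := (le_degree_of_mem_supp i hi).trans_lt h2
      rw [degree_eq_natDegree hR] at h3
      exact Nat.cast_lt.1 h3
    exact ⟨⟨i, this⟩, rfl⟩
  · rintro _ ⟨i, rfl⟩
    exact ⟨monomial i 1, by rw [ev_monomial, one_smul]⟩

/-- A linearly independent family of iterates and a relation of the next degree give a minimal
operator. -/
theorem isMin_of_linearIndependent {m : M} {R : K[X]} (hR : R ≠ 0) (h : ev S m R = 0)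
    (hl : LinearIndependent K fun i : Fin R.natDegree => S^[i] m) : IsMin S ⊥ m R := by
  refine ⟨hR, by rw [h]; exact Submodule.zero_mem _, fun B hB hB0 => ?_⟩
  by_contra hlt
  rw [not_le] at hlt
  rw [Submodule.mem_bot, ev_eq_sum_range S m B hlt, Finset.sum_range] at hB
  rw [Fintype.linearIndependent_iff] at hl
  have := hl (fun i => B.coeff i) hB ⟨B.natDegree, hlt⟩
  exact hB0 (leadingCoeff_eq_zero.1 this)

end Ops

/-! ## Elementary facts on `C{x}` and `C({x})` -/

section Field

variable {C : Type*} [NormedField C] {K : Type*} [Field K] [Algebra (Germ C) K]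
  [IsFractionRing (Germ C) K]

theorem isConvergent_X : IsConvergent (PowerSeries.X : PowerSeries C) := by
  refine ⟨1, 1, one_pos, fun n => ?_⟩
  rw [PowerSeries.coeff_X]
  split_ifs <;> simp

variable (C) in
/-- The variable `x` in `C{x}`. -/
noncomputable def germX : Germ C := ⟨PowerSeries.X, isConvergent_X⟩

variable (C) in
/-- The constants of `C{x}`. -/
noncomputable def germC : C →+* Germ C :=
  (PowerSeries.C (R := C)).codRestrict (convergentSubring C) isConvergent_algebraMap

variable (C) in
/-- The value at `0` of a germ. -/
noncomputable def germVal : Germ C →+* C :=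
  (PowerSeries.constantCoeff (R := C)).comp (convergentSubring C).subtype

variable (C K) in
/-- The inclusion of `C{x}` in its fraction field `C({x})`. -/
noncomputable abbrev toK : Germ C →+* K := algebraMap (Germ C) (K)

variable (C K) in
/-- The variable `x` in `C({x})`. -/
noncomputable def xK : K := toK C K (germX C)

variable (C K) in
/-- The constants of `C({x})`. -/
noncomputable def cst : C →+* K := (toK C K).comp (germC C)

/-- The substitution `x ↦ xⁿ` in `C{x}`. -/
noncomputable def germExpand (n : ℕ) (hn : n ≠ 0) : Germ C →+* Germ C :=
  ((PowerSeries.expand n hn : PowerSeries C →ₐ[C] PowerSeries C).toRingHom.comp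
    (convergentSubring C).subtype).codRestrict (convergentSubring C) fun f => f.2.expand n hn

theorem germExpand_coe (n : ℕ) (hn : n ≠ 0) (f : Germ C) :
    (germExpand n hn f).1 = PowerSeries.expand n hn f.1 := rfl

theorem germExpand_injective (n : ℕ) (hn : n ≠ 0) :
    Function.Injective (germExpand (C := C) n hn) := by
  intro f g h
  apply Subtype.ext
  ext m
  have := congrArg (fun u : Germ C => PowerSeries.coeff (n * m) u.1) h
  simpa only [germExpand_coe, PowerSeries.coeff_expand_mul] using this

variable (C) in
/-- The substitution `x ↦ xⁿ` in `C({x})`. -/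
noncomputable def ram (n : ℕ) (hn : n ≠ 0) : K →+* K :=
  IsFractionRing.map (germExpand_injective (C := C) n hn)

theorem toK_injective : Function.Injective (toK C K) := IsFractionRing.injective _ _

theorem toK_eq_zero {g : Germ C} : toK C K g = 0 ↔ g = 0 :=
  map_eq_zero_iff _ toK_injective

/-- The automorphism `f(x) ↦ f(qx)` of a fraction field of `C{x}`. -/
noncomputable def sh (q : Cˣ) : K ≃+* K :=
  IsFractionRing.ringEquivOfRingEquiv (germShift q)

theorem ram_toK (n : ℕ) (hn : n ≠ 0) (g : Germ C) :
    ram C n hn (toK C K g) = toK C K (germExpand n hn g) :=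
  by unfold ram IsFractionRing.map; exact IsLocalization.map_eq _ g

theorem shift_toK (q : Cˣ) (g : Germ C) : sh q (toK C K g) = toK C K (germShift q g) :=
  IsFractionRing.ringEquivOfRingEquiv_algebraMap _ _

@[simp] theorem coe_germX : (germX C).1 = PowerSeries.X := rfl
@[simp] theorem coe_germC (a : C) : (germC C a).1 = PowerSeries.C a := rfl
theorem germVal_apply (g : Germ C) : germVal C g = PowerSeries.constantCoeff g.1 := rfl
theorem germVal_eq_coeff (g : Germ C) : germVal C g = PowerSeries.coeff 0 g.1 := by
  rw [germVal_apply, PowerSeries.coeff_zero_eq_constantCoeff_apply]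
@[simp] theorem germVal_germC (a : C) : germVal C (germC C a) = a := by simp [germVal_apply]
@[simp] theorem germVal_germX : germVal C (germX C) = 0 := by simp [germVal_apply]

theorem coe_germShift (q : Cˣ) (g : Germ C) :
    (germShift q g).1 = PowerSeries.rescale (q : C) g.1 := rfl

@[simp] theorem germVal_germShift (q : Cˣ) (g : Germ C) :
    germVal C (germShift q g) = germVal C g := by
  rw [germVal_eq_coeff, germVal_eq_coeff, coe_germShift, PowerSeries.coeff_rescale]; simp

@[simp] theorem germVal_germShift_iterate (q : Cˣ) (g : Germ C) (i : ℕ) :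
    germVal C ((germShift q)^[i] g) = germVal C g := by
  induction i with
  | zero => rfl
  | succ i ih => rw [Function.iterate_succ_apply', germVal_germShift, ih]

@[simp] theorem germVal_germExpand (n : ℕ) (hn : n ≠ 0) (g : Germ C) :
    germVal C (germExpand n hn g) = germVal C g := by
  rw [germVal_eq_coeff, germVal_eq_coeff, germExpand_coe]
  simp

theorem germX_ne_zero : germX C ≠ 0 := fun h => by
  have := congrArg Subtype.val h
  exact PowerSeries.X_ne_zero this

theorem xK_ne_zero : xK C K ≠ 0 := fun h => germX_ne_zero (toK_eq_zero.1 h)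

theorem germShift_germX (q : Cˣ) : germShift q (germX C) = germC C q * germX C := by
  apply Subtype.ext
  rw [coe_germShift]
  change _ = PowerSeries.C (q : C) * PowerSeries.X
  rw [coe_germX, PowerSeries.rescale_X]

theorem germShift_germC (q : Cˣ) (a : C) : germShift q (germC C a) = germC C a := by
  apply Subtype.ext
  rw [coe_germShift, coe_germC]
  ext m
  rw [PowerSeries.coeff_rescale, PowerSeries.coeff_C]
  split_ifs with h <;> simp [h]

theorem germExpand_germX (n : ℕ) (hn : n ≠ 0) : germExpand n hn (germX C) = germX C ^ n := by
  apply Subtype.ext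
  rw [germExpand_coe, coe_germX, PowerSeries.expand_X]
  rfl

theorem germExpand_germC (n : ℕ) (hn : n ≠ 0) (a : C) :
    germExpand n hn (germC C a) = germC C a := by
  apply Subtype.ext
  rw [germExpand_coe, coe_germC]
  exact PowerSeries.expand_C _ _ _

@[simp] theorem shift_xK (q : Cˣ) : sh q (xK C K) = cst C K q * xK C K := by
  rw [xK, shift_toK, germShift_germX, map_mul]; rfl

@[simp] theorem shift_cst (q : Cˣ) (a : C) : sh q (cst C K a) = cst C K a := by
  change sh q (toK C K (germC C a)) = _
  rw [shift_toK, germShift_germC]; rfl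

@[simp] theorem ram_xK (n : ℕ) (hn : n ≠ 0) : ram C n hn (xK C K) = xK C K ^ n := by
  rw [xK, ram_toK, germExpand_germX, map_pow]

@[simp] theorem ram_cst (n : ℕ) (hn : n ≠ 0) (a : C) : ram C n hn (cst C K a) = cst C K a := by
  change ram C n hn (toK C K (germC C a)) = _
  rw [ram_toK, germExpand_germC]; rfl

theorem cst_ne_zero {a : C} (ha : a ≠ 0) : cst C K a ≠ 0 := (map_ne_zero _).2 ha

theorem shift_xK_zpow (q : Cˣ) (s : ℤ) :
    sh q (xK C K ^ s) = cst C K ((q ^ s : Cˣ) : C) * xK C K ^ s := by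
  rw [map_zpow₀, shift_xK, mul_zpow, ← map_zpow₀, Units.val_zpow_eq_zpow_val]

theorem ram_xK_zpow (n : ℕ) (hn : n ≠ 0) (s : ℤ) :
    ram C n hn (xK C K ^ s) = xK C K ^ (n * s : ℤ) := by
  rw [map_zpow₀, ram_xK, zpow_mul, zpow_natCast]

theorem germExpand_germShift {p q : Cˣ} {n : ℕ} (hn : n ≠ 0) (hp : p ^ n = q) (g : Germ C) :
    germExpand n hn (germShift q g) = germShift p (germExpand n hn g) := by
  apply Subtype.ext
  rw [germExpand_coe, coe_germShift, coe_germShift, germExpand_coe]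
  ext m
  rw [PowerSeries.coeff_rescale, PowerSeries.coeff_expand, PowerSeries.coeff_expand]
  split_ifs with h
  · obtain ⟨k, rfl⟩ := h
    rw [PowerSeries.coeff_rescale, Nat.mul_div_cancel_left _ (Nat.pos_of_ne_zero hn), ← hp,
      Units.val_pow_eq_pow_val, ← pow_mul]
  · rw [mul_zero]

theorem div_surjective (f : K) : ∃ a b : Germ C, b ≠ 0 ∧ f = toK C K a / toK C K b := by
  obtain ⟨a, b, hb, rfl⟩ := IsFractionRing.div_surjective (Germ C) f
  exact ⟨a, b, nonZeroDivisors.ne_zero hb, rfl⟩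

theorem ram_shift {p q : Cˣ} {n : ℕ} (hn : n ≠ 0) (hp : p ^ n = q) (f : K) :
    ram C n hn (sh q f) = sh p (ram C n hn f) := by
  obtain ⟨a, b, _, rfl⟩ := div_surjective (C := C) f
  simp only [map_div₀, shift_toK, ram_toK, germExpand_germShift hn hp]

theorem ram_ram (n g : ℕ) (hn : n ≠ 0) (hg : g ≠ 0) (f : K) :
    ram C g hg (ram C n hn f) = ram C (n * g) (mul_ne_zero hn hg) f := by
  obtain ⟨a, b, _, rfl⟩ := div_surjective (C := C) f
  have : ∀ a : Germ C, germExpand g hg (germExpand n hn a) =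
      germExpand (n * g) (mul_ne_zero hn hg) a := fun a => by
    apply Subtype.ext
    simp only [germExpand_coe]
    exact (DFunLike.congr_fun (PowerSeries.expand_mul_eq_comp g hg n hn) a.1).symm.trans
      (by congr 2; simp only [mul_comm])
  simp only [map_div₀, ram_toK, this]

/-- Dividing a convergent series by x^k keeps it convergent, so the order can be split off inside
C{x}. -/
theorem germ_eq_X_pow_mul {g : Germ C} (hg : g ≠ 0) :
    ∃ u : Germ C, germVal C u ≠ 0 ∧ g = germX C ^ (g.1.order.toNat) * u ∧
      germVal C u = PowerSeries.coeff g.1.order.toNat g.1 := by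
  have hg' : g.1 ≠ 0 := fun h => hg (Subtype.ext h)
  set k := g.1.order.toNat with hk
  have ho : g.1.order = k := (ENat.natCast_toNat (by rwa [Ne, PowerSeries.order_eq_top])).symm
  let u : PowerSeries C := PowerSeries.mk fun m => PowerSeries.coeff (m + k) g.1
  have hu : IsConvergent u := by
    obtain ⟨A, B, hA, hB, h⟩ := g.2.exists_one_le
    refine ⟨A * B ^ k, B, by linarith, fun m => ?_⟩
    rw [PowerSeries.coeff_mk]
    exact (h _).trans_eq (by rw [pow_add]; ring)
  have hval : germVal C ⟨u, hu⟩ = PowerSeries.coeff k g.1 := by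
    rw [germVal_eq_coeff, PowerSeries.coeff_mk, zero_add]
  refine ⟨⟨u, hu⟩, ?_, ?_, hval⟩
  · rw [hval]
    exact PowerSeries.coeff_order hg'
  · apply Subtype.ext
    change g.1 = PowerSeries.X ^ k * u
    ext m
    rw [PowerSeries.coeff_X_pow_mul', PowerSeries.coeff_mk]
    split_ifs with h
    · rw [Nat.sub_add_cancel h]
    · exact PowerSeries.coeff_of_lt_order _ (by rw [ho]; exact_mod_cast not_le.1 h)

theorem exists_eq_zpow_mul {f : K} (hf : f ≠ 0) :
    ∃ (s : ℤ) (u : Germ C), germVal C u ≠ 0 ∧ f = xK C K ^ s * toK C K u := by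
  obtain ⟨a, b, hb, rfl⟩ := div_surjective (C := C) f
  have ha : a ≠ 0 := by
    rintro rfl
    exact hf (by simp)
  obtain ⟨u, hu, hau, -⟩ := germ_eq_X_pow_mul ha
  obtain ⟨w, hw, hbw, -⟩ := germ_eq_X_pow_mul hb
  set k := a.1.order.toNat
  set l := b.1.order.toNat
  obtain ⟨w', rfl⟩ := isUnit_germ w hw
  refine ⟨k - l, u * (w'⁻¹ : (Germ C)ˣ), ?_, ?_⟩
  · rw [map_mul]
    exact mul_ne_zero hu (((w'⁻¹).isUnit.map (germVal C)).ne_zero)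
  · have h1 : toK C K (w' : Germ C) ≠ 0 := by rw [Ne, toK_eq_zero]; exact w'.ne_zero
    have h2 : toK C K ((w'⁻¹ : (Germ C)ˣ) : Germ C) = (toK C K (w' : Germ C))⁻¹ := by
      exact eq_inv_of_mul_eq_one_left (by rw [← map_mul, Units.inv_mul, map_one])
    rw [hau, hbw, map_mul, map_mul, map_mul, map_pow, map_pow, h2]
    change (xK C K ^ k * toK C K u) / (xK C K ^ l * toK C K (w' : Germ C)) = _
    rw [zpow_sub₀ xK_ne_zero, zpow_natCast, zpow_natCast]
    have := xK_ne_zero (C := C) (K := K)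
    field_simp

theorem exists_eq_zpow_mul' (f : K) :
    ∃ (k : ℕ) (g : Germ C), f = xK C K ^ (-(k : ℤ)) * toK C K g := by
  rcases eq_or_ne f 0 with rfl | hf
  · exact ⟨0, 0, by simp⟩
  obtain ⟨s, u, -, rfl⟩ := exists_eq_zpow_mul (C := C) hf
  refine ⟨s.natAbs, germX C ^ (s + s.natAbs).toNat * u, ?_⟩
  rw [map_mul, map_pow]
  change _ = _ * (xK C K ^ _ * _)
  rw [← mul_assoc, ← zpow_natCast, ← zpow_add₀ xK_ne_zero]
  congr 2
  omega

/-- Uniqueness of order and leading coefficient, in a form where only one of the two sides is known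
to be in normal form: g may vanish at 0, and does so exactly when its exponent underestimates the
order. -/
theorem zpow_mul_eq {s s' : ℤ} {u g : Germ C} (hu : germVal C u ≠ 0)
    (h : xK C K ^ s * toK C K u = xK C K ^ s' * toK C K g) :
    s' ≤ s ∧ (s' = s → germVal C u = germVal C g) ∧ (germVal C g ≠ 0 → s' = s) := by
  have aux : ∀ {s s' : ℤ} {u g : Germ C}, germVal C u ≠ 0 →
      xK C K ^ s * toK C K u = xK C K ^ s' * toK C K g → s' ≤ s := by
    intro s s' u g hu h
    by_contra hlt
    rw [not_le] at hlt
    have h1 : toK C K u = toK C K (germX C ^ (s' - s).toNat * g) := by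
      rw [map_mul, map_pow]
      change _ = xK C K ^ _ * _
      rw [← zpow_natCast, Int.toNat_of_nonneg (by omega), zpow_sub₀ xK_ne_zero, div_mul_eq_mul_div,
        ← h, mul_div_cancel_left₀ _ (zpow_ne_zero _ xK_ne_zero)]
    apply hu
    rw [toK_injective h1, map_mul, map_pow, germVal_germX, zero_pow (by omega), zero_mul]
  refine ⟨aux hu h, ?_, fun hg => le_antisymm (aux hu h) (aux hg h.symm)⟩
  rintro rfl
  rw [toK_injective (mul_left_cancel₀ (zpow_ne_zero _ xK_ne_zero) h)]

theorem toK_mul_zpow_ne_zero {u : Germ C} (hu : germVal C u ≠ 0) (s : ℤ) :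
    xK C K ^ s * toK C K u ≠ 0 := by
  refine mul_ne_zero (zpow_ne_zero _ xK_ne_zero) ?_
  rw [Ne, toK_eq_zero]
  rintro rfl
  exact hu (map_zero _)

end Field

/-! ## Initial forms of operators -/

section Init

open Polynomial

variable {C : Type*} [NormedField C] {K : Type*} [Field K] [Algebra (Germ C) K]
  [IsFractionRing (Germ C) K]

/-- After the substitution `x = tⁿ` and the twist by `t^{-d}`, the operator `A` has lowest order
`h` in `t`, and initial form `P`. -/
def HasInit (A : K[X]) (n : ℕ) (hn : n ≠ 0) (d : ℤ) (p : Cˣ) (h : ℤ) (P : C[X]) :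
    Prop :=
  P ≠ 0 ∧ ∃ g : ℕ → Germ C, ∀ i,
    ram C n hn (A.coeff i) =
      cst C K ((p ^ (d * (i.choose 2 : ℤ)) : Cˣ) : C) * xK C K ^ (d * i + h) * toK C K (g i) ∧
    germVal C (g i) = P.coeff i

variable {n : ℕ} {hn : n ≠ 0} {d : ℤ} {p q : Cˣ}

theorem ram_shift_iterate (hn : n ≠ 0) (hp : p ^ n = q) (i : ℕ) (f : K) :
    ram C n hn ((sh q)^[i] f) = (sh p)^[i] (ram C n hn f) := by
  induction i with
  | zero => rfl
  | succ i ih => rw [Function.iterate_succ_apply', Function.iterate_succ_apply', ram_shift hn hp, ih]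

theorem shift_iterate_monomial (p : Cˣ) (i : ℕ) (a : C) (s : ℤ) (g : Germ C) :
    (sh p)^[i] (cst C K a * xK C K ^ s * toK C K g) =
      cst C K ((p ^ (s * i) : Cˣ) : C) * (cst C K a * xK C K ^ s * toK C K ((germShift p)^[i] g)) := by
  induction i with
  | zero => simp
  | succ i ih =>
    rw [Function.iterate_succ_apply', Function.iterate_succ_apply', ih]
    simp only [map_mul, shift_cst, shift_xK_zpow, shift_toK]
    have : p ^ (s * ((i + 1 : ℕ) : ℤ)) = p ^ (s * i) * p ^ s := by
      rw [← zpow_add]; push_cast; ring_nf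
    rw [this, Units.val_mul, map_mul]
    ring

theorem choose_two_add (i j : ℕ) : (i + j).choose 2 = i.choose 2 + j.choose 2 + i * j := by
  induction j with
  | zero => simp
  | succ j ih =>
    rw [← add_assoc, Nat.choose_succ_succ' (i + j) 1, Nat.choose_succ_succ' j 1, ih,
      Nat.choose_one_right, Nat.choose_one_right]
    ring

/-- Moving σ^i past t^{dj + h₂} costs p^{(dj + h₂) i}. The part p^{dij} is absorbed by the
normalisation p^{d i(i-1)/2}, through `choose_two_add`; what is left, p^{h₂ i}, is the substitution
X ↦ p^{h₂} X in the initial form of the left factor. -/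
theorem HasInit.comp (hp : p ^ n = q) {Q R : K[X]} {h₁ h₂ : ℤ} {P₁ P₂ : C[X]}
    (hQ : HasInit Q n hn d p h₁ P₁) (hR : HasInit R n hn d p h₂ P₂) :
    HasInit (QDiff.comp (sh q) Q R) n hn d p (h₁ + h₂)
      (P₁.comp (Polynomial.C ((p ^ h₂ : Cˣ) : C) * X) * P₂) := by
  obtain ⟨hP₁, g₁, hg₁⟩ := hQ
  obtain ⟨hP₂, g₂, hg₂⟩ := hR
  refine ⟨mul_ne_zero ?_ hP₂, fun k => ∑ i ∈ Finset.range (k + 1),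
    germC C ((p ^ (h₂ * i) : Cˣ) : C) * g₁ i * (germShift p)^[i] (g₂ (k - i)), fun k => ⟨?_, ?_⟩⟩
  · intro h0
    apply hP₁
    ext i
    have := congrArg (fun F : C[X] => F.coeff i) h0
    simp only [comp_C_mul_X_coeff, coeff_zero] at this
    rw [coeff_zero]
    exact (mul_eq_zero.1 this).resolve_right (pow_ne_zero _ (Units.ne_zero _))
  · rw [coeff_comp, map_sum, map_sum, Finset.mul_sum]
    refine Finset.sum_congr rfl fun i hi => ?_
    have hik : i ≤ k := Nat.lt_succ_iff.1 (Finset.mem_range.1 hi)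
    obtain ⟨j, rfl⟩ := Nat.exists_eq_add_of_le hik
    rw [Nat.add_sub_cancel_left, map_mul, ram_shift_iterate hn hp, (hg₁ i).1, (hg₂ j).1,
      shift_iterate_monomial, map_mul, map_mul]
    have e1 : p ^ (d * ((i + j).choose 2 : ℤ)) * p ^ (h₂ * i) =
        p ^ (d * (i.choose 2 : ℤ)) * (p ^ ((d * j + h₂) * i) * p ^ (d * (j.choose 2 : ℤ))) := by
      rw [← zpow_add, ← zpow_add, ← zpow_add, choose_two_add]
      push_cast
      ring_nf
    have e2 : xK C K ^ (d * ((i + j : ℕ) : ℤ) + (h₁ + h₂)) =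
        xK C K ^ (d * i + h₁) * xK C K ^ (d * j + h₂) := by
      rw [← zpow_add₀ xK_ne_zero]; push_cast; ring_nf
    have e1' := congrArg (fun u : Cˣ => cst C K (u : C)) e1
    simp only [Units.val_mul, map_mul] at e1'
    have e3 : toK C K (germC C ((p ^ (h₂ * i) : Cˣ) : C)) = cst C K ((p ^ (h₂ * i) : Cˣ) : C) := rfl
    rw [e2, e3]
    linear_combination (-(xK C K ^ (d * i + h₁) * xK C K ^ (d * j + h₂) * toK C K (g₁ i) *
      toK C K ((germShift p)^[i] (g₂ j)))) * e1'
  · rw [map_sum, coeff_mul, Finset.Nat.sum_antidiagonal_eq_sum_range_succ_mk]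
    refine Finset.sum_congr rfl fun i _ => ?_
    rw [map_mul, map_mul, germVal_germC, germVal_germShift_iterate, (hg₁ i).2, (hg₂ _).2,
      comp_C_mul_X_coeff, zpow_mul, zpow_natCast, Units.val_pow_eq_pow_val]
    ring

/-- The points (i, ord a_i) lie above a line of slope d/n, and the support of P marks those on the
line; there the coefficient of P is the normalised leading coefficient. -/
theorem HasInit.order {A : K[X]} {h : ℤ} {P : C[X]} (hA : HasInit A n hn d p h P)
    {i : ℕ} {o : ℤ} {u : Germ C} (hu : germVal C u ≠ 0) (hi : A.coeff i = xK C K ^ o * toK C K u) :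
    d * i + h ≤ n * o ∧ (d * i + h = n * o ↔ P.coeff i ≠ 0) ∧
      (d * i + h = n * o → P.coeff i = ((p ^ (-(d * (i.choose 2 : ℤ))) : Cˣ) : C) * germVal C u) := by
  obtain ⟨hP, g, hg⟩ := hA
  obtain ⟨h1, h2⟩ := hg i
  have h3 : xK C K ^ (n * o : ℤ) * toK C K (germExpand n hn u) = xK C K ^ (d * i + h) *
      toK C K (germC C ((p ^ (d * (i.choose 2 : ℤ)) : Cˣ) : C) * g i) := by
    rw [hi, map_mul, ram_xK_zpow, ram_toK] at h1
    rw [h1, map_mul]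
    change _ = _ * (cst C K _ * _)
    ring
  obtain ⟨h4, h5, h6⟩ := zpow_mul_eq (by rwa [germVal_germExpand]) h3
  rw [map_mul, germVal_germC, germVal_germExpand, h2] at *
  refine ⟨h4, ⟨fun h => ?_, fun h => h6 (mul_ne_zero (Units.ne_zero _) h)⟩, fun h => ?_⟩
  · intro h0
    have := h5 h
    rw [h0, mul_zero] at this
    exact hu this
  · rw [h5 h, ← mul_assoc, ← Units.val_mul, ← zpow_add, neg_add_cancel, zpow_zero, Units.val_one,
      one_mul]

theorem HasInit.coeff_ne_zero {A : K[X]} {h : ℤ} {P : C[X]}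
    (hA : HasInit A n hn d p h P) {i : ℕ} (hi : P.coeff i ≠ 0) : A.coeff i ≠ 0 := by
  obtain ⟨hP, g, hg⟩ := hA
  obtain ⟨h1, h2⟩ := hg i
  intro h0
  rw [h0, map_zero] at h1
  have h3 : toK C K (g i) = 0 := by
    have := mul_eq_zero.1 h1.symm
    exact this.resolve_left (mul_ne_zero (cst_ne_zero (Units.ne_zero _))
      (zpow_ne_zero _ xK_ne_zero))
  rw [toK_eq_zero] at h3
  rw [← h2, h3, map_zero] at hi
  exact hi rfl

theorem HasInit.exists_order {A : K[X]} {h : ℤ} {P : C[X]}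
    (hA : HasInit A n hn d p h P) {i : ℕ} (hi : A.coeff i ≠ 0) :
    ∃ o : ℤ, d * i + h ≤ n * o ∧ (d * i + h = n * o ↔ P.coeff i ≠ 0) := by
  obtain ⟨o, u, hu, h1⟩ := exists_eq_zpow_mul (C := C) hi
  exact ⟨o, (hA.order hu h1).1, (hA.order hu h1).2.1⟩

theorem HasInit.ne_zero {A : K[X]} {h : ℤ} {P : C[X]}
    (hA : HasInit A n hn d p h P) : A ≠ 0 := by
  rintro rfl
  obtain ⟨i, hi⟩ : ∃ i, P.coeff i ≠ 0 := by
    by_contra hc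
    push Not at hc
    exact hA.1 (Polynomial.ext hc)
  exact hA.coeff_ne_zero hi (coeff_zero i)

theorem HasInit.natDegree_le {A : K[X]} {h : ℤ} {P : C[X]}
    (hA : HasInit A n hn d p h P) : P.natDegree ≤ A.natDegree :=
  le_natDegree_of_ne_zero (hA.coeff_ne_zero (leadingCoeff_ne_zero.2 hA.1))

theorem HasInit.unique {A : K[X]} {h h' : ℤ} {P P' : C[X]}
    (hA : HasInit A n hn d p h P) (hA' : HasInit A n hn d p h' P') : h = h' ∧ P = P' := by
  have aux : ∀ {h h' : ℤ} {P P' : C[X]}, HasInit A n hn d p h P → HasInit A n hn d p h' P' →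
      h' ≤ h := by
    intro h h' P P' hA hA'
    have hi : P.coeff P.natDegree ≠ 0 := leadingCoeff_ne_zero.2 hA.1
    obtain ⟨o, u, hu, h1⟩ := exists_eq_zpow_mul (C := C) (hA.coeff_ne_zero hi)
    have h2 := (hA.order hu h1).2.1.2 hi
    have h3 := (hA'.order hu h1).1
    omega
  obtain rfl : h = h' := le_antisymm (aux hA' hA) (aux hA hA')
  refine ⟨rfl, ?_⟩
  have aux2 : ∀ {P P' : C[X]}, HasInit A n hn d p h P → HasInit A n hn d p h P' →
      ∀ i, P.coeff i ≠ 0 → P.coeff i = P'.coeff i := by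
    intro P P' hA hA' i hi
    obtain ⟨o, u, hu, h1⟩ := exists_eq_zpow_mul (C := C) (hA.coeff_ne_zero hi)
    have h2 := (hA.order hu h1).2.1.2 hi
    rw [(hA.order hu h1).2.2 h2, (hA'.order hu h1).2.2 h2]
  ext i
  by_cases hi : P.coeff i = 0
  · by_cases hi' : P'.coeff i = 0
    · rw [hi, hi']
    · exact (aux2 hA' hA i hi').symm
  · exact aux2 hA hA' i hi

theorem exists_hasInit {A : K[X]} (hA : A ≠ 0) (n : ℕ) (hn : n ≠ 0) (d : ℤ) (p : Cˣ) :
    ∃ h P, HasInit A n hn d p h P := by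
  classical
  have hex : ∀ i, ∃ (o : ℤ) (u : Germ C), A.coeff i ≠ 0 →
      germVal C u ≠ 0 ∧ A.coeff i = xK C K ^ o * toK C K u := by
    intro i
    by_cases hi : A.coeff i = 0
    · exact ⟨0, 0, fun h => absurd hi h⟩
    · obtain ⟨o, u, hu, h⟩ := exists_eq_zpow_mul (C := C) hi
      exact ⟨o, u, fun _ => ⟨hu, h⟩⟩
  choose o u hou using hex
  -- The supporting line passes through a point minimising n ord a_i - d i, and this minimum is the
  -- height h.
  obtain ⟨i₀, hi₀, hmin⟩ := Finset.exists_min_image A.support (fun i => n * o i - d * i)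
    (support_nonempty.2 hA)
  set h := n * o i₀ - d * i₀ with hh
  let g : ℕ → Germ C := fun i => if A.coeff i = 0 then 0 else
    germC C ((p ^ (-(d * (i.choose 2 : ℤ))) : Cˣ) : C) *
      germX C ^ (n * o i - d * i - h).toNat * germExpand n hn (u i)
  let P : C[X] := ∑ i ∈ A.support, monomial i (germVal C (g i))
  have hPc : ∀ i, P.coeff i = germVal C (g i) := by
    intro i
    simp only [P, finsetSum_coeff, coeff_monomial]
    rw [Finset.sum_ite_eq']
    split_ifs with hi
    · rfl
    · rw [notMem_support_iff] at hi
      simp [g, hi]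
  refine ⟨h, P, ?_, g, fun i => ⟨?_, (hPc i).symm⟩⟩
  · intro h0
    have h1 := hPc i₀
    rw [h0, coeff_zero] at h1
    have hne := mem_support_iff.1 hi₀
    simp only [g, if_neg hne, ← hh, sub_self, Int.toNat_zero, pow_zero, mul_one, map_mul,
      germVal_germC, germVal_germExpand] at h1
    exact mul_ne_zero (Units.ne_zero _) (hou i₀ hne).1 h1.symm
  · by_cases hi : A.coeff i = 0
    · simp [g, hi]
    · obtain ⟨-, h2⟩ := hou i hi
      have h3 : h ≤ n * o i - d * i := hmin i (mem_support_iff.2 hi)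
      simp only [g, if_neg hi]
      rw [h2, map_mul, ram_xK_zpow, ram_toK, map_mul, map_mul, map_pow]
      change _ = _ * _ * (cst C K _ * xK C K ^ _ * _)
      have e1 : xK C K ^ (n * o i : ℤ) =
          xK C K ^ (d * i + h) * xK C K ^ (n * o i - d * i - h).toNat := by
        rw [← zpow_natCast, Int.toNat_of_nonneg (by omega), ← zpow_add₀ xK_ne_zero]
        ring_nf
      have e2 : cst C K ((p ^ (d * (i.choose 2 : ℤ)) : Cˣ) : C) *
          cst C K ((p ^ (-(d * (i.choose 2 : ℤ))) : Cˣ) : C) = 1 := by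
        rw [← map_mul, ← Units.val_mul, ← zpow_add, add_neg_cancel, zpow_zero, Units.val_one,
          map_one]
      rw [e1]
      linear_combination (-(xK C K ^ (d * i + h) * xK C K ^ (n * o i - d * i - h).toNat *
        toK C K (germExpand n hn (u i)))) * e2

/-- For two points on the same edge, d (i - j) is n times the difference of the integer orders, and
d is prime to n. Hence P is a power of X times a polynomial in Xⁿ. -/
theorem HasInit.dvd_sub {A : K[X]} {h : ℤ} {P : C[X]} (hA : HasInit A n hn d p h P)
    (hc : IsCoprime d (n : ℤ)) {i j : ℕ} (hi : P.coeff i ≠ 0) (hj : P.coeff j ≠ 0) :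
    (n : ℤ) ∣ (i : ℤ) - j := by
  obtain ⟨o, -, ho⟩ := hA.exists_order (hA.coeff_ne_zero hi)
  obtain ⟨o', -, ho'⟩ := hA.exists_order (hA.coeff_ne_zero hj)
  have h1 := ho.2 hi
  have h2 := ho'.2 hj
  refine hc.symm.dvd_of_dvd_mul_left (y := d) ⟨o - o', ?_⟩
  linear_combination h1 - h2

theorem HasInit.ramify {A : K[X]} {h : ℤ} {P : C[X]} {g : ℕ} (hg : g ≠ 0)
    (hA : HasInit A n hn d (p ^ g) h P) :
    HasInit A (n * g) (mul_ne_zero hn hg) (d * g) p (g * h) P := by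
  obtain ⟨hP, f, hf⟩ := hA
  refine ⟨hP, fun i => germExpand g hg (f i), fun i => ⟨?_, ?_⟩⟩
  · rw [← ram_ram n g hn hg, (hf i).1, map_mul, map_mul, ram_cst, ram_xK_zpow, ram_toK]
    congr 3
    · rw [← zpow_natCast, ← zpow_mul]; ring_nf
    · ring
  · rw [germVal_germExpand, (hf i).2]

end Init

/-! ## The modules `C({t})`, `tⁿ = x`, with `Σ f(t) = c t^{-d} f(pt)`, `pⁿ = q` -/

section Model

open Polynomial

variable {C : Type*} [NormedField C] {K : Type*} [Field K] [Algebra (Germ C) K]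
  [IsFractionRing (Germ C) K]

/-- The field `C({t})` as a vector space over `C({x})`, `x = tⁿ`. -/
structure RamK (C K : Type*) (n : ℕ) (hn : n ≠ 0) where
  /-- The underlying element of `C({t})`. -/
  val : K

variable (C K) in
/-- The underlying set of `RamK C K n hn` is `C({t})`. -/
def ramEquiv (n : ℕ) (hn : n ≠ 0) : RamK C K n hn ≃ K where
  toFun := RamK.val
  invFun := RamK.mk
  left_inv _ := rfl
  right_inv _ := rfl

noncomputable instance (n : ℕ) (hn : n ≠ 0) : AddCommGroup (RamK C K n hn) :=
  (ramEquiv C K n hn).addCommGroup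

variable (C K) in
/-- The additive identification of `C({t})` with `RamK C K n hn`. -/
noncomputable def toRam (n : ℕ) (hn : n ≠ 0) : K ≃+ RamK C K n hn where
  toFun := RamK.mk
  invFun := RamK.val
  left_inv _ := rfl
  right_inv _ := rfl
  map_add' _ _ := rfl

noncomputable instance (n : ℕ) (hn : n ≠ 0) : Module (K) (RamK C K n hn) where
  smul f y := toRam C K n hn (ram C n hn f * (toRam C K n hn).symm y)
  one_smul y := by
    change toRam C K n hn (ram C n hn 1 * (toRam C K n hn).symm y) = y
    rw [map_one, one_mul, AddEquiv.apply_symm_apply]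
  mul_smul f g y := by
    change toRam C K n hn (ram C n hn (f * g) * (toRam C K n hn).symm y) =
      toRam C K n hn (ram C n hn f * (toRam C K n hn).symm (toRam C K n hn (ram C n hn g * (toRam C K n hn).symm y)))
    rw [map_mul (ram C n hn), AddEquiv.symm_apply_apply, mul_assoc]
  smul_zero f := by
    change toRam C K n hn (ram C n hn f * (toRam C K n hn).symm 0) = 0
    rw [map_zero, mul_zero, map_zero]
  smul_add f y z := by
    change toRam C K n hn (ram C n hn f * (toRam C K n hn).symm (y + z)) =
      toRam C K n hn (ram C n hn f * (toRam C K n hn).symm y) + toRam C K n hn (ram C n hn f * (toRam C K n hn).symm z)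
    rw [map_add, mul_add, map_add]
  add_smul f g y := by
    change toRam C K n hn (ram C n hn (f + g) * (toRam C K n hn).symm y) =
      toRam C K n hn (ram C n hn f * (toRam C K n hn).symm y) + toRam C K n hn (ram C n hn g * (toRam C K n hn).symm y)
    rw [map_add, add_mul, map_add]
  zero_smul y := by
    change toRam C K n hn (ram C n hn 0 * (toRam C K n hn).symm y) = 0
    rw [map_zero, zero_mul, map_zero]

theorem smul_toRam {n : ℕ} {hn : n ≠ 0} (f y : K) :
    f • toRam C K n hn y = toRam C K n hn (ram C n hn f * y) := by
  change toRam C K n hn (ram C n hn f * (toRam C K n hn).symm (toRam C K n hn y)) = _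
  rw [AddEquiv.symm_apply_apply]

variable (K) in
/-- The semilinear map `f(t) ↦ c t^{-d} f(pt)`. -/
noncomputable def tw {n : ℕ} (hn : n ≠ 0) {p q : Cˣ} (hp : p ^ n = q) (d : ℤ) (c : Cˣ) :
    RamK C K n hn →ₛₗ[((sh q : K ≃+* K) : K →+* K)] RamK C K n hn where
  toFun y := toRam C K n hn (cst C K c * xK C K ^ (-d) * sh p ((toRam C K n hn).symm y))
  map_add' a b := by rw [map_add, map_add, mul_add, map_add]
  map_smul' f a := by
    obtain ⟨a, rfl⟩ := (toRam C K n hn).surjective a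
    rw [smul_toRam, AddEquiv.symm_apply_apply, AddEquiv.symm_apply_apply, smul_toRam,
      map_mul (sh p),      RingEquiv.coe_toRingHom, ram_shift hn hp, mul_left_comm]

variable {n : ℕ} {hn : n ≠ 0} {p q : Cˣ} (hp : p ^ n = q) {d : ℤ} {c : Cˣ}

theorem tw_toRam (y : K) :
    tw K hn hp d c (toRam C K n hn y) = toRam C K n hn (cst C K c * xK C K ^ (-d) * sh p y) := by
  change toRam C K n hn (cst C K c * xK C K ^ (-d) * sh p ((toRam C K n hn).symm (toRam C K n hn y))) = _
  rw [AddEquiv.symm_apply_apply]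

variable (C K) in
/-- The inclusion of the nonzero constants in `C({x})`. -/
noncomputable def cu : Cˣ →* K := (cst C K : C →* K).comp (Units.coeHom C)

theorem cst_coe_units (a : Cˣ) : cst C K (a : C) = cu C K a := rfl

theorem tw_iterate (y : K) (i : ℕ) :
    (tw K hn hp d c)^[i] (toRam C K n hn y) =
      toRam C K n hn (cu C K (c ^ i * p ^ (-(d * (i.choose 2 : ℤ)))) *
        xK C K ^ (-(d * i)) * (sh p)^[i] y) := by
  induction i with
  | zero => simp
  | succ i ih =>
    rw [Function.iterate_succ_apply', ih, tw_toRam, Function.iterate_succ_apply']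
    have e1 : c ^ (i + 1) * p ^ (-(d * ((i + 1).choose 2 : ℤ))) =
        c * (c ^ i * p ^ (-(d * (i.choose 2 : ℤ))) * p ^ (-(d * i))) := by
      rw [Nat.choose_succ_succ' i 1, Nat.choose_one_right, mul_assoc, ← zpow_add, pow_succ']
      push_cast
      rw [mul_assoc]
      congr 3
      ring
    have e2 : xK C K ^ (-(d * ((i + 1 : ℕ) : ℤ))) = xK C K ^ (-d) * xK C K ^ (-(d * i)) := by
      rw [← zpow_add₀ xK_ne_zero]; push_cast; ring_nf
    rw [map_mul (sh p), map_mul (sh p), ← cst_coe_units (c ^ i * _), shift_cst,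
      shift_xK_zpow, e1, e2, cst_coe_units, cst_coe_units, cst_coe_units, map_mul (cu C K) c,
      map_mul (cu C K) (c ^ i * _)]
    congr 1
    ring

/-- The powers of p and t produced by the iterates of the twist cancel those of the initial form. On
t^s C{t} the operator is then a plain p-difference operator with coefficients in C{t}, of which only
the values at 0 matter. -/
theorem ev_tw {A : K[X]} {h : ℤ} {P : C[X]} (hA : HasInit A n hn d p h P) (s : ℤ) :
    ∃ b : ℕ → Germ C, (∀ i, germVal C (b i) = P.coeff i * ((c * p ^ s : Cˣ) : C) ^ i) ∧
      ∀ z : Germ C, ev (tw K hn hp d c) (toRam C K n hn (xK C K ^ s * toK C K z)) A =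
        toRam C K n hn (xK C K ^ (h + s) * toK C K (∑ i ∈ Finset.range (A.natDegree + 1),
          b i * (germShift p)^[i] z)) := by
  obtain ⟨hP, g, hg⟩ := hA
  refine ⟨fun i => germC C ((c * p ^ s : Cˣ) ^ i : Cˣ) * g i, fun i => ?_, fun z => ?_⟩
  · rw [map_mul, germVal_germC, (hg i).2, mul_comm, Units.val_pow_eq_pow_val]
  rw [ev_eq_sum_range _ _ _ (Nat.lt_succ_self _), map_sum, Finset.mul_sum, map_sum]
  refine Finset.sum_congr rfl fun i _ => ?_
  rw [tw_iterate, smul_toRam, (hg i).1]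
  have h1 := shift_iterate_monomial (K := K) p i 1 s z
  rw [map_one, one_mul] at h1
  rw [h1, map_mul (toK C K), map_mul (toK C K)]
  have e1 : cu C K ((c * p ^ s) ^ i) = cu C K (p ^ (d * (i.choose 2 : ℤ))) *
      cu C K (c ^ i * p ^ (-(d * (i.choose 2 : ℤ)))) * cu C K (p ^ (s * i)) := by
    rw [← map_mul, ← map_mul]
    congr 1
    rw [mul_pow, zpow_neg, zpow_mul p s, zpow_natCast, mul_left_comm, mul_inv_cancel, mul_one]
  have e2 : xK C K ^ (h + s) = xK C K ^ (d * i + h) * xK C K ^ (-(d * i)) * xK C K ^ s := by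
    rw [← zpow_add₀ xK_ne_zero, ← zpow_add₀ xK_ne_zero]; ring_nf
  have e3 : toK C K (germC C (((c * p ^ s) ^ i : Cˣ) : C)) = cu C K ((c * p ^ s) ^ i) := rfl
  rw [e3, e1, e2, cst_coe_units, cst_coe_units]
  congr 1
  ring

theorem germVal_sum_range {A : K[X]} {h : ℤ} {P : C[X]} (hA : HasInit A n hn d p h P)
    {b : ℕ → Germ C} {a : C} (hb : ∀ i, germVal C (b i) = P.coeff i * a ^ i) (z : Germ C) :
    germVal C (∑ i ∈ Finset.range (A.natDegree + 1), b i * (germShift p)^[i] z) =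
      P.eval a * germVal C z := by
  rw [map_sum, eval_eq_sum_range' (Nat.lt_succ_of_le hA.natDegree_le), Finset.sum_mul]
  refine Finset.sum_congr rfl fun i _ => ?_
  rw [map_mul, germVal_germShift_iterate, hb]

/-- If y has order s, the lowest coefficient of the image of y is P(c p^s) times that of y. -/
theorem exists_eval_eq_zero {A : K[X]} {h : ℤ} {P : C[X]}
    (hA : HasInit A n hn d p h P) {y : RamK C K n hn} (hy : y ≠ 0)
    (h0 : ev (tw K hn hp d c) y A = 0) : ∃ s : ℤ, P.eval ((c * p ^ s : Cˣ) : C) = 0 := by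
  obtain ⟨s, u, hu, hyu⟩ := exists_eq_zpow_mul (C := C) (f := (toRam C K n hn).symm y)
    (by rwa [Ne, EmbeddingLike.map_eq_zero_iff])
  obtain ⟨b, hb, hev⟩ := ev_tw hp (c := c) hA s
  refine ⟨s, ?_⟩
  have h1 := hev u
  rw [← hyu, AddEquiv.apply_symm_apply, h0, eq_comm, EmbeddingLike.map_eq_zero_iff] at h1
  by_contra hne
  refine toK_mul_zpow_ne_zero (u := ∑ i ∈ Finset.range (A.natDegree + 1),
    b i * (germShift p)^[i] u) ?_ (h + s) h1
  rw [germVal_sum_range hA hb]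
  exact mul_ne_zero hne hu

theorem germ_eq_X_mul {g : Germ C} (hg : germVal C g = 0) : ∃ u, g = germX C * u := by
  by_cases h0 : g = 0
  · exact ⟨0, by rw [h0, mul_zero]⟩
  obtain ⟨u, hu, h1, -⟩ := germ_eq_X_pow_mul h0
  obtain ⟨k, hk⟩ : ∃ k, g.1.order.toNat = k + 1 := by
    refine Nat.exists_eq_succ_of_ne_zero fun hz => hu ?_
    rw [hz, pow_zero, one_mul] at h1
    rw [← h1, hg]
  rw [hk, pow_succ', mul_assoc] at h1
  exact ⟨_, h1⟩

/-- A solution is sought as y = 1 + t z. The constant term is free because P(c) = 0, and the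
coefficient of t^{m+1} has divisor P(c p^{m+1}), which is nonzero with controlled inverses. -/
theorem exists_ev_tw_eq_zero (hp1 : ‖(p : C)‖ = 1) {A : K[X]} {h : ℤ} {P : C[X]}
    (hA : HasInit A n hn d p h P) (h0 : P.eval (c : C) = 0)
    (h1 : ∀ m : ℕ, P.eval ((c * p ^ (m + 1) : Cˣ) : C) ≠ 0)
    (hG : GeoBdd fun m => ‖P.eval ((c * p ^ (m + 1) : Cˣ) : C)‖⁻¹) :
    ∃ y : RamK C K n hn, y ≠ 0 ∧ ev (tw K hn hp d c) y A = 0 := by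
  obtain ⟨b, hb, hev⟩ := ev_tw hp (c := c) hA 0
  obtain ⟨b', hb', hev'⟩ := ev_tw hp (c := c) hA 1
  obtain ⟨w, hw⟩ := germ_eq_X_mul (g := ∑ i ∈ Finset.range (A.natDegree + 1),
    b i * (germShift p)^[i] 1) (by
      rw [germVal_sum_range hA hb, zpow_zero, mul_one, h0, zero_mul])
  obtain ⟨z, hz⟩ := exists_germ_solution b' (A.natDegree + 1) p hp1
    (fun m => P.eval ((c * p ^ (m + 1) : Cˣ) : C)) (fun m => by
      rw [eval_eq_sum_range' (Nat.lt_succ_of_le hA.natDegree_le)]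
      refine Finset.sum_congr rfl fun i _ => ?_
      rw [← germVal_apply, hb', mul_assoc]
      congr 1
      rw [← Units.val_pow_eq_pow_val, ← Units.val_pow_eq_pow_val, ← Units.val_pow_eq_pow_val,
        ← Units.val_mul]
      congr 1
      rw [zpow_one, pow_succ, mul_pow, mul_pow, mul_pow, ← pow_mul, mul_comm i m]
      ac_rfl) h1 hG (-w)
  refine ⟨toRam C K n hn (toK C K (1 + germX C * z)), ?_, ?_⟩
  · rw [Ne, EmbeddingLike.map_eq_zero_iff]
    have := toK_mul_zpow_ne_zero (K := K) (u := 1 + germX C * z) (by simp) 0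
    rwa [zpow_zero, one_mul] at this
  · have e1 : toK C K (1 + germX C * z) =
        xK C K ^ (0 : ℤ) * toK C K 1 + xK C K ^ (1 : ℤ) * toK C K z := by
      rw [map_add, map_mul, zpow_zero, zpow_one, one_mul]; rfl
    rw [e1, map_add, ev_add_left, hev, hev', hw, hz, ← map_add, EmbeddingLike.map_eq_zero_iff,
      zpow_add₀ xK_ne_zero, zpow_add₀ xK_ne_zero, map_mul, map_neg, zpow_one, zpow_zero]
    change _ * _ * (xK C K * _) + _ = _
    ring

/-- Multiplication by t^{-s} is an isomorphism from the model of c to that of c p^s, so c matters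
only up to powers of p. -/
theorem ev_tw_shift (y : K) (A : K[X]) (s : ℤ) :
    ev (tw K hn hp d (c * p ^ s)) (toRam C K n hn (xK C K ^ (-s) * y)) A =
      toRam C K n hn (xK C K ^ (-s) * (toRam C K n hn).symm (ev (tw K hn hp d c) (toRam C K n hn y) A)) := by
  rw [ev_eq_sum_range _ _ _ (Nat.lt_succ_self _), ev_eq_sum_range _ _ _ (Nat.lt_succ_self _),
    map_sum, Finset.mul_sum, map_sum]
  refine Finset.sum_congr rfl fun i _ => ?_
  rw [tw_iterate, tw_iterate, smul_toRam, smul_toRam, AddEquiv.symm_apply_apply]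
  have e0 : (sh p)^[i] (xK C K ^ (-s) * y) =
      cu C K (p ^ (-s * i)) * (xK C K ^ (-s) * (sh p)^[i] y) := by
    have h1 := shift_iterate_monomial (K := K) p i 1 (-s) 1
    rw [map_one, one_mul, map_one, mul_one, iterate_map_one, map_one, mul_one] at h1
    rw [iterate_map_mul, h1, cst_coe_units]; ring
  have e1 : cu C K ((c * p ^ s) ^ i * p ^ (-(d * (i.choose 2 : ℤ)))) * cu C K (p ^ (-s * i)) =
      cu C K (c ^ i * p ^ (-(d * (i.choose 2 : ℤ)))) := by
    rw [← map_mul]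
    congr 1
    rw [mul_pow, neg_mul, zpow_neg _ (s * i), zpow_mul p s, zpow_natCast]
    rw [mul_right_comm, mul_right_comm (c ^ i), mul_assoc (c ^ i * _), mul_right_comm,
      mul_assoc, mul_inv_cancel_comm]
  rw [e0]
  congr 1
  linear_combination (ram C n hn (A.coeff i) * xK C K ^ (-(d * i)) * xK C K ^ (-s) *
    (sh p)^[i] y) * e1

theorem le_natDegree_of_ev_tw (hc : IsCoprime d (n : ℤ)) {B : K[X]} (hB : B ≠ 0)
    {y : RamK C K n hn} (hy : y ≠ 0) (h0 : ev (tw K hn hp d c) y B = 0) : n ≤ B.natDegree := by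
  obtain ⟨h, P, hP⟩ := exists_hasInit hB n hn d p
  obtain ⟨s, hs⟩ := exists_eval_eq_zero hp hP hy h0
  by_contra hlt
  rw [not_le] at hlt
  -- An annihilator of degree less than n would have an initial form supported in an interval
  -- shorter than n, hence at one point by `HasInit.dvd_sub`; but a monomial has no nonzero root.
  have hmono : P = monomial P.natDegree P.leadingCoeff := by
    ext i
    rw [coeff_monomial]
    split_ifs with hi
    · rw [← hi]; rfl
    · by_contra hne
      have h1 := hP.dvd_sub hc (leadingCoeff_ne_zero.2 hP.1) hne
      have h2 : P.natDegree ≤ B.natDegree := hP.natDegree_le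
      have h3 : i ≤ P.natDegree := le_natDegree_of_ne_zero hne
      have h4 := Int.eq_zero_of_dvd_of_nonneg_of_lt (by omega) (by omega) h1
      omega
  rw [hmono, eval_monomial] at hs
  exact mul_ne_zero (leadingCoeff_ne_zero.2 hP.1) (pow_ne_zero _ (Units.ne_zero _)) hs

/-- Sort the powers of t by the residue of the exponent modulo n. -/
theorem span_RamK (n : ℕ) (hn : n ≠ 0) :
    Submodule.span (K) (Set.range fun j : Fin n =>
      toRam C K n hn (xK C K ^ (j : ℕ))) = ⊤ := by
  set N := Submodule.span (K) (Set.range fun j : Fin n =>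
      toRam C K n hn (xK C K ^ (j : ℕ))) with hN
  have hg : ∀ g : Germ C, toRam C K n hn (toK C K g) ∈ N := by
    intro g
    have hconv : ∀ j : ℕ, IsConvergent
        (PowerSeries.mk fun k => PowerSeries.coeff (n * k + j) g.1) := by
      intro j
      obtain ⟨A, B, hA, hB, h⟩ := g.2.exists_one_le
      refine ⟨A * B ^ j, B ^ n, by positivity, fun k => ?_⟩
      rw [PowerSeries.coeff_mk]
      exact (h _).trans_eq (by rw [pow_add, pow_mul]; ring)
    have e : g = ∑ j ∈ Finset.range n, germX C ^ j * germExpand n hn ⟨_, hconv j⟩ := by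
      apply Subtype.ext
      ext m
      have hcoe : ((∑ j ∈ Finset.range n, germX C ^ j * germExpand n hn ⟨_, hconv j⟩ : Germ C)).1 =
          ∑ j ∈ Finset.range n, (PowerSeries.X : PowerSeries C) ^ j *
            PowerSeries.expand n hn (PowerSeries.mk fun k => PowerSeries.coeff (n * k + j) g.1) := by
        push_cast; rfl
      rw [hcoe, map_sum, Finset.sum_eq_single (m % n)]
      · rw [PowerSeries.coeff_X_pow_mul', if_pos (Nat.mod_le _ _), PowerSeries.coeff_expand,
          if_pos (Nat.dvd_sub_mod m), PowerSeries.coeff_mk,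
          Nat.mul_div_cancel' (Nat.dvd_sub_mod m), Nat.sub_add_cancel (Nat.mod_le _ _)]
      · intro j hj hne
        rw [PowerSeries.coeff_X_pow_mul']
        split_ifs with hjm
        · rw [PowerSeries.coeff_expand, if_neg]
          intro hdvd
          have := (Nat.modEq_iff_dvd' hjm).2 hdvd
          rw [Nat.ModEq, Nat.mod_eq_of_lt (Finset.mem_range.1 hj)] at this
          exact hne this
        · rfl
      · intro h
        exact absurd (Finset.mem_range.2 (Nat.mod_lt _ (Nat.pos_of_ne_zero hn))) h
    have e' : toRam C K n hn (toK C K g) = ∑ j ∈ Finset.range n,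
        toK C K ⟨_, hconv j⟩ • toRam C K n hn (xK C K ^ j) := by
      conv_lhs => rw [e]
      rw [map_sum, map_sum]
      refine Finset.sum_congr rfl fun j _ => ?_
      rw [smul_toRam, ram_toK, map_mul, map_pow, mul_comm]; rfl
    rw [e']
    refine Submodule.sum_mem _ fun j hj => N.smul_mem _ (Submodule.subset_span ?_)
    exact ⟨⟨j, Finset.mem_range.1 hj⟩, rfl⟩
  rw [eq_top_iff]
  rintro y -
  obtain ⟨y, rfl⟩ := (toRam C K n hn).surjective y
  obtain ⟨k, g, hk⟩ := exists_eq_zpow_mul' (C := C) y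
  -- A pole is moved into the scalars: t^{-k} = x^{-k} t^{(n-1)k}.
  have e : toRam C K n hn y = xK C K ^ (-(k : ℤ)) •
      toRam C K n hn (toK C K (germX C ^ ((n - 1) * k) * g)) := by
    rw [smul_toRam, ram_xK_zpow, map_mul (toK C K), map_pow, hk]
    change _ = toRam C K n hn (_ * (xK C K ^ _ * _))
    rw [← mul_assoc, ← zpow_natCast (xK C K), ← zpow_add₀ xK_ne_zero]
    congr 3
    have : 1 ≤ n := Nat.pos_of_ne_zero hn
    push_cast [Nat.cast_sub this]
    ring
  rw [e]
  exact N.smul_mem _ (hg _)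

instance (n : ℕ) (hn : n ≠ 0) : FiniteDimensional (K) (RamK C K n hn) :=
  Module.finite_def.2 (span_RamK (C := C) (K := K) n hn ▸ Submodule.fg_span (Set.finite_range _))

theorem finrank_RamK_le (n : ℕ) (hn : n ≠ 0) :
    Module.finrank (K) (RamK C K n hn) ≤ n := by
  have := finrank_range_le_card (R := K) (fun j : Fin n =>
      toRam C K n hn (xK C K ^ (j : ℕ)))
  rw [Set.finrank, span_RamK, finrank_top, Fintype.card_fin] at this
  exact this

/-- Simplicity of the model: its dimension is at most n, while every nonzero element generates a
subspace of dimension at least n. -/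
theorem isMin_tw (hc : IsCoprime d (n : ℤ)) {y : RamK C K n hn} (hy : y ≠ 0) {R : K[X]}
    (hR : IsMin (tw K hn hp d c) ⊥ y R) :
    R.natDegree = n ∧ LinearMap.range (ev (tw K hn hp d c) y) = ⊤ := by
  have h1 := hR.finrank_range
  have h2 := le_natDegree_of_ev_tw hp hc hR.ne_zero hy hR.ev_eq_zero
  have h3 := Submodule.finrank_le (LinearMap.range (ev (tw K hn hp d c) y))
  have h4 := finrank_RamK_le (C := C) (K := K) n hn
  refine ⟨by omega, Submodule.eq_top_of_finrank_eq (by omega)⟩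

end Model

/-! ## The operators `x^d σ^n - λ` -/

section Tau

open Polynomial

variable {C : Type*} [NormedField C] {K : Type*} [Field K] [Algebra (Germ C) K]
  [IsFractionRing (Germ C) K]

variable (K) in
/-- The operator `x^d σ^n - λ`. -/
noncomputable def tau (n : ℕ) (d : ℤ) (lam : Cˣ) : K[X] :=
  monomial n (xK C K ^ d) - Polynomial.C (cst C K lam)

theorem natDegree_tau {n : ℕ} (hn : n ≠ 0) (d : ℤ) (lam : Cˣ) : (tau K n d lam).natDegree = n := by
  rw [tau, natDegree_sub_C, natDegree_monomial_eq _ (zpow_ne_zero _ xK_ne_zero)]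

theorem tau_ne_zero {n : ℕ} (hn : n ≠ 0) (d : ℤ) (lam : Cˣ) : tau K n d lam ≠ 0 := by
  intro h
  have := natDegree_tau (K := K) hn d lam
  rw [h, natDegree_zero] at this
  exact hn this.symm

/-- The multiplier of the operator `x^d σ^n` on the model `C({t})`. -/
def lamOf (n : ℕ) (d : ℤ) (p c : Cˣ) : Cˣ := c ^ n * p ^ (-(d * (n.choose 2 : ℤ)))

section Module

variable {σ : K ≃+* K} {M : Type*} [AddCommGroup M] [Module K M] {S : M →ₛₗ[(σ : K →+* K)] M}

theorem ev_tau (m : M) (n : ℕ) (d : ℤ) (lam : Cˣ) :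
    ev S m (tau K n d lam) = xK C K ^ d • S^[n] m - cst C K lam • m := by
  rw [tau, map_sub, ev_monomial, ev_C]

end Module

variable {n : ℕ} {hn : n ≠ 0} {p q : Cˣ} (hp : p ^ n = q) {d : ℤ} {c : Cˣ}

theorem ev_tw_tau (n₂ : ℕ) (d₂ : ℤ) (lam : Cˣ) (y : K) :
    ev (tw K hn hp d c) (toRam C K n hn y) (tau K n₂ d₂ lam) =
      toRam C K n hn (cu C K (lamOf n₂ d p c) * xK C K ^ (n * d₂ - d * n₂ : ℤ) * (sh p)^[n₂] y -
        cst C K lam * y) := by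
  rw [ev_tau, tw_iterate, smul_toRam, smul_toRam, ← map_sub, ram_xK_zpow, ram_cst, lamOf]
  congr 2
  rw [sub_eq_add_neg, zpow_add₀ xK_ne_zero]
  ring

theorem ev_tw_one : ev (tw K hn hp d c) (toRam C K n hn 1) (tau K n d (lamOf n d p c)) = 0 := by
  rw [ev_tw_tau, iterate_map_one, mul_one, mul_comm (n : ℤ) d, sub_self, zpow_zero, mul_one,
    cst_coe_units, mul_one, sub_self, map_zero]

theorem toRam_one_ne_zero : toRam C K n hn 1 ≠ 0 := by
  rw [Ne, EmbeddingLike.map_eq_zero_iff]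
  exact one_ne_zero

theorem isMin_tau (hc : IsCoprime d (n : ℤ)) :
    IsMin (tw K hn hp d c) ⊥ (toRam C K n hn 1) (tau K n d (lamOf n d p c)) := by
  refine ⟨tau_ne_zero hn _ _, by rw [ev_tw_one]; exact Submodule.zero_mem _, fun B hB hB0 => ?_⟩
  rw [natDegree_tau hn]
  exact le_natDegree_of_ev_tw hp hc hB0 toRam_one_ne_zero ((Submodule.mem_bot K).1 hB)

theorem range_ev_one (hc : IsCoprime d (n : ℤ)) :
    LinearMap.range (ev (tw K hn hp d c) (toRam C K n hn 1)) = ⊤ :=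
  (isMin_tw hp hc toRam_one_ne_zero (isMin_tau hp hc)).2

theorem sh_iterate_zpow_mul (p : Cˣ) (i : ℕ) (s : ℤ) (g : Germ C) :
    (sh p)^[i] (xK C K ^ s * toK C K g) =
      xK C K ^ s * toK C K (germC C ((p ^ (s * i) : Cˣ) : C) * (germShift p)^[i] g) := by
  have := shift_iterate_monomial (K := K) p i 1 s g
  rw [map_one, one_mul] at this
  rw [this, map_mul]
  change cst C K _ * _ = _ * (cst C K _ * _)
  ring

/-- On the model the operator acts as κ t^e σ^{n₂} - λ, up to constants, with e ≠ 0 measuring the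
difference of slopes. The term of lower order in t gives the divisors; they have constant absolute
value because |p| = 1, so there are no small divisors. -/
theorem ev_tau_surjective_of_slope_ne (hp1 : ‖(p : C)‖ = 1) {n₂ : ℕ} (hn₂ : n₂ ≠ 0) {d₂ : ℤ}
    (h : n * d₂ ≠ d * n₂) (lam : Cˣ) (w : RamK C K n hn) :
    ∃ u, ev (tw K hn hp d c) u (tau K n₂ d₂ lam) = w := by
  obtain ⟨w, rfl⟩ := (toRam C K n hn).surjective w
  obtain ⟨k, g, rfl⟩ := exists_eq_zpow_mul' (C := C) w
  set e : ℤ := n * d₂ - d * n₂ with he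
  set κ := lamOf n₂ d p c
  have hsum : ∀ (b₀ b₁ z : Germ C), ∑ i ∈ Finset.range (n₂ + 1),
      (if i = 0 then b₀ else if i = n₂ then b₁ else 0) * (germShift p)^[i] z =
      b₀ * z + b₁ * (germShift p)^[n₂] z := by
    intro b₀ b₁ z
    obtain ⟨j, rfl⟩ := Nat.exists_eq_succ_of_ne_zero hn₂
    rw [Finset.sum_range_succ, Finset.sum_range_succ', Finset.sum_eq_zero]
    · simp
    · intro i hi
      have := Finset.mem_range.1 hi
      rw [if_neg (by omega), if_neg (by omega), zero_mul]
  have hP : ∀ (b₀ b₁ : Germ C) (m : ℕ), ∑ i ∈ Finset.range (n₂ + 1),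
      PowerSeries.constantCoeff (if i = 0 then b₀ else if i = n₂ then b₁ else 0 : Germ C).1 *
        (p : C) ^ (i * m) = germVal C b₀ + germVal C b₁ * (p : C) ^ (n₂ * m) := by
    intro b₀ b₁ m
    obtain ⟨j, rfl⟩ := Nat.exists_eq_succ_of_ne_zero hn₂
    rw [Finset.sum_range_succ, Finset.sum_range_succ', Finset.sum_eq_zero]
    · simp [germVal_apply]
    · intro i hi
      have := Finset.mem_range.1 hi
      rw [if_neg (by omega), if_neg (by omega)]
      simp
  rcases lt_or_gt_of_ne (show e ≠ 0 from sub_ne_zero.2 h) with hneg | hpos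
  -- For e < 0 the dominant term lowers the order by -e, so the solution starts at order -k - e. In
  -- the other case λ dominates and the solution starts at order -k.
  · set s : ℤ := -k - e with hs
    obtain ⟨z, hz⟩ := exists_germ_solution
      (fun i => if i = 0 then -(germC C lam * germX C ^ (-e).toNat) else if i = n₂ then
        germC C (κ * p ^ (s * n₂) : Cˣ) else 0) (n₂ + 1) p hp1
      (fun m => ((κ * p ^ (s * n₂) : Cˣ) : C) * (p : C) ^ (n₂ * m)) (fun m => by
        rw [hP, map_neg, map_mul, map_pow, germVal_germX, zero_pow (by omega), mul_zero, neg_zero,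
          zero_add, germVal_germC])
      (fun m => mul_ne_zero (Units.ne_zero _) (pow_ne_zero _ (Units.ne_zero _)))
      (geoBdd_of_le (‖((κ * p ^ (s * n₂) : Cˣ) : C)‖⁻¹) fun m => by
        rw [norm_mul, norm_pow, hp1, one_pow, mul_one]) g
    rw [hsum] at hz
    refine ⟨toRam C K n hn (xK C K ^ s * toK C K z), ?_⟩
    rw [ev_tw_tau, sh_iterate_zpow_mul, ← hz]
    congr 1
    have e1 : xK C K ^ s = xK C K ^ (-(k : ℤ)) * xK C K ^ (-e).toNat := by
      rw [← zpow_natCast (xK C K), Int.toNat_of_nonneg (by omega), ← zpow_add₀ xK_ne_zero, hs]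
      congr 1
    have e2 : xK C K ^ e * xK C K ^ (-e).toNat = 1 := by
      rw [← zpow_natCast (xK C K), Int.toNat_of_nonneg (by omega), ← zpow_add₀ xK_ne_zero,
        add_neg_cancel, zpow_zero]
    simp only [map_mul, map_add, map_neg, map_pow, Units.val_mul]
    change cu C K κ * xK C K ^ e * (_ * (cst C K _ * _)) - _ =
      _ * (-(cst C K _ * xK C K ^ _) * _ + cu C K κ * cst C K _ * _)
    rw [e1]
    linear_combination (cu C K κ * cst C K ((p ^ (s * n₂) : Cˣ) : C) * xK C K ^ (-(k : ℤ)) *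
      toK C K ((germShift p)^[n₂] z)) * e2
  · set s : ℤ := -k with hs
    obtain ⟨z, hz⟩ := exists_germ_solution
      (fun i => if i = 0 then -germC C lam else if i = n₂ then
        germC C (κ * p ^ (s * n₂) : Cˣ) * germX C ^ e.toNat else 0) (n₂ + 1) p hp1
      (fun m => -(lam : C)) (fun m => by
        rw [hP, map_neg, germVal_germC, map_mul, map_pow, germVal_germX, zero_pow (by omega),
          mul_zero, zero_mul, add_zero])
      (fun m => neg_ne_zero.2 (Units.ne_zero _)) (geoBdd_of_le _ fun _ => le_rfl) g
    rw [hsum] at hz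
    refine ⟨toRam C K n hn (xK C K ^ s * toK C K z), ?_⟩
    rw [ev_tw_tau, sh_iterate_zpow_mul, ← hz]
    congr 1
    have e1 : xK C K ^ e = xK C K ^ e.toNat := by
      rw [← zpow_natCast (xK C K), Int.toNat_of_nonneg hpos.le]
    simp only [map_mul, map_add, map_neg, map_pow, Units.val_mul]
    change cu C K κ * xK C K ^ e * (_ * (cst C K _ * _)) - _ =
      _ * (-(cst C K _) * _ + cu C K κ * cst C K _ * xK C K ^ _ * _)
    rw [e1]
    ring

theorem toK_add_const_mul (a b e : C) (k : ℕ) (y z : Germ C) :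
    cst C K a * (xK C K ^ (-(k : ℤ)) * toK C K z) - cst C K b * (xK C K ^ (-(k : ℤ)) * toK C K y) +
      cst C K e = xK C K ^ (-(k : ℤ)) *
        toK C K (germC C a * z - germC C b * y + germC C e * germX C ^ k) := by
  have h : xK C K ^ (-(k : ℤ)) * xK C K ^ k = 1 := by
    rw [zpow_neg, zpow_natCast, inv_mul_cancel₀ (pow_ne_zero _ xK_ne_zero)]
  simp only [map_mul, map_add, map_sub, map_pow]
  change cst C K a * _ - cst C K b * _ + _ = _ * (cst C K a * _ - cst C K b * _ + cst C K e * xK C K ^ k)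
  linear_combination (-cst C K e) * h

theorem coeff_mul_germC (a : C) (z : Germ C) (m : ℕ) :
    PowerSeries.coeff m (germC C a * z).1 = a * PowerSeries.coeff m z.1 := by
  change PowerSeries.coeff m (PowerSeries.C a * z.1) = _
  rw [PowerSeries.coeff_C_mul]

theorem coeff_germX_pow (k m : ℕ) :
    PowerSeries.coeff m (germX C ^ k).1 = if m = k then 1 else 0 := by
  change PowerSeries.coeff m (PowerSeries.X ^ k) = _
  rw [PowerSeries.coeff_X_pow]

theorem coeff_tau_germ (hp : p ^ n = q) (a b e : C) (k m : ℕ) (z : Germ C) :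
    PowerSeries.coeff m (germC C a * (germC C ((p ^ (-(k : ℤ) * n) : Cˣ) : C) * (germShift p)^[n] z) -
      germC C b * z + germC C e * germX C ^ k).1 =
      (a * ((q ^ ((m : ℤ) - k) : Cˣ) : C) - b) * PowerSeries.coeff m z.1 +
        if m = k then e else 0 := by
  change PowerSeries.coeff m ((germC C a * (germC C ((p ^ (-(k : ℤ) * n) : Cˣ) : C) *
    (germShift p)^[n] z)).1 - (germC C b * z).1 + (germC C e * germX C ^ k).1) = _
  rw [map_add, map_sub, coeff_mul_germC, coeff_mul_germC, coeff_mul_germC, coeff_mul_germC,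
    coeff_germX_pow, coeff_germShift_iterate, mul_ite, mul_one, mul_zero]
  have : ((q ^ ((m : ℤ) - k) : Cˣ) : C) = ((p ^ (-(k : ℤ) * n) : Cˣ) : C) * (p : C) ^ (n * m) := by
    rw [← Units.val_pow_eq_pow_val, ← Units.val_mul, ← hp, ← zpow_natCast p, ← zpow_natCast p,
      ← zpow_mul, ← zpow_add]
    congr 2
    push_cast
    ring
  rw [this]
  ring

/-- Solution of `x^d σ^n u - λ₂ u = w` up to a constant in the model of the same slope. -/
theorem exists_ev_tau_add_const {lam₂ : Cˣ}
    (hG : ∀ k : ℕ, GeoBdd fun m : ℕ =>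
      ‖((lamOf n d p c : Cˣ) : C) * ((q ^ ((m : ℤ) - k) : Cˣ) : C) - lam₂‖⁻¹)
    (h0 : ∀ s : ℤ, lamOf n d p c * q ^ s = lam₂ → s = 0) (w : RamK C K n hn) :
    ∃ u a, w = ev (tw K hn hp d c) u (tau K n d lam₂) + cst C K a • toRam C K n hn 1 ∧
      (a ≠ 0 → lamOf n d p c = lam₂) := by
  classical
  obtain ⟨w, rfl⟩ := (toRam C K n hn).surjective w
  obtain ⟨k, g, rfl⟩ := exists_eq_zpow_mul' (C := C) w
  set lam := lamOf n d p c with hlam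
  -- For equal slopes the operator is diagonal on powers of t: the coefficient of t^{m-k} is
  -- multiplied by λ q^{m-k} - λ₂. If λ = λ₂ the divisor at m = k is zero, its inverse is 0 by
  -- convention, and the coefficient of t⁰ is what remains as `a`.
  set D : ℕ → C := fun m => (lam : C) * ((q ^ ((m : ℤ) - k) : Cˣ) : C) - lam₂ with hD
  have hz : IsConvergent (PowerSeries.mk fun m => (D m)⁻¹ * PowerSeries.coeff m g.1) := by
    obtain ⟨A, B, hA, hB, h⟩ := g.2.exists_one_le
    obtain ⟨A', B', hB', h'⟩ := growth_of_recursion (hG k)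
      (fun m => (D m)⁻¹ * PowerSeries.coeff m g.1) (A₁ := 0) (A₂ := A) (B := B) le_rfl
      (by linarith) hA (fun m => by
        simp only [zero_mul, Finset.sum_const_zero, add_zero, norm_mul, norm_inv]
        exact mul_le_mul (le_max_right _ _) (h m) (norm_nonneg _)
          (zero_le_one.trans (le_max_left _ _)))
    exact ⟨A', B', hB', fun m => by rw [PowerSeries.coeff_mk]; exact h' m⟩
  set z : Germ C := ⟨_, hz⟩ with hzdef
  set a : C := if lam = lam₂ then PowerSeries.coeff k g.1 else 0 with ha
  refine ⟨toRam C K n hn (xK C K ^ (-(k : ℤ)) * toK C K z), a, ?_, fun h => ?_⟩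
  · rw [ev_tw_tau, smul_toRam, ← map_add, ram_cst, mul_one, mul_comm (n : ℤ) d, sub_self, zpow_zero,
      mul_one, sh_iterate_zpow_mul, ← cst_coe_units, ← hlam, toK_add_const_mul]
    congr 3
    apply Subtype.ext
    ext m
    rw [coeff_tau_germ hp, hzdef, PowerSeries.coeff_mk]
    change _ = D m * _ + _
    by_cases hDm : D m = 0
    · have h1 : lam * q ^ ((m : ℤ) - k) = lam₂ := Units.ext (by
        rw [Units.val_mul]; exact sub_eq_zero.1 hDm)
      have h2 : m = k := by have := h0 _ h1; omega
      rw [h2, sub_self, zpow_zero, mul_one] at h1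
      rw [hDm, zero_mul, zero_add, if_pos h2, ha, if_pos h1, h2]
    · rw [← mul_assoc, mul_inv_cancel₀ hDm, one_mul, ha]
      split_ifs with h2 h1
      · exfalso
        apply hDm
        rw [hD]
        simp only [h2, sub_self, zpow_zero, Units.val_one, mul_one, h1]
      · rw [add_zero]
      · rw [add_zero]
  · by_contra hne
    exact h (by rw [ha, if_neg hne])

/-- The operator multiplies the coefficient of t⁰ by λ - λ = 0, so no nonzero constant is in its
image. This is the source of all the nonsplitting statements. -/
theorem eq_zero_of_ev_tau_eq_const {u : RamK C K n hn} {a : C}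
    (h : ev (tw K hn hp d c) u (tau K n d (lamOf n d p c)) = cst C K a • toRam C K n hn 1) :
    a = 0 := by
  obtain ⟨y, rfl⟩ := (toRam C K n hn).surjective u
  obtain ⟨k, z, rfl⟩ := exists_eq_zpow_mul' (C := C) y
  rw [← sub_eq_zero, sub_eq_add_neg, ← neg_smul, ← map_neg, ev_tw_tau, smul_toRam, ← map_add,
    ram_cst, mul_one, mul_comm (n : ℤ) d, sub_self, zpow_zero,
    mul_one, sh_iterate_zpow_mul, ← cst_coe_units, toK_add_const_mul,
    EmbeddingLike.map_eq_zero_iff, mul_eq_zero, or_iff_right (zpow_ne_zero _ xK_ne_zero),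
    toK_eq_zero] at h
  have := congrArg (fun g : Germ C => PowerSeries.coeff k g.1) h
  rw [coeff_tau_germ hp, sub_self, zpow_zero, Units.val_one, mul_one, sub_self, zero_mul, zero_add,
    if_pos rfl] at this
  simpa using this

end Tau

/-! ## Sets of exponents without small divisors -/

section Exponents

open Polynomial

variable {C : Type*} [NormedField C] {K : Type*} [Field K] [Algebra (Germ C) K]
  [IsFractionRing (Germ C) K] {q : Cˣ}

/-- A set of exponents for each slope, stable under the natural equivalence of exponents, whose
quotients have no small divisors. -/
structure ExponentData (C : Type*) [NormedField C] (q : Cˣ) where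
  /-- A root of `q` of order the denominator of the slope. -/
  root : ℚ → Cˣ
  root_pow : ∀ μ, root μ ^ μ.den = q
  /-- The exponents. -/
  set : ℚ → Set Cˣ
  closed : ∀ {μ : ℚ} {c c' : Cˣ} {m : ℤ}, c ∈ set μ → c' ^ μ.den = c ^ μ.den * q ^ m → c' ∈ set μ
  bdd : ∀ {μ : ℚ} {c c' : Cˣ}, c ∈ set μ → c' ∈ set μ →
    GeoBdd fun i => ‖1 - ((root μ ^ i * (c / c') : Cˣ) : C)‖⁻¹

variable (X : ExponentData C q)

namespace ExponentData

/-- The multiplier of an exponent. -/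
def lam (μ : ℚ) (c : Cˣ) : Cˣ := lamOf μ.den μ.num (X.root μ) c

variable (K) in
/-- The operator annihilating the generator of the model. -/
noncomputable def op (μ : ℚ) (c : Cˣ) : K[X] := tau K μ.den μ.num (X.lam μ c)

variable (K) in
/-- The semilinear map of the model. -/
noncomputable abbrev model (μ : ℚ) (c : Cˣ) :
    RamK C K μ.den μ.den_nz →ₛₗ[((sh q : K ≃+* K) : K →+* K)] RamK C K μ.den μ.den_nz :=
  tw K μ.den_nz (X.root_pow μ) μ.num c

theorem root_zpow_pow (μ : ℚ) (s : ℤ) : (X.root μ ^ s) ^ μ.den = q ^ s := by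
  have := congrArg (· ^ s) (X.root_pow μ)
  rw [← this, ← zpow_natCast (X.root μ ^ s), ← zpow_natCast (X.root μ), ← zpow_mul, ← zpow_mul,
    mul_comm s]

theorem mul_zpow_mem {μ : ℚ} {c : Cˣ} (hc : c ∈ X.set μ) (s : ℤ) : c * X.root μ ^ s ∈ X.set μ := by
  refine X.closed (m := s) hc ?_
  rw [mul_pow, X.root_zpow_pow]

theorem lam_mul_zpow (μ : ℚ) (c : Cˣ) (s : ℤ) : X.lam μ (c * X.root μ ^ s) = X.lam μ c * q ^ s := by
  rw [lam, lam, lamOf, lamOf, mul_pow]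
  rw [X.root_zpow_pow]
  exact mul_right_comm _ _ _

theorem norm_root (hq1 : ‖(q : C)‖ = 1) (μ : ℚ) : ‖(X.root μ : C)‖ = 1 := by
  rw [← X.root_pow μ, Units.val_pow_eq_pow_val, norm_pow] at hq1
  exact (pow_eq_one_iff_of_nonneg (norm_nonneg _) μ.den_nz).1 hq1

theorem root_zpow_injective (hqr : ∀ n : ℕ, 0 < n → q ^ n ≠ 1) (μ : ℚ) :
    Function.Injective fun m : ℕ => X.root μ ^ m := by
  have h : ∀ a k : ℕ, X.root μ ^ a = X.root μ ^ (a + (k + 1)) → False := by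
    intro a k h
    rw [pow_add, left_eq_mul] at h
    apply hqr (k + 1) (Nat.succ_pos k)
    rw [← X.root_pow μ, ← pow_mul, mul_comm, pow_mul, h, one_pow]
  intro a b hab
  rcases lt_trichotomy a b with hlt | rfl | hlt
  · obtain ⟨k, rfl⟩ := Nat.exists_eq_add_of_lt hlt
    exact (h a k hab).elim
  · rfl
  · obtain ⟨k, rfl⟩ := Nat.exists_eq_add_of_lt hlt
    exact (h b k hab.symm).elim

/-- With y = p^m c₁ / c', where c₁ = c p^{-k}, the divisor is λ'(yⁿ - 1) and factors over the n-th
roots of unity z. The factor of z is 1 - p^m c₁ / (c' z) up to a unit of absolute value 1, and c' z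
is again an exponent by `closed`. -/
theorem geoBdd_lam [IsAlgClosed C] {μ : ℚ} {c c' : Cˣ} (hc : c ∈ X.set μ) (hc' : c' ∈ X.set μ)
    (k : ℕ) : GeoBdd fun m : ℕ =>
      ‖((X.lam μ c : Cˣ) : C) * ((q ^ ((m : ℤ) - k) : Cˣ) : C) - X.lam μ c'‖⁻¹ := by
  classical
  set n := μ.den with hn
  set c₁ := c * X.root μ ^ (-(k : ℤ)) with hc₁
  have hc₁m : c₁ ∈ X.set μ := X.mul_zpow_mem hc _
  set f : C[X] := Polynomial.X ^ n - 1 with hf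
  have hfm : f.Monic := monic_X_pow_sub_C 1 μ.den_nz
  have hroots : ∀ z ∈ f.roots, z ^ n = 1 := by
    intro z hz
    have := (mem_roots hfm.ne_zero).1 hz
    rw [IsRoot, hf, eval_sub, eval_pow, eval_X, eval_one] at this
    exact sub_eq_zero.1 this
  have key : ∀ m : ℕ, ‖((X.lam μ c : Cˣ) : C) * ((q ^ ((m : ℤ) - k) : Cˣ) : C) - X.lam μ c'‖⁻¹ =
      ‖(X.lam μ c' : C)‖⁻¹ * (f.roots.map fun z =>
        ‖1 - ((X.root μ : C) ^ m * (c₁ : C) * (c' : C)⁻¹) * z⁻¹‖⁻¹).prod := by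
    intro m
    set y : C := (X.root μ : C) ^ m * (c₁ : C) * (c' : C)⁻¹ with hy
    have h1 : ((X.lam μ c : Cˣ) : C) * ((q ^ ((m : ℤ) - k) : Cˣ) : C) =
        X.lam μ c' * y ^ n := by
      have h2 : X.lam μ c * q ^ ((m : ℤ) - k) = X.lam μ c' * (X.root μ ^ m * c₁ * c'⁻¹) ^ n := by
        rw [← X.lam_mul_zpow, lam, lam, lamOf, lamOf]
        have : c * X.root μ ^ ((m : ℤ) - k) = c' * (X.root μ ^ m * c₁ * c'⁻¹) := by
          rw [hc₁, mul_comm c', inv_mul_cancel_right, sub_eq_add_neg, zpow_add, zpow_natCast]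
          exact mul_left_comm _ _ _
        rw [this, mul_pow]
        exact mul_right_comm _ _ _
      have := congrArg (Units.val) h2
      simpa [hy] using this
    have h3 : ‖y ^ n - 1‖ = (f.roots.map fun z => ‖1 - y * z⁻¹‖).prod := by
      have h4 : y ^ n - 1 = (f.roots.map fun z => y - z).prod := by
        rw [← (IsAlgClosed.splits f).eval_eq_prod_roots_of_monic hfm]
        simp [hf]
      rw [h4]
      change (normHom : C →*₀ ℝ) _ = _
      rw [map_multiset_prod, Multiset.map_map]
      congr 1
      refine Multiset.map_congr rfl fun z hz => ?_
      have hz1 := hroots z hz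
      have hz0 : z ≠ 0 := by
        rintro rfl
        rw [zero_pow μ.den_nz] at hz1
        exact zero_ne_one hz1
      have hzn : ‖z‖ = 1 := by
        refine (pow_eq_one_iff_of_nonneg (norm_nonneg z) μ.den_nz).1 ?_
        rw [← norm_pow, hz1, norm_one]
      change ‖y - z‖ = _
      have : 1 - y * z⁻¹ = -(y - z) * z⁻¹ := by field_simp; ring
      rw [this, norm_mul, norm_neg, norm_inv, hzn, inv_one, mul_one]
    rw [h1, ← mul_sub_one, norm_mul, mul_inv, h3]
    congr 1
    rw [← Multiset.prod_map_inv]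
  simp only [key]
  refine (geoBdd_of_le _ fun _ => le_rfl).mul (GeoBdd.multiset_prod _ (fun z hz => ?_)
    fun _ _ _ => inv_nonneg.2 (norm_nonneg _)) fun _ => inv_nonneg.2 (norm_nonneg _)
  have hz1 := hroots z hz
  obtain ⟨z, rfl⟩ : IsUnit z := IsUnit.of_pow_eq_one hz1 μ.den_nz
  have h5 : c' * z ∈ X.set μ := by
    refine X.closed (m := 0) hc' ?_
    rw [zpow_zero, mul_one, mul_pow]
    rw [← Units.val_pow_eq_pow_val, Units.val_eq_one] at hz1
    rw [hz1, mul_one]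
  have := X.bdd hc₁m h5
  refine this.mono fun i => le_max_of_le_right (le_of_eq ?_)
  congr 3
  push_cast
  rw [div_eq_mul_inv, mul_inv]
  ring

/-- The chosen representatives of the classes of multipliers modulo `q^ℤ`. -/
def IsRep (q : Cˣ) (a : Cˣ) : Prop := (QuotientGroup.mk a : Cˣ ⧸ Subgroup.zpowers q).out = a

/-- Fixing representatives modulo q^ℤ turns every resonance λ q^s = λ₂ into an equality λ = λ₂, so
resonances occur only at the coefficient of t⁰. -/
theorem IsRep.eq {a b : Cˣ} (ha : IsRep q a) (hb : IsRep q b) {s : ℤ} (h : a * q ^ s = b) :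
    a = b := by
  rw [← ha, ← hb]
  congr 1
  rw [QuotientGroup.eq]
  exact ⟨s, by rw [← h]; simp⟩

theorem exists_isRep (a : Cˣ) : ∃ s : ℤ, IsRep q (a * q ^ s) := by
  obtain ⟨⟨h, s, rfl⟩, hs⟩ := QuotientGroup.mk_out_eq_mul (Subgroup.zpowers q) a
  refine ⟨s, ?_⟩
  have : (QuotientGroup.mk (a * q ^ s) : Cˣ ⧸ Subgroup.zpowers q) = QuotientGroup.mk a := by
    rw [QuotientGroup.eq]
    exact ⟨-s, by simp⟩
  rw [IsRep, this]
  exact hs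

theorem zpow_eq_one (hqr : ∀ n : ℕ, 0 < n → q ^ n ≠ 1) {s : ℤ} (h : q ^ s = 1) : s = 0 := by
  by_contra hs
  apply hqr s.natAbs (Int.natAbs_pos.2 hs)
  rcases Int.natAbs_eq s with h' | h'
  · rw [h', zpow_natCast] at h; exact h
  · rw [h', zpow_neg, zpow_natCast, inv_eq_one] at h; exact h

/-- All extension computations are contained here: constants obstruct solvability only when slope
and multiplier coincide. -/
theorem exists_model_eq [IsAlgClosed C] (hq1 : ‖(q : C)‖ = 1) (hqr : ∀ n : ℕ, 0 < n → q ^ n ≠ 1)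
    {μ μ₂ : ℚ} {c c₂ : Cˣ} (hc : c ∈ X.set μ) (hc₂ : c₂ ∈ X.set μ₂) (hr : IsRep q (X.lam μ c))
    (hr₂ : IsRep q (X.lam μ₂ c₂)) (w : RamK C K μ.den μ.den_nz) :
    ∃ u a, w = ev (X.model K μ c) u (X.op K μ₂ c₂) + cst C K a • toRam C K μ.den μ.den_nz 1 ∧
      (a ≠ 0 → μ = μ₂ ∧ X.lam μ c = X.lam μ₂ c₂) := by
  by_cases hμ : μ = μ₂
  · subst hμ
    obtain ⟨u, a, h1, h2⟩ := exists_ev_tau_add_const (X.root_pow μ) (X.geoBdd_lam hc hc₂)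
      (fun s hs => by
        have := hr.eq hr₂ hs
        change X.lam μ c * q ^ s = _ at hs
        rw [← this, mul_eq_left] at hs
        exact zpow_eq_one hqr hs) w
    exact ⟨u, a, h1, fun ha => ⟨rfl, h2 ha⟩⟩
  · obtain ⟨u, hu⟩ := ev_tau_surjective_of_slope_ne (hn := μ.den_nz) (d := μ.num) (c := c)
      (X.root_pow μ) (X.norm_root hq1 μ) μ₂.den_nz
      (d₂ := μ₂.num) (fun h => hμ (by
        rw [Rat.eq_iff_mul_eq_mul, ← h, mul_comm])) (X.lam μ₂ c₂) w
    exact ⟨u, 0, by rw [map_zero, zero_smul, add_zero]; exact hu.symm, fun h => absurd rfl h⟩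

end ExponentData

end Exponents

/-! ## Jordan systems -/

section Jordan

open Polynomial

variable {C : Type*} [NormedField C] {K : Type*} [Field K] [Algebra (Germ C) K]
  [IsFractionRing (Germ C) K] {q : Cˣ} (X : ExponentData C q)
variable {M : Type*} [AddCommGroup M] [Module K M]
  (S : M →ₛₗ[((sh q : K ≃+* K) : K →+* K)] M)

/-- The action of an operator. -/
noncomputable def act (A : K[X]) : M →+ M where
  toFun w := ev S w A
  map_zero' := ev_zero_left S A
  map_add' w w' := ev_add_left S w w' A

variable {S}

theorem act_apply (A : K[X]) (w : M) : act S A w = ev S w A := rfl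

/-- Constants of C are fixed by σ_q, so these operators are C-linear although only additive over K.
-/
theorem act_tau_cst_smul (n : ℕ) (d : ℤ) (lam : Cˣ) (a : C) (w : M) :
    act S (tau K n d lam) (cst C K a • w) = cst C K a • act S (tau K n d lam) w := by
  have h : ∀ i : ℕ, S^[i] (cst C K a • w) = cst C K a • S^[i] w := by
    intro i
    induction i with
    | zero => rfl
    | succ i ih =>
      rw [Function.iterate_succ_apply', Function.iterate_succ_apply', ih, LinearMap.map_smulₛₗ]
      congr 1
      exact shift_cst q a
  rw [act_apply, act_apply, ev_tau, ev_tau, h, smul_sub, smul_comm, smul_comm (cst C K (lam : C))]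

theorem act_tau_iterate_cst_smul (n : ℕ) (d : ℤ) (lam : Cˣ) (a : C) (l : ℕ) (w : M) :
    (act S (tau K n d lam))^[l] (cst C K a • w) = cst C K a • (act S (tau K n d lam))^[l] w := by
  induction l generalizing w with
  | zero => rfl
  | succ l ih => rw [Function.iterate_succ_apply, act_tau_cst_smul, ih, Function.iterate_succ_apply]

theorem act_iterate_sum {ι : Type*} (A : K[X]) (l : ℕ) (s : Finset ι) (f : ι → M) :
    (act S A)^[l] (∑ i ∈ s, f i) = ∑ i ∈ s, (act S A)^[l] (f i) := by
  induction l generalizing f with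
  | zero => rfl
  | succ l ih =>
    simp only [Function.iterate_succ_apply]
    rw [map_sum, ih]

variable (S) in
/-- A system of generators of `N` with Jordan chains of prescribed slopes, exponents, lengths. -/
structure JordanSystem (N : Submodule K M) {J : Type} [Fintype J] (μ : J → ℚ) (c : J → Cˣ)
    (v : J → M) (l : J → ℕ) : Prop where
  mem : ∀ j, c j ∈ X.set (μ j)
  isRep : ∀ j, ExponentData.IsRep q (X.lam (μ j) (c j))
  iterate_eq_zero : ∀ j, (act S (X.op K (μ j) (c j)))^[l j] (v j) = 0
  iSup_range : ⨆ j, LinearMap.range (ev S (v j)) = N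
  finrank : ∑ j, (μ j).den * l j = Module.finrank K N

variable {X}

/-- Decomposition of the elements of a Jordan block with respect to an operator `x^d σ^n - λ`. -/
theorem exists_eq_act_add [IsAlgClosed C] (hq1 : ‖(q : C)‖ = 1)
    (hqr : ∀ n : ℕ, 0 < n → q ^ n ≠ 1) {μ μ₂ : ℚ} {c c₂ : Cˣ} (hc : c ∈ X.set μ)
    (hc₂ : c₂ ∈ X.set μ₂) (hr : ExponentData.IsRep q (X.lam μ c))
    (hr₂ : ExponentData.IsRep q (X.lam μ₂ c₂)) (l : ℕ) :
    ∀ v : M, (act S (X.op K μ c))^[l] v = 0 → ∀ w ∈ LinearMap.range (ev S v),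
      ∃ u ∈ LinearMap.range (ev S v), ∃ a, w = act S (X.op K μ₂ c₂) u + cst C K a • v ∧
        (a ≠ 0 → μ = μ₂ ∧ X.lam μ c = X.lam μ₂ c₂) := by
  induction l with
  | zero =>
    rintro v hv _ ⟨B, rfl⟩
    rw [Function.iterate_zero, id] at hv
    subst hv
    exact ⟨0, Submodule.zero_mem _, 0, by simp [ev_zero_left], fun h => absurd rfl h⟩
  | succ l ih =>
    rintro v hv _ ⟨B, rfl⟩
    rw [Function.iterate_succ_apply] at hv
    -- The equation is first solved in the top layer of the block, where v becomes the element 1 of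
    -- the model; the error lies in the submodule generated by the image of v, a shorter block.
    obtain ⟨b, a, hb, ha⟩ := X.exists_model_eq hq1 hqr hc hc₂ hr hr₂
      (ev (X.model K μ c) (toRam C K μ.den μ.den_nz 1) B)
    obtain ⟨B', rfl⟩ : b ∈ LinearMap.range (ev (X.model K μ c) (toRam C K μ.den μ.den_nz 1)) := by
      rw [range_ev_one _ (Rat.isCoprime_num_den μ)]; trivial
    rw [← ev_comp, ← ev_C (X.model K μ c), ← map_add, ← sub_eq_zero, ← map_sub] at hb
    obtain ⟨Q, hQ⟩ := (isMin_tau (X.root_pow μ) (c := c) (Rat.isCoprime_num_den μ)).eq_comp stable_bot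
      ((Submodule.mem_bot K).2 hb)
    have hw : ev S v B = act S (X.op K μ₂ c₂) (ev S v B') + cst C K a • v +
        ev S (act S (X.op K μ c) v) Q := by
      rw [sub_eq_iff_eq_add] at hQ
      rw [hQ, map_add, map_add, ev_comp, ev_comp, ev_C, add_comm]
      rfl
    obtain ⟨_, ⟨U, rfl⟩, a', hu', ha'⟩ := ih _ hv _ ⟨Q, rfl⟩
    -- A leftover multiple of the image of v occurs only when both operators are equal; it is then
    -- the image of a' v and can be absorbed in u.
    by_cases h0 : a' = 0
    · refine ⟨ev S v B' + ev S (act S (X.op K μ c) v) U, Submodule.add_mem _ ⟨B', rfl⟩ ?_, a, ?_, ha⟩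
      · exact (stable_range v).ev_mem ⟨_, rfl⟩ U
      · rw [hw, hu', h0, map_zero, zero_smul, add_zero, map_add]
        abel
    · obtain ⟨rfl, h2⟩ := ha' h0
      refine ⟨ev S v B' + ev S (act S (X.op K μ c) v) U + cst C K a' • v,
        Submodule.add_mem _ (Submodule.add_mem _ ⟨B', rfl⟩ ?_)
          (Submodule.smul_mem _ _ (mem_range_ev v)), a, ?_, ha⟩
      · exact (stable_range v).ev_mem ⟨_, rfl⟩ U
      · have : X.op K μ c₂ = X.op K μ c := by rw [ExponentData.op, ExponentData.op, h2]
        rw [hw, hu', map_add, map_add, this, ExponentData.op, act_tau_cst_smul]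
        abel

namespace JordanSystem

variable {N : Submodule K M} {J : Type} [Fintype J] {μ : J → ℚ} {c : J → Cˣ} {v : J → M}
  {l : J → ℕ}

theorem stable (h : JordanSystem X S N μ c v l) : Stable S N := by
  rw [← h.iSup_range]
  exact Stable.iSup fun j => stable_range _

theorem v_mem (h : JordanSystem X S N μ c v l) (j : J) : v j ∈ N := by
  rw [← h.iSup_range]
  exact Submodule.mem_iSup_of_mem j (mem_range_ev _)

theorem exists_eq [IsAlgClosed C] (h : JordanSystem X S N μ c v l) (hq1 : ‖(q : C)‖ = 1)
    (hqr : ∀ n : ℕ, 0 < n → q ^ n ≠ 1) {μ₂ : ℚ} {c₂ : Cˣ}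
    (hc₂ : c₂ ∈ X.set μ₂) (hr₂ : ExponentData.IsRep q (X.lam μ₂ c₂)) {w : M} (hw : w ∈ N) :
    ∃ u ∈ N, ∃ a : J → C, w = act S (X.op K μ₂ c₂) u + ∑ j, cst C K (a j) • v j ∧
      ∀ j, a j ≠ 0 → μ j = μ₂ ∧ X.lam (μ j) (c j) = X.lam μ₂ c₂ := by
  classical
  have hle : ∀ j, LinearMap.range (ev S (v j)) ≤ N := fun j => h.stable.range_le (h.v_mem j)
  rw [← h.iSup_range] at hw
  induction hw using Submodule.iSup_induction' with
  | mem j w hw =>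
    obtain ⟨u, hu, a, hua, ha⟩ := exists_eq_act_add hq1 hqr (h.mem j) hc₂ (h.isRep j) hr₂ _ _
      (h.iterate_eq_zero j) w hw
    refine ⟨u, hle j hu, Pi.single j a, ?_, fun i hi => ?_⟩
    · rw [Finset.sum_eq_single j, Pi.single_eq_same]
      · exact hua
      · intro i _ hi
        rw [Pi.single_eq_of_ne hi, map_zero, zero_smul]
      · simp
    · have : i = j := by
        by_contra hij
        exact hi (Pi.single_eq_of_ne hij _)
      subst this
      rw [Pi.single_eq_same] at hi
      exact ha hi
  | zero => exact ⟨0, N.zero_mem, 0, by simp, fun j hj => absurd rfl hj⟩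
  | add x y _ _ hx hy =>
    obtain ⟨u, hu, a, hua, ha⟩ := hx
    obtain ⟨u', hu', a', hua', ha'⟩ := hy
    refine ⟨u + u', N.add_mem hu hu', a + a', ?_, fun j hj => ?_⟩
    · rw [hua, hua', map_add]
      simp only [Pi.add_apply, map_add, add_smul, Finset.sum_add_distrib]
      abel
    · by_cases hj1 : a j = 0
      · exact ha' j fun hj2 => hj (by rw [Pi.add_apply, hj1, hj2, add_zero])
      · exact ha j hj1

/-- Extension of a Jordan system by one generator. -/
theorem extend [IsAlgClosed C] (h : JordanSystem X S N μ c v l) (hq1 : ‖(q : C)‖ = 1)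
    (hqr : ∀ n : ℕ, 0 < n → q ^ n ≠ 1) {μ₀ : ℚ} {c₀ : Cˣ}
    (hc₀ : c₀ ∈ X.set μ₀) (hr₀ : ExponentData.IsRep q (X.lam μ₀ c₀)) {w : M}
    (hw : act S (X.op K μ₀ c₀) w ∈ N)
    (hf : Module.finrank K ↥(N ⊔ LinearMap.range (ev S w)) = Module.finrank K N + μ₀.den) :
    ∃ (J' : Type) (_ : Fintype J') (μ' : J' → ℚ) (c' : J' → Cˣ) (v' : J' → M) (l' : J' → ℕ),
      JordanSystem X S (N ⊔ LinearMap.range (ev S w)) μ' c' v' l' := by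
  classical
  -- Replacing w by w - u leaves a relation expressing the image of the new generator as a constant
  -- combination of tops of blocks of the same type.
  obtain ⟨u, hu, a, hua, ha⟩ := h.exists_eq hq1 hqr hc₀ hr₀ hw
  set w' := w - u with hw'
  have hsup : N ⊔ LinearMap.range (ev S w) = N ⊔ LinearMap.range (ev S w') := by
    apply le_antisymm
    · refine sup_le le_sup_left ?_
      have hst : Stable S (N ⊔ LinearMap.range (ev S w')) := by
        rw [sup_eq_iSup]
        exact Stable.iSup fun b => by cases b; exacts [stable_range _, h.stable]
      refine hst.range_le ?_
      rw [show w = u + w' by rw [hw']; abel]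
      exact Submodule.add_mem_sup hu (mem_range_ev _)
    · refine sup_le le_sup_left ?_
      have hst : Stable S (N ⊔ LinearMap.range (ev S w)) := by
        rw [sup_eq_iSup]
        exact Stable.iSup fun b => by cases b; exacts [stable_range _, h.stable]
      refine hst.range_le (Submodule.sub_mem _ ?_ ?_)
      · exact Submodule.mem_sup_right (mem_range_ev _)
      · exact Submodule.mem_sup_left hu
  have haw : act S (X.op K μ₀ c₀) w' = ∑ j, cst C K (a j) • v j := by
    rw [hw', map_sub, hua, add_sub_cancel_left]
  rw [hsup] at hf ⊢
  clear_value w'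
  by_cases h0 : ∀ j, a j = 0
  · refine ⟨Option J, inferInstance, fun o => o.elim μ₀ μ, fun o => o.elim c₀ c,
      fun o => o.elim w' v, fun o => o.elim 1 l, ?_, ?_, ?_, ?_, ?_⟩
    · rintro (_ | j)
      exacts [hc₀, h.mem j]
    · rintro (_ | j)
      exacts [hr₀, h.isRep j]
    · rintro (_ | j)
      · simp only [Option.elim_none, Function.iterate_one]
        rw [haw]
        exact Finset.sum_eq_zero fun j _ => by rw [h0, map_zero, zero_smul]
      · exact h.iterate_eq_zero j
    · rw [iSup_option]
      simp only [Option.elim_none, Option.elim_some]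
      rw [h.iSup_range, sup_comm]
    · rw [Fintype.sum_option]
      simp only [Option.elim_none, Option.elim_some]
      rw [h.finrank, hf, mul_one, add_comm]
  · push Not at h0
    -- Among the blocks that occur, a longest one is prolonged: its length bounds the others, so its
    -- length plus one annihilates w'.
    obtain ⟨j₀, hj₀, hmax⟩ := (Finset.univ.filter fun j => a j ≠ 0).exists_max_image l
      (by obtain ⟨j, hj⟩ := h0; exact ⟨j, by simp [hj]⟩)
    simp only [Finset.mem_filter, Finset.mem_univ, true_and] at hj₀ hmax
    have hop : ∀ j, a j ≠ 0 → X.op K (μ j) (c j) = X.op K μ₀ c₀ := by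
      intro j hj
      obtain ⟨h1, h2⟩ := ha j hj
      rw [ExponentData.op, ExponentData.op, h2, h1]
    have hμ₀ : (μ j₀).den = μ₀.den := by rw [(ha j₀ hj₀).1]
    refine ⟨J, inferInstance, μ, c, Function.update v j₀ w', Function.update l j₀ (l j₀ + 1),
      h.mem, h.isRep, ?_, ?_, ?_⟩
    · intro j
      by_cases hj : j = j₀
      · subst hj
        rw [Function.update_self, Function.update_self, Function.iterate_succ_apply, hop j hj₀, haw,
          act_iterate_sum]
        refine Finset.sum_eq_zero fun i _ => ?_
        by_cases hi : a i = 0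
        · rw [hi, map_zero, zero_smul, iterate_map_zero]
        · rw [ExponentData.op, act_tau_iterate_cst_smul]
          have hli := hmax i hi
          have := h.iterate_eq_zero i
          rw [hop i hi] at this
          rw [← Nat.sub_add_cancel hli, Function.iterate_add_apply]
          rw [ExponentData.op] at this
          rw [this, iterate_map_zero, smul_zero]
      · rw [Function.update_of_ne hj, Function.update_of_ne hj]
        exact h.iterate_eq_zero j
    · have hst : Stable S (⨆ j, LinearMap.range (ev S (Function.update v j₀ w' j))) :=
        Stable.iSup fun j => stable_range _
      have hv : ∀ j, j ≠ j₀ →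
          v j ∈ ⨆ j, LinearMap.range (ev S (Function.update v j₀ w' j)) := by
        intro j hj
        refine Submodule.mem_iSup_of_mem j ?_
        rw [Function.update_of_ne hj]
        exact mem_range_ev _
      have hw₀ : w' ∈ ⨆ j, LinearMap.range (ev S (Function.update v j₀ w' j)) := by
        refine Submodule.mem_iSup_of_mem j₀ ?_
        rw [Function.update_self]
        exact mem_range_ev _
      -- The old generator is not lost: its nonzero coefficient in the relation allows it to be
      -- recovered from w' and the other generators.
      have hv₀ : v j₀ ∈ ⨆ j, LinearMap.range (ev S (Function.update v j₀ w' j)) := by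
        have h1 : cst C K (a j₀) • v j₀ ∈
            ⨆ j, LinearMap.range (ev S (Function.update v j₀ w' j)) := by
          have h2 : cst C K (a j₀) • v j₀ = act S (X.op K μ₀ c₀) w' -
              ∑ j ∈ Finset.univ.erase j₀, cst C K (a j) • v j := by
            rw [haw, ← Finset.add_sum_erase _ _ (Finset.mem_univ j₀), add_sub_cancel_right]
          rw [h2]
          refine Submodule.sub_mem _ (hst.ev_mem hw₀ _) (Submodule.sum_mem _ fun j hj => ?_)
          exact Submodule.smul_mem _ _ (hv j (Finset.ne_of_mem_erase hj))
        exact (Submodule.smul_mem_iff _ (cst_ne_zero hj₀)).1 h1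
      apply le_antisymm
      · refine iSup_le fun j => ?_
        by_cases hj : j = j₀
        · rw [hj, Function.update_self]
          exact le_sup_right
        · rw [Function.update_of_ne hj]
          exact (h.stable.range_le (h.v_mem j)).trans le_sup_left
      · refine sup_le ?_ (hst.range_le hw₀)
        rw [← h.iSup_range]
        refine iSup_le fun j => hst.range_le ?_
        by_cases hj : j = j₀
        · rw [hj]; exact hv₀
        · exact hv j hj
    · have : ∀ j, (μ j).den * Function.update l j₀ (l j₀ + 1) j =
          (μ j).den * l j + if j = j₀ then (μ j₀).den else 0 := by
        intro j
        by_cases hj : j = j₀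
        · subst hj
          rw [Function.update_self, if_pos rfl, mul_add, mul_one]
        · rw [Function.update_of_ne hj, if_neg hj, add_zero]
      rw [Finset.sum_congr rfl fun j _ => this j, Finset.sum_add_distrib, Finset.sum_ite_eq',
        if_pos (Finset.mem_univ _), h.finrank, hf, hμ₀]

end JordanSystem

end Jordan

/-! ## Existence of Jordan systems -/

section Existence

open Polynomial

variable {C : Type*} [NormedField C] {K : Type*} [Field K] [Algebra (Germ C) K]
  [IsFractionRing (Germ C) K] {q : Cˣ} (X : ExponentData C q)
variable {M : Type*} [AddCommGroup M] [Module K M]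
  {S : M →ₛₗ[((sh q : K ≃+* K) : K →+* K)] M}

/-- Otherwise the operator is σ times an operator of lower degree, which already kills m by
injectivity of Σ. -/
theorem IsMin.coeff_zero_ne_zero (hS : Function.Injective S) {m : M} {A : K[X]}
    (hA : IsMin S ⊥ m A) (hd : A.natDegree ≠ 0) : A.coeff 0 ≠ 0 := by
  intro h0
  set B : K[X] := A.divX.map ((sh q : K ≃+* K).symm : K →+* K) with hB
  have hdeg : B.natDegree = A.natDegree - 1 := by
    rw [hB, natDegree_map, natDegree_divX_eq_natDegree_tsub_one]
  have hAB : skewX (sh q : K ≃+* K) B = A := by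
    rw [skewX, hB, Polynomial.map_map]
    have : ((sh q : K ≃+* K) : K →+* K).comp ((sh q : K ≃+* K).symm : K →+* K) = RingHom.id K := by
      ext; simp
    rw [this, Polynomial.map_id]
    conv_rhs => rw [← X_mul_divX_add A, h0, Polynomial.C_0, add_zero]
  have hB0 : B ≠ 0 := by
    rintro h
    rw [h] at hAB
    apply hA.ne_zero
    rw [← hAB, skewX]
    simp
  have h1 : ev S m B = 0 := by
    apply hS
    rw [← ev_skewX, hAB, hA.ev_eq_zero, map_zero]
  have := hA.le B ((Submodule.mem_bot K).2 h1) hB0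
  omega

variable [IsAlgClosed C]

/-- The first edge of the Newton polygon, starting at the index 0, contains a further point. Its
initial form has a nonzero constant term and positive degree, hence a nonzero root. -/
theorem exists_slope_root (p : ℚ → Cˣ) {A : K[X]} (h0 : A.coeff 0 ≠ 0) (hd : A.natDegree ≠ 0) :
    ∃ (μ : ℚ) (h : ℤ) (P : C[X]) (c : Cˣ), HasInit A μ.den μ.den_nz μ.num (p μ) h P ∧
      P.eval (c : C) = 0 := by
  have hA : A ≠ 0 := by rintro rfl; exact h0 rfl
  have hord : ∀ i, ∃ (o : ℤ) (u : Germ C), A.coeff i ≠ 0 →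
      germVal C u ≠ 0 ∧ A.coeff i = xK C K ^ o * toK C K u := by
    intro i
    by_cases hi : A.coeff i = 0
    · exact ⟨0, 0, fun h => absurd hi h⟩
    · obtain ⟨o, u, hu⟩ := exists_eq_zpow_mul (C := C) hi
      exact ⟨o, u, fun _ => hu⟩
  choose o u hou using hord
  obtain ⟨i, hi, hmin⟩ := (A.support.erase 0).exists_min_image
    (fun i => ((o i : ℚ) - o 0) / i) ⟨A.natDegree, by simp [hd, hA]⟩
  rw [Finset.mem_erase, mem_support_iff] at hi
  set μ : ℚ := ((o i : ℚ) - o 0) / i with hμ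
  have hi0 : (0 : ℚ) < i := by exact_mod_cast Nat.pos_of_ne_zero hi.1
  obtain ⟨h, P, hP⟩ := exists_hasInit hA μ.den μ.den_nz μ.num (p μ)
  have hn0 : (0 : ℚ) < μ.den := by exact_mod_cast μ.den_pos
  have hμn : (μ.num : ℚ) = μ * μ.den := (Rat.mul_den_eq_num μ).symm
  have hle : ∀ j, A.coeff j ≠ 0 → (μ.den : ℤ) * o 0 ≤ μ.den * o j - μ.num * j := by
    intro j hj
    have h1 : (o 0 : ℚ) ≤ o j - μ * j := by
      rcases Nat.eq_zero_or_pos j with rfl | hj0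
      · simp
      · have h2 := hmin j (by rw [Finset.mem_erase, mem_support_iff]; exact ⟨hj0.ne', hj⟩)
        rw [le_div_iff₀ (by exact_mod_cast hj0)] at h2
        linarith
    have h3 : (μ.den : ℚ) * o 0 ≤ μ.den * o j - μ.num * j := by
      rw [hμn]
      nlinarith
    exact_mod_cast h3
  have hi1 : (μ.den : ℤ) * o 0 = μ.den * o i - μ.num * i := by
    have h1 : (o 0 : ℚ) = o i - μ * i := by
      rw [hμ]
      field_simp
      ring
    have h3 : (μ.den : ℚ) * o 0 = μ.den * o i - μ.num * i := by
      rw [hμn, h1]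
      ring
    exact_mod_cast h3
  have hh : h = μ.den * o 0 := by
    obtain ⟨j, hj⟩ : ∃ j, P.coeff j ≠ 0 := by
      by_contra! hall
      exact hP.1 (Polynomial.ext hall)
    have hj' := hP.coeff_ne_zero hj
    have h1 := (hP.order (hou j hj').1 (hou j hj').2).2.1.2 hj
    have h2 := hle j hj'
    have h3 := (hP.order (hou 0 h0).1 (hou 0 h0).2).1
    push_cast at h3
    linarith
  have hP0 : P.coeff 0 ≠ 0 := by
    refine (hP.order (hou 0 h0).1 (hou 0 h0).2).2.1.1 ?_
    rw [hh]; simp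
  have hPi : P.coeff i ≠ 0 := by
    refine (hP.order (hou i hi.2).1 (hou i hi.2).2).2.1.1 ?_
    rw [hh]; linarith
  obtain ⟨a, ha⟩ := IsAlgClosed.exists_root P (by
    intro hdeg
    exact hPi (coeff_eq_zero_of_degree_lt (by
      rw [hdeg]; exact_mod_cast Nat.pos_of_ne_zero hi.1)))
  have ha0 : a ≠ 0 := by
    rintro rfl
    rw [IsRoot, ← coeff_zero_eq_eval_zero] at ha
    exact hP0 ha
  exact ⟨μ, h, P, Units.mk0 a ha0, hP, ha⟩

variable {X}

/-- Since q is not a root of unity, the sequence c p^m takes each value once and meets the finitely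
many roots of P only finitely often; the last one met has no resonance ahead. -/
theorem ExponentData.exists_last_root (hqr : ∀ n : ℕ, 0 < n → q ^ n ≠ 1) {μ : ℚ} {P : C[X]}
    (hP : P ≠ 0) {c : Cˣ} (hc : P.eval (c : C) = 0) :
    ∃ c' : Cˣ, P.eval (c' : C) = 0 ∧
      ∀ m : ℕ, P.eval ((c' * X.root μ ^ (m + 1) : Cˣ) : C) ≠ 0 := by
  classical
  have hfin : {m : ℕ | P.eval ((c * X.root μ ^ m : Cˣ) : C) = 0}.Finite := by
    refine Set.Finite.of_finite_image (f := fun m : ℕ => ((c * X.root μ ^ m : Cˣ) : C))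
      (P.roots.toFinset.finite_toSet.subset ?_) ?_
    · rintro _ ⟨m, hm, rfl⟩
      simpa [hP] using hm
    · intro a _ b _ hab
      exact X.root_zpow_injective hqr μ (mul_left_cancel (Units.ext hab))
  obtain ⟨m, hm, hmax⟩ := hfin.toFinset.exists_max_image id
    ⟨0, by simpa using hc⟩
  simp only [Set.Finite.mem_toFinset, Set.mem_ofPred_eq, id] at hm hmax
  refine ⟨c * X.root μ ^ m, hm, fun k hk => ?_⟩
  rw [mul_assoc, ← pow_add] at hk
  have := hmax _ hk
  omega

/-- P splits. A root 0 contributes a factor of constant absolute value, and a nonzero root z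
contributes z (1 - p^{m+1} c / z) up to sign. -/
theorem ExponentData.geoBdd_eval {μ : ℚ} {P : C[X]} (hP : P ≠ 0)
    (hX : ∀ c : Cˣ, P.eval (c : C) = 0 → c ∈ X.set μ) {c : Cˣ} (hc : c ∈ X.set μ)
    (hq1 : ‖(q : C)‖ = 1) :
    GeoBdd fun m : ℕ => ‖P.eval ((c * X.root μ ^ (m + 1) : Cˣ) : C)‖⁻¹ := by
  have key : ∀ m : ℕ, ‖P.eval ((c * X.root μ ^ (m + 1) : Cˣ) : C)‖⁻¹ =
      ‖P.leadingCoeff‖⁻¹ * (P.roots.map fun z =>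
        ‖((c * X.root μ ^ (m + 1) : Cˣ) : C) - z‖⁻¹).prod := by
    intro m
    rw [(IsAlgClosed.splits P).eval_eq_prod_roots, norm_mul, mul_inv]
    congr 1
    change ((normHom : C →*₀ ℝ) _)⁻¹ = _
    rw [map_multiset_prod, Multiset.map_map, ← Multiset.prod_map_inv]
    rfl
  simp only [key]
  refine (geoBdd_of_le _ fun _ => le_rfl).mul (GeoBdd.multiset_prod _ (fun z hz => ?_)
    fun _ _ _ => inv_nonneg.2 (norm_nonneg _)) fun _ => inv_nonneg.2 (norm_nonneg _)
  by_cases hz0 : z = 0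
  · refine geoBdd_of_le ‖(c : C)‖⁻¹ fun i => le_of_eq ?_
    rw [hz0, sub_zero, Units.val_mul, Units.val_pow_eq_pow_val, norm_mul, norm_pow,
      X.norm_root hq1, one_pow, mul_one]
  · have hzX := hX (Units.mk0 z hz0) ((mem_roots hP).1 hz)
    have h1 := (geoBdd_of_le ‖z‖⁻¹ fun _ => le_rfl).mul (X.bdd hc hzX).succ
      fun _ => inv_nonneg.2 (norm_nonneg _)
    refine h1.mono fun i => le_max_of_le_right (le_of_eq ?_)
    rw [← mul_inv, ← norm_mul, ← norm_neg]
    congr 2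
    push_cast
    rw [Units.val_mk0]
    field_simp
    ring

/-- Induction on the order of A: a solution y of A in a basic module gives A = QR with R the
annihilator of y. The submodule generated by R m has annihilator Q and smaller order, and the
quotient of the module generated by m by it is basic. -/
theorem exists_jordanSystem [FiniteDimensional K M] (hS : Function.Injective S)
    (hq1 : ‖(q : C)‖ = 1) (hqr : ∀ n : ℕ, 0 < n → q ^ n ≠ 1) (ν : ℕ) :
    ∀ (m : M) (A : K[X]), A.natDegree = ν → IsMin S ⊥ m A →
      (∀ μ h P, HasInit A μ.den μ.den_nz μ.num (X.root μ) h P →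
        ∀ c : Cˣ, P.eval (c : C) = 0 → c ∈ X.set μ) →
      ∃ (J : Type) (_ : Fintype J) (μ : J → ℚ) (c : J → Cˣ) (v : J → M) (l : J → ℕ),
        JordanSystem X S (LinearMap.range (ev S m)) μ c v l := by
  induction ν using Nat.strong_induction_on with
  | _ ν ih =>
  intro m A hν hA hX
  by_cases hd : A.natDegree = 0
  · refine ⟨Empty, inferInstance, nofun, nofun, nofun, nofun, nofun, nofun, nofun, ?_, ?_⟩
    · rw [iSup_of_empty, eq_comm, ← Submodule.finrank_eq_zero (R := K), hA.finrank_range, hd]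
    · rw [hA.finrank_range, hd]
      rfl
  obtain ⟨μ, h, P, c₁, hP, hc₁⟩ := exists_slope_root X.root (hA.coeff_zero_ne_zero hS hd) hd
  obtain ⟨c₂, hc₂, hlast⟩ := X.exists_last_root hqr (μ := μ) hP.1 hc₁
  have hc₂X := hX μ h P hP c₂ hc₂
  obtain ⟨y₂, hy₂, hy₂A⟩ := exists_ev_tw_eq_zero (X.root_pow μ) (X.norm_root hq1 μ) hP hc₂ hlast
    (X.geoBdd_eval hP.1 (hX μ h P hP) hc₂X hq1)
  -- A change of c by a power of p, realised by `ev_tw_shift`, multiplies λ by a power of q and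
  -- makes it the chosen representative.
  obtain ⟨s, hs⟩ := ExponentData.exists_isRep (q := q) (X.lam μ c₂)
  rw [← X.lam_mul_zpow] at hs
  set c := c₂ * X.root μ ^ s with hcdef
  have hcX : c ∈ X.set μ := X.mul_zpow_mem hc₂X s
  obtain ⟨y, hy, hyA⟩ : ∃ y : RamK C K μ.den μ.den_nz, y ≠ 0 ∧ ev (X.model K μ c) y A = 0 := by
    obtain ⟨z, rfl⟩ := (toRam C K μ.den μ.den_nz).surjective y₂
    refine ⟨toRam C K μ.den μ.den_nz (xK C K ^ (-s) * z), ?_, ?_⟩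
    · rw [Ne, EmbeddingLike.map_eq_zero_iff] at hy₂ ⊢
      exact mul_ne_zero (zpow_ne_zero _ xK_ne_zero) hy₂
    · rw [ExponentData.model, hcdef, ev_tw_shift, hy₂A, map_zero, mul_zero, map_zero]
  obtain ⟨R, hR⟩ := exists_isMin (S := X.model K μ c) ⊥ y
  obtain ⟨hRdeg, hRtop⟩ := isMin_tw (X.root_pow μ) (Rat.isCoprime_num_den μ) hy hR
  obtain ⟨Q, hQ⟩ := hR.eq_comp stable_bot ((Submodule.mem_bot K).2 hyA)
  have hQ0 : Q ≠ 0 := by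
    rintro rfl
    rw [comp_zero_left] at hQ
    exact hA.ne_zero hQ
  set u := ev S m R with hu
  have hdeg : A.natDegree = Q.natDegree + R.natDegree := by
    rw [hQ, natDegree_comp hQ0 hR.ne_zero]
  have hQmin : IsMin S ⊥ u Q := by
    refine ⟨hQ0, ?_, fun B hB hB0 => ?_⟩
    · rw [hu, ← ev_comp, ← hQ, hA.ev_eq_zero]
      exact Submodule.zero_mem _
    · rw [hu, ← ev_comp] at hB
      have := hA.le _ hB (comp_ne_zero hB0 hR.ne_zero)
      rw [natDegree_comp hB0 hR.ne_zero] at this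
      omega
  -- The roots of the initial form of Q are roots of that of A up to a power of the root of q, and
  -- the sets of exponents are stable under these powers.
  have hQX : ∀ μ' h' P', HasInit Q μ'.den μ'.den_nz μ'.num (X.root μ') h' P' →
      ∀ c : Cˣ, P'.eval (c : C) = 0 → c ∈ X.set μ' := by
    intro μ' h' P' hP' c' hc'
    obtain ⟨h'', P'', hP''⟩ := exists_hasInit hR.ne_zero μ'.den μ'.den_nz μ'.num (X.root μ')
    have h1 := hP'.comp (X.root_pow μ') hP''
    rw [← hQ] at h1
    have h2 := hX _ _ _ h1 (c' * X.root μ' ^ (-h'')) (by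
      rw [eval_mul, eval_comp, eval_mul, eval_C, eval_X, ← Units.val_mul]
      have : X.root μ' ^ h'' * (c' * X.root μ' ^ (-h'')) = c' := by
        rw [mul_left_comm, ← zpow_add, add_neg_cancel, zpow_zero, mul_one]
      rw [this, hc', zero_mul])
    have h3 := X.mul_zpow_mem h2 h''
    rwa [mul_assoc, ← zpow_add, neg_add_cancel, zpow_zero, mul_one] at h3
  obtain ⟨J, _, μJ, cJ, vJ, lJ, hJ⟩ := ih Q.natDegree
    (by have := μ.den_pos; omega) u Q rfl hQmin hQX
  -- The solution y corresponds to m in the quotient. An operator taking y to 1 gives the lift V m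
  -- of 1, which is sent into the submodule by x^d σⁿ - λ.
  obtain ⟨V, hV⟩ : toRam C K μ.den μ.den_nz 1 ∈ LinearMap.range (ev (X.model K μ c) y) := by
    rw [hRtop]; trivial
  have hker : ∀ B, ev (X.model K μ c) y B = 0 → ev S m B ∈ LinearMap.range (ev S u) := by
    intro B hB
    obtain ⟨Q', rfl⟩ := hR.eq_comp stable_bot ((Submodule.mem_bot K).2 hB)
    exact ⟨Q', by rw [ev_comp]⟩
  have hsup : LinearMap.range (ev S u) ⊔ LinearMap.range (ev S (ev S m V)) =
      LinearMap.range (ev S m) := by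
    apply le_antisymm
    · exact sup_le ((stable_range m).range_le ⟨R, rfl⟩) ((stable_range m).range_le ⟨V, rfl⟩)
    · rintro _ ⟨B, rfl⟩
      obtain ⟨B', hB'⟩ : ev (X.model K μ c) y B ∈
          LinearMap.range (ev (X.model K μ c) (toRam C K μ.den μ.den_nz 1)) := by
        rw [range_ev_one _ (Rat.isCoprime_num_den μ)]; trivial
      have h1 := hker (B - QDiff.comp (sh q) B' V) (by
        rw [map_sub, ev_comp, hV, hB', sub_self])
      rw [map_sub, ev_comp] at h1
      rw [← sub_add_cancel (ev S m B) (ev S (ev S m V) B')]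
      exact Submodule.add_mem_sup h1 ⟨B', rfl⟩
  have hact : act S (X.op K μ c) (ev S m V) ∈ LinearMap.range (ev S u) := by
    rw [act_apply, ← ev_comp]
    apply hker
    rw [ev_comp, hV]
    exact ev_tw_one _
  have := hJ.extend hq1 hqr hcX hs hact (by
    rw [hsup, hA.finrank_range, hQmin.finrank_range, hdeg, hRdeg])
  rw [hsup] at this
  exact this

end Existence

/-! ## The Newton polygon of a Jordan system -/

section Width

open Polynomial

variable {C : Type*} [NormedField C] {K : Type*} [Field K] [Algebra (Germ C) K]
  [IsFractionRing (Germ C) K] {q : Cˣ} {X : ExponentData C q}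
variable {M : Type*} [AddCommGroup M] [Module K M]
  {S : M →ₛₗ[((sh q : K ≃+* K) : K →+* K)] M}

theorem IsMin.mem_iff {N : Submodule K M} (hN : Stable S N) {m : M} {R : K[X]}
    (h : IsMin S N m R) {B : K[X]} : ev S m B ∈ N ↔ ∃ Q, B = QDiff.comp (sh q) Q R := by
  refine ⟨h.eq_comp hN, ?_⟩
  rintro ⟨Q, rfl⟩
  rw [ev_comp]
  exact hN.ev_mem h.mem Q

theorem natDegree_natTrailingDegree_congr {P Q : C[X]} (hP : P ≠ 0)
    (h : ∀ i, P.coeff i ≠ 0 ↔ Q.coeff i ≠ 0) :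
    P.natDegree = Q.natDegree ∧ P.natTrailingDegree = Q.natTrailingDegree := by
  have hs : P.support = Q.support := by
    ext i
    rw [mem_support_iff, mem_support_iff, h]
  have hQ : Q ≠ 0 := by
    rwa [Ne, ← support_eq_empty, ← hs, support_eq_empty]
  rw [natDegree_eq_support_max' hP, natDegree_eq_support_max' hQ,
    natTrailingDegree_eq_support_min' hP, natTrailingDegree_eq_support_min' hQ]
  simp only [hs, and_self]

theorem natTrailingDegree_lt_natDegree {P : C[X]} (hP : P ≠ 0) {a : C} (ha : a ≠ 0)
    (h : P.eval a = 0) : P.natTrailingDegree < P.natDegree := by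
  refine lt_of_le_of_ne (natTrailingDegree_le_natDegree _) fun he => ?_
  have := C_mul_X_pow_eq_self (p := P) (by
    rw [Finset.card_le_one_iff]
    intro a b ha hb
    have ha1 := le_natDegree_of_mem_supp a ha
    have hb1 := le_natDegree_of_mem_supp b hb
    have ha2 := natTrailingDegree_le_of_mem_supp a ha
    have hb2 := natTrailingDegree_le_of_mem_supp b hb
    omega)
  rw [← this, eval_mul, eval_C, eval_pow, eval_X] at h
  exact mul_ne_zero (leadingCoeff_ne_zero.2 hP) (pow_ne_zero _ ha) h

/-- The Newton polygon of the annihilator of an element of the model. -/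
theorem HasInit.natDegree_of_model {μ μ' : ℚ} {c : Cˣ}
    {y : RamK C K μ.den μ.den_nz} (hy : y ≠ 0) {R : K[X]}
    (hR : ev (X.model K μ c) y R = 0) (hd : R.natDegree = μ.den) {h : ℤ} {P : C[X]}
    (hP : HasInit R μ'.den μ'.den_nz μ'.num (X.root μ') h P) :
    P.natDegree = P.natTrailingDegree + if μ = μ' then μ.den else 0 := by
  obtain ⟨h₀, P₀, hP₀⟩ := exists_hasInit hP.ne_zero μ.den μ.den_nz μ.num (X.root μ)
  obtain ⟨s, hs⟩ := exists_eval_eq_zero (X.root_pow μ) hP₀ hy hR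
  have hlt := natTrailingDegree_lt_natDegree hP₀.1 (Units.ne_zero _) hs
  have hlc : P₀.coeff P₀.natDegree ≠ 0 := leadingCoeff_ne_zero.2 hP₀.1
  have htc : P₀.coeff P₀.natTrailingDegree ≠ 0 := trailingCoeff_nonzero_iff_nonzero.2 hP₀.1
  -- The edge of slope μ has positive length divisible by the denominator n, which is also the
  -- degree of R: it spans the whole interval from 0 to n.
  have hdvd := hP₀.dvd_sub (Rat.isCoprime_num_den μ) hlc htc
  have hle : P₀.natDegree ≤ μ.den := hd ▸ hP₀.natDegree_le
  have hle2 := Int.le_of_dvd (by omega) hdvd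
  have hn : P₀.natDegree = μ.den := by omega
  have h0 : P₀.natTrailingDegree = 0 := by omega
  rw [hn] at hlc
  rw [h0] at htc
  split_ifs with hμ
  · subst hμ
    rw [(hP.unique hP₀).2, hn, h0, zero_add]
  · rw [add_zero]
    by_contra hne'
    have hlt' : P.natTrailingDegree < P.natDegree :=
      lt_of_le_of_ne (natTrailingDegree_le_natDegree _) (Ne.symm hne')
    have hlc' : P.coeff P.natDegree ≠ 0 := leadingCoeff_ne_zero.2 hP.1
    have htc' : P.coeff P.natTrailingDegree ≠ 0 := trailingCoeff_nonzero_iff_nonzero.2 hP.1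
    have hle' : P.natDegree ≤ μ.den := hd ▸ hP.natDegree_le
    have hord : ∀ k, R.coeff k ≠ 0 → ∃ o : ℤ,
        (μ.num * k + h₀ ≤ μ.den * o ∧ (P₀.coeff k ≠ 0 → μ.num * k + h₀ = μ.den * o)) ∧
        (μ'.num * k + h ≤ μ'.den * o ∧ (P.coeff k ≠ 0 → μ'.num * k + h = μ'.den * o)) := by
      intro k hk
      obtain ⟨o, u, hu, ho⟩ := exists_eq_zpow_mul (C := C) hk
      have h1 := hP₀.order hu ho
      have h2 := hP.order hu ho
      exact ⟨o, ⟨h1.1, h1.2.1.2⟩, ⟨h2.1, h2.2.1.2⟩⟩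
    obtain ⟨o₀, ⟨-, h1⟩, ⟨h2, -⟩⟩ := hord 0 (hP₀.coeff_ne_zero htc)
    obtain ⟨oₙ, ⟨-, h3⟩, ⟨h4, -⟩⟩ := hord _ (hP₀.coeff_ne_zero hlc)
    obtain ⟨oi, ⟨h5, -⟩, ⟨-, h6⟩⟩ := hord _ (hP.coeff_ne_zero htc')
    obtain ⟨oj, ⟨h7, -⟩, ⟨-, h8⟩⟩ := hord _ (hP.coeff_ne_zero hlc')
    replace h1 := h1 htc
    replace h3 := h3 hlc
    replace h6 := h6 htc'
    replace h8 := h8 hlc'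
    have hd1 : (0 : ℤ) < μ.den := by exact_mod_cast μ.den_pos
    have hd2 : (0 : ℤ) < μ'.den := by exact_mod_cast μ'.den_pos
    push_cast at h1 h2
    set i := P.natTrailingDegree
    set j := P.natDegree
    have hj0 : (0 : ℤ) < j := by omega
    have hin : (i : ℤ) < μ.den := by omega
    -- Convexity: compare an edge from i to j of another slope with the chord from 0 to n, at the
    -- right end for a larger slope and at the left end for a smaller one.
    rcases lt_or_gt_of_ne hμ with hlt | hlt
    · rw [Rat.lt_iff] at hlt
      have := mul_pos (sub_pos.2 hlt) (sub_pos.2 hin)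
      nlinarith [mul_le_mul_of_nonneg_left h5 hd2.le, mul_le_mul_of_nonneg_left h4 hd1.le]
    · rw [Rat.lt_iff] at hlt
      have := mul_pos (sub_pos.2 hlt) hj0
      nlinarith [mul_le_mul_of_nonneg_left h7 hd2.le, mul_le_mul_of_nonneg_left h2 hd1.le]

/-- Each layer of the filtration by the powers of A is cyclic and killed by A, hence of dimension at
most the degree of A. -/
theorem finrank_range_ev_le [FiniteDimensional K M] (A : K[X]) (hA : A ≠ 0) (l : ℕ) :
    ∀ v : M, (act S A)^[l] v = 0 →
      Module.finrank K (LinearMap.range (ev S v)) ≤ A.natDegree * l := by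
  induction l with
  | zero =>
    intro v hv
    rw [Function.iterate_zero, id] at hv
    have : LinearMap.range (ev S v) = ⊥ := by
      rw [eq_bot_iff]
      rintro _ ⟨B, rfl⟩
      rw [hv, ev_zero_left]
      exact Submodule.zero_mem _
    rw [this, finrank_bot]
    exact Nat.zero_le _
  | succ l ih =>
    intro v hv
    rw [Function.iterate_succ_apply] at hv
    have h1 := ih _ hv
    obtain ⟨R, hR⟩ := exists_isMin (S := S) (LinearMap.range (ev S (act S A v))) v
    have h2 := hR.finrank_sup (stable_range _)
    have h3 := hR.le A (mem_range_ev _) hA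
    have h4 : LinearMap.range (ev S (act S A v)) ⊔ LinearMap.range (ev S v) =
        LinearMap.range (ev S v) :=
      sup_eq_right.2 ((stable_range v).range_le ⟨A, rfl⟩)
    rw [h4] at h2
    rw [h2, mul_add, mul_one]
    omega

theorem finrank_iSup_le {J : Type} [Fintype J] [FiniteDimensional K M] (N : J → Submodule K M) :
    Module.finrank K ↥(⨆ j, N j) ≤ ∑ j, Module.finrank K (N j) := by
  classical
  rw [← Finset.sup_univ_eq_iSup]
  generalize (Finset.univ : Finset J) = s
  induction s using Finset.induction_on with
  | empty => simp
  | insert j s hj ih =>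
    rw [Finset.sup_insert, Finset.sum_insert hj]
    exact (Submodule.finrank_add_le_finrank_add_finrank _ _).trans (Nat.add_le_add_left ih _)

theorem ExponentData.natDegree_op (X : ExponentData C q) (μ : ℚ) (c : Cˣ) :
    (X.op K μ c).natDegree = μ.den := natDegree_tau μ.den_nz _ _

theorem ExponentData.op_ne_zero (X : ExponentData C q) (μ : ℚ) (c : Cˣ) : X.op K μ c ≠ 0 :=
  tau_ne_zero μ.den_nz _ _

/-- Initial forms multiply up to rescaling the variable, so the lengths of edges of a given slope
add up. -/
theorem HasInit.natDegree_comp {n : ℕ} {hn : n ≠ 0} {d : ℤ} {p : Cˣ} (hp : p ^ n = q)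
    {Q R : K[X]} {h₁ h₂ h : ℤ} {P₁ P₂ P : C[X]} (h1 : HasInit Q n hn d p h₁ P₁)
    (h2 : HasInit R n hn d p h₂ P₂) (hA : HasInit (QDiff.comp (sh q) Q R) n hn d p h P) :
    P.natDegree = P₁.natDegree + P₂.natDegree ∧
      P.natTrailingDegree = P₁.natTrailingDegree + P₂.natTrailingDegree := by
  rw [(hA.unique (h1.comp hp h2)).2]
  set a : C := ((p ^ h₂ : Cˣ) : C) with ha
  have ha0 : a ≠ 0 := Units.ne_zero _
  have hc := natDegree_natTrailingDegree_congr h1.1 (Q := P₁.comp (Polynomial.C a * Polynomial.X))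
    (fun i => by rw [comp_C_mul_X_coeff, Ne, Ne, mul_eq_zero, or_iff_left (pow_ne_zero _ ha0)])
  have hne : P₁.comp (Polynomial.C a * Polynomial.X) ≠ 0 := by
    intro h0
    have := comp_C_mul_X_coeff (p := P₁) (r := a) (n := P₁.natDegree)
    rw [h0, coeff_zero, eq_comm, mul_eq_zero, or_iff_left (pow_ne_zero _ ha0)] at this
    exact h1.1 (leadingCoeff_eq_zero.1 this)
  rw [natDegree_mul hne h2.1, natTrailingDegree_mul hne h2.1, hc.1, hc.2]
  exact ⟨rfl, rfl⟩

namespace JordanSystem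

variable {N : Submodule K M} {J : Type} [Fintype J] {μ : J → ℚ} {c : J → Cˣ} {v : J → M}
  {l : J → ℕ}

/-- The Newton polygon of a module with a Jordan system. -/
theorem natDegree_eq [FiniteDimensional K M] (k : ℕ) :
    ∀ (v : J → M) (l : J → ℕ) (m : M) (A : K[X]) (μ' : ℚ) (h : ℤ) (P : C[X]), ∑ j, l j = k →
      JordanSystem X S (LinearMap.range (ev S m)) μ c v l → IsMin S ⊥ m A →
      HasInit A μ'.den μ'.den_nz μ'.num (X.root μ') h P →
      P.natDegree = P.natTrailingDegree + ∑ j, if μ j = μ' then (μ j).den * l j else 0 := by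
  classical
  induction k with
  | zero =>
    intro v l m A μ' h P hk hJ hA hP
    have hl : ∀ j, l j = 0 := fun j => (Finset.sum_eq_zero_iff.1 hk) j (Finset.mem_univ j)
    have hf := hJ.finrank
    rw [hA.finrank_range] at hf
    have h1 := hP.natDegree_le
    have h2 := natTrailingDegree_le_natDegree P
    simp only [hl, mul_zero, Finset.sum_const_zero, ite_self, add_zero] at hf ⊢
    omega
  | succ k ih =>
    intro v l m A μ' h P hk hJ hA hP
    obtain ⟨j₀, hj₀⟩ : ∃ j, l j ≠ 0 := by
      by_contra! hall
      simp [hall] at hk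
    obtain ⟨l₀, hl₀⟩ := Nat.exists_eq_succ_of_ne_zero hj₀
    -- The top layer of one nonempty block is removed: its generator is replaced by its image and
    -- its length decreases by one.
    set op₀ := X.op K (μ j₀) (c j₀) with hop₀
    set v' := Function.update v j₀ (act S op₀ (v j₀)) with hv'
    set l' := Function.update l j₀ l₀ with hl'
    set N' := ⨆ j, LinearMap.range (ev S (v' j)) with hN'
    have hst : Stable S N' := Stable.iSup fun j => stable_range _
    have hv'j : ∀ j, j ≠ j₀ → v' j = v j := fun j hj => Function.update_of_ne hj _ _
    have hv'j₀ : v' j₀ = act S op₀ (v j₀) := Function.update_self _ _ _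
    have hl's : ∀ (f : J → ℕ), ∑ j, f j * l j = ∑ j, f j * l' j + f j₀ := by
      intro f
      have : ∀ j, f j * l j = f j * l' j + if j = j₀ then f j₀ else 0 := by
        intro j
        by_cases hj : j = j₀
        · subst hj
          rw [hl', Function.update_self, if_pos rfl, hl₀, Nat.mul_succ]
        · rw [hl', Function.update_of_ne hj, if_neg hj, add_zero]
      rw [Finset.sum_congr rfl fun j _ => this j, Finset.sum_add_distrib, Finset.sum_ite_eq',
        if_pos (Finset.mem_univ _)]
    have hle : N' ≤ LinearMap.range (ev S m) := by
      refine iSup_le fun j => hJ.stable.range_le ?_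
      by_cases hj : j = j₀
      · rw [hj, hv'j₀]
        exact hJ.stable.ev_mem (hJ.v_mem _) _
      · rw [hv'j j hj]
        exact hJ.v_mem j
    have hsup : N' ⊔ LinearMap.range (ev S (v j₀)) = LinearMap.range (ev S m) := by
      refine le_antisymm (sup_le hle (hJ.stable.range_le (hJ.v_mem _))) ?_
      rw [← hJ.iSup_range]
      refine iSup_le fun j => ?_
      by_cases hj : j = j₀
      · rw [hj]; exact le_sup_right
      · refine le_sup_of_le_left (le_iSup_of_le j ?_)
        rw [hv'j j hj]
    have hnil : ∀ j, (act S (X.op K (μ j) (c j)))^[l' j] (v' j) = 0 := by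
      intro j
      have := hJ.iterate_eq_zero j
      by_cases hj : j = j₀
      · subst hj
        rw [hl₀, Function.iterate_succ_apply] at this
        rw [hv'j₀, hl', Function.update_self]
        exact this
      · rw [hv'j j hj, hl', Function.update_of_ne hj]
        exact this
    have hfle : Module.finrank K N' ≤ ∑ j, (μ j).den * l' j := by
      refine (finrank_iSup_le _).trans (Finset.sum_le_sum fun j _ => ?_)
      have := finrank_range_ev_le _ (X.op_ne_zero (K := K) (μ j) (c j)) (l' j) (v' j) (hnil j)
      rwa [X.natDegree_op] at this
    have hopN' : ev S (v j₀) op₀ ∈ N' := by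
      refine Submodule.mem_iSup_of_mem j₀ ?_
      rw [hv'j₀]
      exact mem_range_ev _
    obtain ⟨R', hR'⟩ := exists_isMin (S := S) N' (v j₀)
    have hf1 := hR'.finrank_sup hst
    have hR'le := hR'.le _ hopN' (X.op_ne_zero _ _)
    rw [hop₀, X.natDegree_op] at hR'le
    have hf := hJ.finrank
    rw [hl's fun j => (μ j).den] at hf
    rw [hsup] at hf1
    -- All upper bounds on dimensions must be equalities, since the full Jordan system has exactly
    -- the dimension of the module. The removed layer is thus a full basic module.
    have hR'deg : R'.natDegree = (μ j₀).den := by omega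
    have hfN' : ∑ j, (μ j).den * l' j = Module.finrank K N' := by omega
    have hop : IsMin S N' (v j₀) op₀ := by
      refine ⟨X.op_ne_zero _ _, hopN', fun B hB hB0 => ?_⟩
      rw [hop₀, X.natDegree_op, ← hR'deg]
      exact hR'.le B hB hB0
    obtain ⟨x, hx, _, ⟨U, rfl⟩, hm⟩ := Submodule.mem_sup.1
      (show m ∈ N' ⊔ LinearMap.range (ev S (v j₀)) by rw [hsup]; exact mem_range_ev m)
    -- `y` is the class of the cyclic generator m in the quotient by N', identified with the model.
    set y := ev (X.model K (μ j₀) (c j₀)) (toRam C K _ _ 1) U with hy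
    have hiff : ∀ B, ev S m B ∈ N' ↔ ev (X.model K (μ j₀) (c j₀)) y B ∈
        (⊥ : Submodule K (RamK C K (μ j₀).den (μ j₀).den_nz)) := by
      intro B
      rw [hy, ← ev_comp, (isMin_tau (X.root_pow _) (Rat.isCoprime_num_den _)).mem_iff stable_bot,
        ← hm, ev_add_left, Submodule.add_mem_iff_right _ (hst.ev_mem hx B), ← ev_comp,
        hop.mem_iff hst]
      rfl
    have hy0 : y ≠ 0 := by
      intro h0
      have h1 := (hiff 1).2 (by rw [ev_one, h0]; exact Submodule.zero_mem _)
      rw [ev_one] at h1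
      have h2 := le_antisymm hle (hst.range_le h1)
      rw [← h2] at hf1
      have := (μ j₀).den_pos
      omega
    obtain ⟨R, hR⟩ := exists_isMin (S := X.model K (μ j₀) (c j₀)) ⊥ y
    have hRdeg := (isMin_tw (X.root_pow _) (Rat.isCoprime_num_den _) hy0 hR).1
    have hRm : IsMin S N' m R :=
      ⟨hR.ne_zero, (hiff R).2 hR.mem, fun B hB hB0 => hR.le B ((hiff B).1 hB) hB0⟩
    obtain ⟨Q, hQ, hQmin, hinf⟩ := hA.factor hst hRm
    rw [inf_eq_left.2 hle] at hinf
    have hJ' : JordanSystem X S (LinearMap.range (ev S (ev S m R))) μ c v' l' :=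
      ⟨hJ.mem, hJ.isRep, hnil, hinf, by rw [hfN', hinf]⟩
    obtain ⟨h₁, P₁, hP₁⟩ := exists_hasInit hQmin.ne_zero μ'.den μ'.den_nz μ'.num (X.root μ')
    obtain ⟨h₂, P₂, hP₂⟩ := exists_hasInit hR.ne_zero μ'.den μ'.den_nz μ'.num (X.root μ')
    have hk' : ∑ j, l' j = k := by
      have := hl's fun _ => 1
      simp only [one_mul] at this
      omega
    have e1 := ih v' l' _ Q μ' h₁ P₁ hk' hJ' hQmin hP₁
    have e2 := hP₂.natDegree_of_model hy0 hR.ev_eq_zero hRdeg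
    rw [hQ] at hP
    obtain ⟨e3, e4⟩ := hP₁.natDegree_comp (X.root_pow μ') hP₂ hP
    have e5 := hl's fun j => if μ j = μ' then (μ j).den else 0
    simp only [ite_mul, zero_mul] at e5
    rw [e5]
    omega

end JordanSystem

end Width

/-! ## Jordan blocks -/

section Block

open Polynomial

/-! ### Cyclic modules and their morphisms -/

section Hom

variable {K : Type*} [Field K] {σ : K ≃+* K}
variable {M : Type*} [AddCommGroup M] [Module K M] {S : M →ₛₗ[(σ : K →+* K)] M}
variable {W : Type*} [AddCommGroup W] [Module K W] {S' : W →ₛₗ[(σ : K →+* K)] W}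

variable (σ) in
/-- Multiplication by `X` on the left of skew polynomials, as a semilinear map. -/
noncomputable def skewXLin : K[X] →ₛₗ[(σ : K →+* K)] K[X] where
  toFun := skewX σ
  map_add' P Q := by simp [skewX, mul_add]
  map_smul' a P := by
    simp only [skewX, smul_eq_C_mul, Polynomial.map_mul, Polynomial.map_C]
    ring

theorem ev_skewXLin (Q R : K[X]) : ev (skewXLin σ) R Q = QDiff.comp σ Q R := by
  rw [ev_apply, QDiff.comp]
  simp only [smul_eq_C_mul]
  rfl

/-- Skew polynomials act on `K[X]` itself by left multiplication, so associativity is an instance of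
`ev_comp`. -/
theorem comp_assoc (P Q R : K[X]) :
    QDiff.comp σ P (QDiff.comp σ Q R) = QDiff.comp σ (QDiff.comp σ P Q) R := by
  rw [← ev_skewXLin, ← ev_skewXLin Q, ← ev_comp, ev_skewXLin]

/-- An inclusion of annihilators sends one cyclic generator to the other; the map is defined through
arbitrary preimages, the hypothesis making it independent of them. -/
theorem exists_hom_of_range_ev {x : M} {y : W} (h : ∀ B, ev S x B = 0 → ev S' y B = 0) :
    ∃ φ : LinearMap.range (ev S x) →ₗ[K] W, ∀ B (w : LinearMap.range (ev S x)),
      (w : M) = ev S x B → φ w = ev S' y B := by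
  let ψ : K[X] →ₗ[K] LinearMap.range (ev S x) := (ev S x).rangeRestrict
  have hψ : Function.Surjective ψ := (ev S x).surjective_rangeRestrict
  choose g hg using hψ
  have hw : ∀ B (w : LinearMap.range (ev S x)), (w : M) = ev S x B → ev S' y (g w) = ev S' y B := by
    intro B w hw
    rw [← sub_eq_zero, ← map_sub]
    apply h
    rw [map_sub, sub_eq_zero, ← hw]
    exact congrArg Subtype.val (hg w)
  have hgv : ∀ w, ev S x (g w) = w := fun w => congrArg Subtype.val (hg w)
  refine ⟨⟨⟨fun w => ev S' y (g w), fun a b => ?_⟩, fun a b => ?_⟩, fun B w h => hw B w h⟩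
  · rw [← map_add]
    apply hw
    rw [map_add, hgv, hgv, Submodule.coe_add]
  · change ev S' y (g (a • b)) = a • ev S' y (g b)
    rw [← map_smul]
    apply hw
    rw [map_smul, hgv, Submodule.coe_smul]

theorem isMin_of_natDegree_le [FiniteDimensional K M] {m : M} {B : K[X]} (hB : B ≠ 0)
    (h : ev S m B = 0) (hd : B.natDegree ≤ Module.finrank K (LinearMap.range (ev S m))) :
    IsMin S ⊥ m B := by
  refine ⟨hB, (Submodule.mem_bot K).2 h, fun A hA hA0 => ?_⟩
  obtain ⟨R, hR⟩ := exists_isMin (S := S) ⊥ m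
  rw [hR.finrank_range] at hd
  exact hd.trans (hR.le A hA hA0)

end Hom

variable {C : Type*} [NormedField C] {K : Type*} [Field K] [Algebra (Germ C) K]
  [IsFractionRing (Germ C) K] {q : Cˣ}
variable {M : Type*} [AddCommGroup M] [Module K M]
  {S : M →ₛₗ[((sh q : K ≃+* K) : K →+* K)] M}

variable (q) in
/-- The powers of an operator. -/
noncomputable def powOp (A : K[X]) : ℕ → K[X]
  | 0 => 1
  | l + 1 => QDiff.comp (sh q) (powOp A l) A

theorem ev_powOp (A : K[X]) (l : ℕ) (v : M) : ev S v (powOp q A l) = (act S A)^[l] v := by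
  induction l generalizing v with
  | zero => rw [powOp, ev_one]; rfl
  | succ l ih => rw [powOp, ev_comp, ih]; rfl

theorem powOp_ne_zero_natDegree {A : K[X]} (hA : A ≠ 0) (l : ℕ) :
    powOp q A l ≠ 0 ∧ (powOp q A l).natDegree = A.natDegree * l := by
  induction l with
  | zero => rw [powOp]; exact ⟨one_ne_zero, by simp⟩
  | succ l ih =>
    rw [powOp, natDegree_comp ih.1 hA, ih.2]
    exact ⟨comp_ne_zero ih.1 hA, rfl⟩

theorem IsMin.act {A : K[X]} (hA : A ≠ 0) {l : ℕ} {v : M} (h : IsMin S ⊥ v (powOp q A (l + 1))) :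
    IsMin S ⊥ (act S A v) (powOp q A l) := by
  have hl := powOp_ne_zero_natDegree (q := q) hA l
  refine ⟨hl.1, ?_, fun B hB hB0 => ?_⟩
  · rw [act_apply, ← ev_comp]
    exact h.mem
  · rw [act_apply, ← ev_comp] at hB
    have := h.le _ hB (comp_ne_zero hB0 hA)
    rw [powOp, natDegree_comp hl.1 hA, natDegree_comp hB0 hA] at this
    omega

/-- The top layer of a block is K[σ] modulo the left ideal of A, i.e. a copy of the model. -/
theorem ev_mem_range_act_iff {A : K[X]} {l : ℕ} {v : M}
    (h : IsMin S ⊥ v (powOp q A (l + 1))) {B : K[X]} :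
    ev S v B ∈ LinearMap.range (ev S (act S A v)) ↔ ∃ Q, B = QDiff.comp (sh q) Q A := by
  constructor
  · rintro ⟨Q, hQ⟩
    rw [act_apply, ← ev_comp, eq_comm, ← sub_eq_zero, ← map_sub] at hQ
    obtain ⟨Q', hQ'⟩ := h.eq_comp stable_bot ((Submodule.mem_bot K).2 hQ)
    have h1 : QDiff.comp (sh q) Q' (powOp q A (l + 1)) =
        QDiff.comp (sh q) (QDiff.comp (sh q) Q' (powOp q A l)) A := by
      rw [powOp, QDiff.comp_assoc]
    rw [h1, sub_eq_iff_eq_add, ← comp_add_left] at hQ'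
    exact ⟨_, hQ'⟩
  · rintro ⟨Q, rfl⟩
    exact ⟨Q, by rw [ev_comp]; rfl⟩

variable {X : ExponentData C q} {μ : ℚ} {c : Cˣ}

theorem ExponentData.model_ev_eq_zero_iff {B : K[X]} :
    ev (X.model K μ c) (toRam C K μ.den μ.den_nz 1) B = 0 ↔
      ∃ Q, B = QDiff.comp (sh q) Q (X.op K μ c) := by
  rw [← Submodule.mem_bot K]
  exact (isMin_tau (X.root_pow _) (Rat.isCoprime_num_den _)).mem_iff stable_bot

/-- Write a as B applied to the image of v. Equality would give, on the top layer of the shorter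
block, an element of the model sent to 1 by x^d σⁿ - λ. -/
theorem act_ne_act_of_mem {l : ℕ} {v : M} (h : IsMin S ⊥ v (powOp q (X.op K μ c) (l + 2))) {a : M}
    (ha : a ∈ LinearMap.range (ev S (act S (X.op K μ c) v))) :
    act S (X.op K μ c) v ≠ act S (X.op K μ c) a := by
  obtain ⟨B, rfl⟩ := ha
  intro he
  have h1 := h.act (X.op_ne_zero μ c)
  rw [act_apply _ (ev S _ B), ← ev_comp, eq_comm] at he
  have h2 : ev S (act S (X.op K μ c) v) (QDiff.comp (sh q) (X.op K μ c) B - 1) = 0 := by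
    rw [map_sub, he, ev_one, sub_self]
  obtain ⟨Q, hQ⟩ := (ev_mem_range_act_iff h1).1 (h2 ▸ Submodule.zero_mem _)
  have h3 := X.model_ev_eq_zero_iff.2 ⟨Q, hQ⟩
  rw [map_sub, ev_one, sub_eq_zero, ev_comp] at h3
  refine one_ne_zero (α := C) (eq_zero_of_ev_tau_eq_const (K := K) (c := c) (d := μ.num)
    (hn := μ.den_nz) (X.root_pow μ)
    (u := ev (X.model K μ c) (toRam C K μ.den μ.den_nz 1) B) ?_)
  rw [map_one (cst C K), one_smul]
  exact h3

/-- A nonzero element of N in the block has nonzero class in the top layer, which is simple; some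
operator therefore brings this class to that of v. -/
theorem exists_mem_sub_mem {l : ℕ} {v : M} (h : IsMin S ⊥ v (powOp q (X.op K μ c) (l + 1)))
    {N : Submodule K M} (hN : Stable S N) (hne : N ⊓ LinearMap.range (ev S v) ≠ ⊥)
    (hbot : N ⊓ LinearMap.range (ev S (act S (X.op K μ c) v)) = ⊥) :
    ∃ t ∈ N, v - t ∈ LinearMap.range (ev S (act S (X.op K μ c) v)) := by
  obtain ⟨_, ⟨hwN, B, rfl⟩, hw0⟩ := Submodule.exists_mem_ne_zero_of_ne_bot hne
  set y := ev (X.model K μ c) (toRam C K μ.den μ.den_nz 1) B with hy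
  have hy0 : y ≠ 0 := by
    intro h0
    have h1 := (ev_mem_range_act_iff h).2 (X.model_ev_eq_zero_iff.1 h0)
    have h2 : ev S v B ∈ N ⊓ LinearMap.range (ev S (act S (X.op K μ c) v)) := ⟨hwN, h1⟩
    rw [hbot] at h2
    exact hw0 ((Submodule.mem_bot K).1 h2)
  obtain ⟨R, hR⟩ := exists_isMin (S := X.model K μ c) ⊥ y
  obtain ⟨B', hB'⟩ : toRam C K μ.den μ.den_nz 1 ∈ LinearMap.range (ev (X.model K μ c) y) := by
    rw [(isMin_tw (X.root_pow _) (Rat.isCoprime_num_den _) hy0 hR).2]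
    trivial
  refine ⟨ev S (ev S v B) B', hN.ev_mem hwN B', ?_⟩
  have h1 : v - ev S (ev S v B) B' = ev S v (1 - QDiff.comp (sh q) B' B) := by
    rw [map_sub, ev_one, ev_comp]
  rw [h1, ev_mem_range_act_iff h, ← X.model_ev_eq_zero_iff, map_sub, ev_comp,
    ev_one, sub_eq_zero]
  exact hB'.symm

/-- Every submodule that meets a Jordan block contains its socle. -/
theorem iterate_act_mem (l : ℕ) : ∀ v : M, IsMin S ⊥ v (powOp q (X.op K μ c) (l + 1)) →
    ∀ N : Submodule K M, Stable S N → N ⊓ LinearMap.range (ev S v) ≠ ⊥ →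
      (act S (X.op K μ c))^[l] v ∈ N := by
  induction l with
  | zero =>
    intro v h N hN hne
    rw [Function.iterate_zero, id]
    have hv : act S (X.op K μ c) v = 0 := by
      have := h.ev_eq_zero
      rwa [ev_powOp] at this
    have hr : LinearMap.range (ev S (act S (X.op K μ c) v)) = ⊥ := by
      rw [eq_bot_iff]
      rintro _ ⟨B, rfl⟩
      rw [hv, ev_zero_left]
      exact Submodule.zero_mem _
    obtain ⟨t, ht, hvt⟩ := exists_mem_sub_mem h hN hne (by rw [hr, inf_bot_eq])
    rw [hr, Submodule.mem_bot, sub_eq_zero] at hvt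
    rwa [hvt]
  | succ l ih =>
    intro v h N hN hne
    rw [Function.iterate_succ_apply]
    apply ih _ (h.act (X.op_ne_zero μ c)) N hN
    intro hbot
    obtain ⟨t, ht, hvt⟩ := exists_mem_sub_mem h hN hne hbot
    -- If N avoided the smaller block, it would contain some t congruent to v modulo that block. The
    -- image of t lies both in N and in the smaller block, so it vanishes, and v has the same image
    -- as v - t.
    refine act_ne_act_of_mem h hvt ?_
    have hst := stable_range (S := S) (act S (X.op K μ c) v)
    have h1 : act S (X.op K μ c) t ∈ N ⊓ LinearMap.range (ev S (act S (X.op K μ c) v)) := by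
      refine ⟨hN.ev_mem ht _, ?_⟩
      have h2 : t = v - (v - t) := by abel
      rw [h2, map_sub]
      exact Submodule.sub_mem _ (mem_range_ev _) (hst.ev_mem hvt _)
    rw [hbot, Submodule.mem_bot] at h1
    rw [map_sub, h1, sub_zero]

/-- The layers of a Jordan block do not split. -/
theorem inf_ne_bot_of_sup_eq {l : ℕ} {v : M} (h : IsMin S ⊥ v (powOp q (X.op K μ c) (l + 2)))
    {T : Submodule K M} (hT : Stable S T)
    (hsup : LinearMap.range (ev S (act S (X.op K μ c) v)) ⊔ T = LinearMap.range (ev S v)) :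
    LinearMap.range (ev S (act S (X.op K μ c) v)) ⊓ T ≠ ⊥ := by
  intro hbot
  obtain ⟨a, ha, t, ht, hat⟩ := Submodule.mem_sup.1
    (show v ∈ LinearMap.range (ev S (act S (X.op K μ c) v)) ⊔ T by
      rw [hsup]; exact mem_range_ev v)
  refine act_ne_act_of_mem h ha ?_
  have hst := stable_range (S := S) (act S (X.op K μ c) v)
  have h1 : act S (X.op K μ c) t ∈ LinearMap.range (ev S (act S (X.op K μ c) v)) ⊓ T := by
    refine ⟨?_, hT.ev_mem ht _⟩
    have h2 : t = v - a := by rw [← hat]; abel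
    rw [h2, map_sub]
    exact Submodule.sub_mem _ (mem_range_ev _) (hst.ev_mem ha _)
  rw [hbot, Submodule.mem_bot] at h1
  nth_rewrite 1 [← hat]
  rw [map_add, h1, add_zero]

/-- The socle and the top layer of a block are both K[σ] modulo the same left ideal. -/
theorem ev_iterate_eq_zero_iff {l : ℕ} : ∀ {v : M},
    IsMin S ⊥ v (powOp q (X.op K μ c) (l + 1)) → ∀ {B : K[X]},
      (ev S ((act S (X.op K μ c))^[l] v) B = 0 ↔
        ev S v B ∈ LinearMap.range (ev S (act S (X.op K μ c) v))) := by
  intro v h B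
  rw [ev_mem_range_act_iff h]
  have h1 : ∀ (l : ℕ) (v : M), IsMin S ⊥ v (powOp q (X.op K μ c) (l + 1)) →
      IsMin S ⊥ ((act S (X.op K μ c))^[l] v) (powOp q (X.op K μ c) 1) := by
    intro l
    induction l with
    | zero => exact fun v h => h
    | succ l ih =>
      intro v h
      rw [Function.iterate_succ_apply]
      exact ih _ (h.act (X.op_ne_zero μ c))
  rw [← Submodule.mem_bot K, (h1 l v h).mem_iff stable_bot, powOp, powOp]
  have h2 : QDiff.comp (sh q) 1 (X.op K μ c) = X.op K μ c := by
    rw [← Polynomial.C_1, comp_C_left, Polynomial.C_1, one_mul]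
  rw [h2]

end Block

/-! ## Operators as skew polynomials -/

section Link

open Polynomial

variable {C : Type*} [NormedField C] {K : Type*} [Field K] [Algebra (Germ C) K]
  [IsFractionRing (Germ C) K]

/-- The support of an initial form depends only on the orders of the coefficients, not on the chosen
root of q. -/
theorem HasInit.coeff_ne_zero_iff {A : K[X]} {n : ℕ} {hn : n ≠ 0} {d : ℤ} {p p' : Cˣ} {h h' : ℤ}
    {P P' : C[X]} (hP : HasInit A n hn d p h P) (hP' : HasInit A n hn d p' h' P') (i : ℕ) :
    P.coeff i ≠ 0 ↔ P'.coeff i ≠ 0 := by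
  have hle : ∀ {p p' : Cˣ} {h h' : ℤ} {P P' : C[X]} (hP : HasInit A n hn d p h P)
      (hP' : HasInit A n hn d p' h' P'), h' ≤ h := by
    intro p p' h h' P P' hP hP'
    have hj : P.coeff P.natDegree ≠ 0 := leadingCoeff_ne_zero.2 hP.1
    obtain ⟨o, u, hu, ho⟩ := exists_eq_zpow_mul (C := C) (hP.coeff_ne_zero hj)
    have h1 := (hP.order hu ho).2.1.2 hj
    have h2 := (hP'.order hu ho).1
    linarith
  have hh : h = h' := le_antisymm (hle hP' hP) (hle hP hP')
  subst hh
  by_cases hi : A.coeff i = 0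
  · refine iff_of_false (not_not.2 ?_) (not_not.2 ?_)
    · by_contra hh; exact hP.coeff_ne_zero hh hi
    · by_contra hh; exact hP'.coeff_ne_zero hh hi
  · obtain ⟨o, u, hu, ho⟩ := exists_eq_zpow_mul (C := C) hi
    rw [← (hP.order hu ho).2.1, ← (hP'.order hu ho).2.1]

/-! ### Newton polygon and characteristic polynomial in terms of initial forms -/

namespace Operator

variable (K) in
/-- The skew polynomial of an operator. -/
noncomputable def toPoly (L : Operator C) : K[X] :=
  ∑ i ∈ Finset.range (L.order + 1), monomial i (toK C K (L.coeff i))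

variable (L : Operator C)

theorem coeff_toPoly (i : ℕ) : (L.toPoly K).coeff i = toK C K (L.coeff i) := by
  rw [toPoly, finsetSum_coeff]
  simp only [coeff_monomial]
  rw [Finset.sum_ite_eq']
  split_ifs with h
  · rfl
  · rw [L.coeff_eq_zero i (by simpa using h), map_zero]

theorem natDegree_toPoly : (L.toPoly K).natDegree = L.order := by
  apply natDegree_eq_of_le_of_coeff_ne_zero
  · rw [natDegree_le_iff_coeff_eq_zero]
    intro i hi
    rw [coeff_toPoly, L.coeff_eq_zero i hi, map_zero]
  · rw [coeff_toPoly, Ne, toK_eq_zero]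
    exact L.coeff_order_ne_zero

theorem toPoly_ne_zero : L.toPoly K ≠ 0 := by
  intro h
  have := L.coeff_toPoly (K := K) L.order
  rw [h, coeff_zero, eq_comm, toK_eq_zero] at this
  exact L.coeff_order_ne_zero this

theorem exists_coeff_eq {i : ℕ} (hi : L.coeff i ≠ 0) : ∃ u : Germ C, germVal C u ≠ 0 ∧
    germVal C u = PowerSeries.coeff (L.ord i) (L.coeff i).1 ∧
    (L.toPoly K).coeff i = xK C K ^ (L.ord i : ℤ) * toK C K u := by
  obtain ⟨u, hu, h1, h2⟩ := germ_eq_X_pow_mul hi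
  refine ⟨u, hu, h2, ?_⟩
  rw [coeff_toPoly, zpow_natCast]
  nth_rewrite 1 [h1]
  rw [map_mul, map_pow]
  rfl

variable {L} {n : ℕ} {hn : n ≠ 0} {d : ℤ} {p : Cˣ} {h : ℤ} {P : C[X]}

theorem mem_edge_iff (hP : HasInit (L.toPoly K) n hn d p h P) {μ : ℚ} (hμ : (d : ℚ) = n * μ)
    (i : ℕ) : i ∈ L.edge μ ↔ P.coeff i ≠ 0 := by
  have hn0 : (0 : ℚ) < n := by exact_mod_cast Nat.pos_of_ne_zero hn
  have hc : ∀ j, (L.toPoly K).coeff j ≠ 0 ↔ L.coeff j ≠ 0 := fun j => by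
    rw [coeff_toPoly, Ne, toK_eq_zero]
  have key : ∀ j, L.coeff j ≠ 0 → (h : ℚ) ≤ n * ((L.ord j : ℚ) - μ * j) ∧
      ((h : ℚ) = n * ((L.ord j : ℚ) - μ * j) ↔ P.coeff j ≠ 0) := by
    intro j hj
    obtain ⟨u, hu, -, hj'⟩ := L.exists_coeff_eq (K := K) hj
    obtain ⟨h1, h2, -⟩ := hP.order hu hj'
    rw [← h2]
    have e : (n : ℚ) * ((L.ord j : ℚ) - μ * j) = n * L.ord j - d * j := by rw [hμ]; ring
    rw [e]
    constructor
    · have : ((d * j + h : ℤ) : ℚ) ≤ ((n * (L.ord j : ℤ) : ℤ) : ℚ) := by exact_mod_cast h1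
      push_cast at this
      linarith
    · rw [← Int.cast_inj (α := ℚ)]
      push_cast
      constructor <;> intro h <;> linarith
  constructor
  · rintro ⟨h1, h2⟩
    have hl : P.coeff P.natDegree ≠ 0 := leadingCoeff_ne_zero.2 hP.1
    have hj := (hc _).1 (hP.coeff_ne_zero hl)
    rw [← (key i h1).2]
    refine le_antisymm (key i h1).1 ?_
    rw [(key _ hj).2.2 hl]
    exact mul_le_mul_of_nonneg_left (h2 _ hj) hn0.le
  · intro hi
    have h1 := (hc _).1 (hP.coeff_ne_zero hi)
    refine ⟨h1, fun j hj => ?_⟩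
    have h2 := (key i h1).2.2 hi
    have h3 := (key j hj).1
    rw [h2] at h3
    exact le_of_mul_le_mul_left h3 hn0

theorem mem_newtonPolygon_iff (hP : HasInit (L.toPoly K) n hn d p h P) {μ : ℚ}
    (hμ : (d : ℚ) = n * μ) (r : ℕ) :
    (μ, r) ∈ L.newtonPolygon ↔ 0 < r ∧ P.natDegree = P.natTrailingDegree + r := by
  have he := mem_edge_iff hP hμ
  have h1 : IsLeast (L.edge μ) P.natTrailingDegree :=
    ⟨(he _).2 (trailingCoeff_nonzero_iff_nonzero.2 hP.1), fun j hj =>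
      natTrailingDegree_le_of_ne_zero ((he j).1 hj)⟩
  have h2 : IsGreatest (L.edge μ) P.natDegree :=
    ⟨(he _).2 (leadingCoeff_ne_zero.2 hP.1), fun j hj => le_natDegree_of_ne_zero ((he j).1 hj)⟩
  constructor
  · rintro ⟨hr, i, hi, hi'⟩
    exact ⟨hr, by rw [h2.unique hi', h1.unique hi]⟩
  · rintro ⟨hr, h3⟩
    exact ⟨hr, _, h1, by rw [← h3]; exact h2⟩

theorem isSlope_iff (hP : HasInit (L.toPoly K) n hn d p h P) {μ : ℚ}
    (hμ : (d : ℚ) = n * μ) : L.IsSlope μ ↔ P.natTrailingDegree < P.natDegree := by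
  rw [IsSlope]
  simp only [mem_newtonPolygon_iff hP hμ]
  constructor
  · rintro ⟨r, hr, h⟩
    omega
  · intro h
    exact ⟨P.natDegree - P.natTrailingDegree, by omega, by omega⟩

/-- For an integral slope and no ramification, the normalisation of `HasInit` is the factor q^{-d
i(i-1)/2} of the characteristic polynomial. -/
theorem charPoly_eq (hP : HasInit (L.toPoly K) 1 one_ne_zero d p h P) : L.charPoly p d = P := by
  classical
  have he := mem_edge_iff hP (μ := d) (by simp)
  ext i
  rw [charPoly, finsetSum_coeff]
  have : ∀ j, (if j ∈ L.edge d then Polynomial.monomial j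
        (((p ^ (-(d * (j.choose 2 : ℤ))) : Cˣ) : C) * PowerSeries.coeff (L.ord j) (L.coeff j).1)
      else 0).coeff i = if j = i then P.coeff i else 0 := by
    intro j
    by_cases hj : j ∈ L.edge d
    · rw [if_pos hj, coeff_monomial]
      split_ifs with hji
      · subst hji
        obtain ⟨u, hu, hu', hj'⟩ := L.exists_coeff_eq (K := K) hj.1
        obtain ⟨-, h2, h3⟩ := hP.order hu hj'
        rw [h3 (h2.2 ((he j).1 hj)), hu']
      · rfl
    · rw [if_neg hj, coeff_zero]
      split_ifs with hji
      · subst hji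
        rw [he, not_not] at hj
        exact hj.symm
      · rfl
  simp only [this]
  rw [Finset.sum_ite_eq']
  split_ifs with hi
  · rfl
  · by_contra hne
    have := hP.coeff_ne_zero (Ne.symm hne)
    rw [coeff_toPoly, L.coeff_eq_zero i (by simpa using hi), map_zero] at this
    exact this rfl

/-- Substituting x = tⁿ in the operator, or in the comparison of its coefficients, gives the same
initial form. -/
theorem hasInit_ramify (hP : HasInit (L.toPoly K) n hn d p h P) :
    HasInit ((L.ramify n hn).toPoly K) 1 one_ne_zero d p h P := by
  obtain ⟨h0, g, hg⟩ := hP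
  refine ⟨h0, g, fun i => ⟨?_, (hg i).2⟩⟩
  rw [← (hg i).1, coeff_toPoly, coeff_toPoly, ram_toK, ram_toK]
  congr 1
  apply Subtype.ext
  rw [germExpand_coe, germExpand_coe, PowerSeries.expand_one_apply]
  rfl

end Operator

theorem exists_operator {R : K[X]} (hR : R ≠ 0) :
    ∃ (L : Operator C) (f : K), f ≠ 0 ∧ L.toPoly K = Polynomial.C f * R := by
  classical
  obtain ⟨b, hb⟩ := IsLocalization.exist_integer_multiples_of_finset
    (nonZeroDivisors (Germ C)) (R.support.image R.coeff)
  have hb' : ∀ i, ∃ g : Germ C, toK C K g = toK C K b * R.coeff i := by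
    intro i
    by_cases hi : R.coeff i = 0
    · exact ⟨0, by rw [hi, map_zero, mul_zero]⟩
    · obtain ⟨g, hg⟩ := hb (R.coeff i) (Finset.mem_image_of_mem _ (mem_support_iff.2 hi))
      refine ⟨g, hg.trans ?_⟩
      rw [Algebra.smul_def]
  choose g hg using hb'
  have hb0 : toK C K b ≠ 0 := by
    rw [Ne, toK_eq_zero]
    exact nonZeroDivisors.coe_ne_zero b
  let L : Operator C :=
    { order := R.natDegree
      coeff := g
      coeff_order_ne_zero := by
        rw [Ne, ← toK_eq_zero (K := K), hg]
        exact mul_ne_zero hb0 (leadingCoeff_ne_zero.2 hR)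
      coeff_eq_zero := fun i hi => by
        rw [← toK_eq_zero (K := K), hg, coeff_eq_zero_of_natDegree_lt hi, mul_zero] }
  refine ⟨L, toK C K b, hb0, ?_⟩
  ext i
  rw [L.coeff_toPoly, coeff_C_mul]
  exact hg i

open Classical in
/-- The quotients of the nonzero roots of a polynomial that are not in `p^{ℤ_{≤ 0}}`. -/
noncomputable def rootRatios (P : C[X]) (p : Cˣ) : Finset C :=
  (((P.roots.filter (· ≠ 0)).toFinset ×ˢ (P.roots.filter (· ≠ 0)).toFinset).image
    (fun z => z.1 * z.2⁻¹)).filter (fun z => ¬ ∃ m : ℕ, z = ((p ^ (-(m : ℤ)) : Cˣ) : C))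

/-- Almost admissibility of a skew polynomial. -/
def IsAlmostAdmissiblePoly (rt : ℕ → Cˣ) (A : K[X]) : Prop :=
  ∀ (μ : ℚ) (p : Cˣ) (h : ℤ) (P : C[X]), HasInit A μ.den μ.den_nz μ.num p h P →
    P.natTrailingDegree < P.natDegree →
      ∃ (N : ℕ) (hN : N ≠ 0) (D : ℤ), (D : ℚ) = N * μ ∧
        ∀ (h' : ℤ) (P' : C[X]), HasInit A N hN D (rt N) h' P' →
          IsConvergent (phi (rt N : C) (rootRatios P' (rt N)))

theorem num_eq_den_mul (μ : ℚ) : (μ.num : ℚ) = μ.den * μ := by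
  rw [mul_comm]
  exact (Rat.mul_den_eq_num μ).symm

theorem Operator.isAlmostAdmissible_iff (L : Operator C) (rt : ℕ → Cˣ) :
    L.IsAlmostAdmissible rt ↔ IsAlmostAdmissiblePoly rt (L.toPoly K) := by
  have key : ∀ (N : ℕ) (hN : N ≠ 0) (D : ℤ) (h' : ℤ) (P' : C[X]),
      HasInit (L.toPoly K) N hN D (rt N) h' P' →
        ((L.ramify N hN).IsAdmissibleSlope (rt N) D ↔
          IsConvergent (phi (rt N : C) (rootRatios P' (rt N)))) := by
    intro N hN D h' P' hP'
    rw [Operator.IsAdmissibleSlope, Operator.exponentRatios, Operator.exponents,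
      Operator.charPoly_eq (Operator.hasInit_ramify (K := K) hP')]
    rfl
  constructor
  · intro hL μ p h P hP hlt
    obtain ⟨N, hN, D, hD, hadm⟩ := hL μ ((Operator.isSlope_iff hP (num_eq_den_mul μ)).2 hlt)
    exact ⟨N, hN, D, hD, fun h' P' hP' => (key N hN D h' P' hP').1 hadm⟩
  · intro hL μ hμ
    obtain ⟨h, P, hP⟩ := exists_hasInit (C := C) (L.toPoly_ne_zero (K := K)) μ.den μ.den_nz μ.num 1
    obtain ⟨N, hN, D, hD, hadm⟩ := hL μ 1 h P hP
      ((Operator.isSlope_iff hP (num_eq_den_mul μ)).1 hμ)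
    obtain ⟨h', P', hP'⟩ := exists_hasInit (C := C) (L.toPoly_ne_zero (K := K)) N hN D (rt N)
    exact ⟨N, hN, D, hD, (key N hN D h' P' hP').2 (hadm h' P' hP')⟩

end Link

/-! ## Small divisors of almost admissible operators -/

section SmallDivisors

open Polynomial

variable {C : Type*} [NormedField C]

theorem norm_qPochhammer_le {p : C} (hp : ‖p‖ = 1) (a : C) (n : ℕ) :
    ‖qPochhammer a p n‖ ≤ (1 + ‖a‖) ^ n := by
  rw [qPochhammer, norm_prod]
  calc ∏ i ∈ Finset.range n, ‖1 - p ^ i * a‖ ≤ ∏ _i ∈ Finset.range n, (1 + ‖a‖) := by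
        refine Finset.prod_le_prod (fun _ _ => norm_nonneg _) fun i _ => ?_
        refine (norm_sub_le _ _).trans_eq ?_
        rw [norm_one, norm_mul, norm_pow, hp, one_pow, one_mul]
    _ = (1 + ‖a‖) ^ n := by simp

theorem one_sub_ne_zero_of_not_mem {p : Cˣ} {a : C}
    (h : ¬ ∃ m : ℕ, a = ((p ^ (-(m : ℤ)) : Cˣ) : C)) (i : ℕ) : 1 - (p : C) ^ i * a ≠ 0 := by
  intro h0
  apply h
  refine ⟨i, ?_⟩
  rw [zpow_neg, zpow_natCast, Units.val_inv_eq_inv_val, Units.val_pow_eq_pow_val]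
  exact eq_inv_of_mul_eq_one_right (sub_eq_zero.1 h0).symm

theorem qPochhammer_ne_zero {p : Cˣ} {a : C} (h : ¬ ∃ m : ℕ, a = ((p ^ (-(m : ℤ)) : Cˣ) : C))
    (n : ℕ) : qPochhammer a (p : C) n ≠ 0 :=
  Finset.prod_ne_zero_iff.2 fun i _ => one_sub_ne_zero_of_not_mem h i

/-- Dropping an element of the set multiplies the n-th coefficient by a Pochhammer symbol, which is
at most geometric since |p| = 1. -/
theorem isConvergent_phi_of_subset {p : C} (hp : ‖p‖ = 1) {Λ Λ' : Finset C} (h : Λ ⊆ Λ')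
    (h0 : ∀ a ∈ Λ', ∀ n, qPochhammer a p n ≠ 0) (hΛ : IsConvergent (phi p Λ')) :
    IsConvergent (phi p Λ) := by
  classical
  obtain ⟨A, B, hB, hAB⟩ := hΛ
  refine ⟨A, B * ∏ a ∈ Λ' \ Λ, (1 + ‖a‖),
    mul_pos hB (Finset.prod_pos fun a _ => by positivity), fun n => ?_⟩
  have h1 := hAB n
  rw [phi, PowerSeries.coeff_mk] at h1 ⊢
  have h2 : (∏ a ∈ Λ, qPochhammer a p n)⁻¹ =
      (∏ a ∈ Λ', qPochhammer a p n)⁻¹ * ∏ a ∈ Λ' \ Λ, qPochhammer a p n := by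
    rw [← Finset.prod_sdiff h, mul_inv, mul_right_comm, inv_mul_cancel₀, one_mul]
    exact Finset.prod_ne_zero_iff.2 fun a ha => h0 a (Finset.sdiff_subset ha) n
  rw [h2, norm_mul, mul_pow, ← mul_assoc, norm_prod, ← Finset.prod_pow]
  exact mul_le_mul h1 (Finset.prod_le_prod (fun _ _ => norm_nonneg _)
    fun a _ => norm_qPochhammer_le hp a n) (Finset.prod_nonneg fun _ _ => norm_nonneg _)
    ((norm_nonneg _).trans h1)

/-- Convergence bounds the full product of the inverses. Truncating each one at 1 costs at most 1 +
|a| per factor, because |1 - p^i a| ≤ 1 + |a|. -/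
theorem geoBdd_of_isConvergent {p : C} (hp : ‖p‖ = 1) {a : C} (h0 : ∀ i : ℕ, 1 - p ^ i * a ≠ 0)
    (h : IsConvergent (PowerSeries.mk fun n => (qPochhammer a p n)⁻¹)) :
    GeoBdd fun i => ‖1 - p ^ i * a‖⁻¹ := by
  obtain ⟨A, B, hA, hB, hAB⟩ := h.exists_one_le
  refine ⟨A, B * (1 + ‖a‖), hA, by positivity, fun k => ?_⟩
  have h1 := hAB k
  rw [PowerSeries.coeff_mk, qPochhammer, norm_inv, norm_prod] at h1
  have hle : ∀ i, ‖1 - p ^ i * a‖ ≤ 1 + ‖a‖ := fun i => by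
    refine (norm_sub_le _ _).trans_eq ?_
    rw [norm_one, norm_mul, norm_pow, hp, one_pow, one_mul]
  calc ∏ i ∈ Finset.range k, max 1 ‖1 - p ^ i * a‖⁻¹
      ≤ ∏ i ∈ Finset.range k, ((1 + ‖a‖) * ‖1 - p ^ i * a‖⁻¹) := by
        refine Finset.prod_le_prod (fun i _ => zero_le_one.trans (le_max_left _ _)) fun i _ => ?_
        have hpos : 0 < ‖1 - p ^ i * a‖ := norm_pos_iff.2 (h0 i)
        refine max_le ?_ ?_
        · rw [← div_eq_mul_inv, one_le_div hpos]
          exact hle i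
        · exact le_mul_of_one_le_left (inv_nonneg.2 hpos.le) (by linarith [norm_nonneg a])
    _ = (1 + ‖a‖) ^ k * (∏ i ∈ Finset.range k, ‖1 - p ^ i * a‖)⁻¹ := by
        rw [Finset.prod_mul_distrib, Finset.prod_inv_distrib]
        simp
    _ ≤ (1 + ‖a‖) ^ k * (A * B ^ k) := by gcongr
    _ = A * (B * (1 + ‖a‖)) ^ k := by rw [mul_pow]; ring

theorem GeoBdd.add_int (f : ℤ → ℝ) (h : GeoBdd fun i : ℕ => f i) (s : ℤ) :
    GeoBdd fun i : ℕ => f (i + s) := by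
  induction s using Int.induction_on with
  | zero => simpa using h
  | succ s ih =>
    refine ih.succ.mono fun i => le_max_of_le_right (le_of_eq ?_)
    congr 1
    push_cast
    ring
  | pred s ih =>
    refine GeoBdd.of_succ (ih.mono fun i => le_max_of_le_right (le_of_eq ?_))
    congr 1
    push_cast
    ring

variable {q : Cˣ}

/-- With r^N = q, the number 1 - q^i is 1 - r^i times a geometric sum of N terms of absolute value
1. At i = 0 the inverse is 0 by convention. -/
theorem geoBdd_one_sub_pow (hq1 : ‖(q : C)‖ = 1) (hqr : ∀ n : ℕ, 0 < n → q ^ n ≠ 1)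
    (hconv : IsConvergent (PowerSeries.mk fun n => (qPochhammer (q : C) (q : C) n)⁻¹))
    {r : Cˣ} {N : ℕ} (hr : r ^ N = q) :
    GeoBdd fun i => ‖1 - (r : C) ^ i‖⁻¹ := by
  have hne : ∀ i : ℕ, 1 - (q : C) ^ (i + 1) ≠ 0 := by
    intro i h
    apply hqr (i + 1) i.succ_pos
    apply Units.ext
    rw [Units.val_pow_eq_pow_val, Units.val_one]
    exact (sub_eq_zero.1 h).symm
  have h1 : GeoBdd fun i => ‖1 - (q : C) ^ i‖⁻¹ := by
    refine GeoBdd.of_succ ?_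
    have := geoBdd_of_isConvergent hq1 (a := (q : C)) (fun i => by rw [← pow_succ]; exact hne i)
      hconv
    simpa only [← pow_succ] using this
  have hN : N ≠ 0 := by
    rintro rfl
    rw [pow_zero] at hr
    exact hqr 1 one_pos (by rw [← hr, one_pow])
  have hr1 : ‖(r : C)‖ = 1 := by
    rw [← hr, Units.val_pow_eq_pow_val, norm_pow] at hq1
    exact (pow_eq_one_iff_of_nonneg (norm_nonneg _) hN).1 hq1
  refine ((geoBdd_of_le (N : ℝ) fun _ => le_rfl).mul h1 fun _ => Nat.cast_nonneg _).mono
    fun i => le_max_of_le_right ?_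
  rcases i with _ | i
  · simp
  have h2 : 1 - (q : C) ^ (i + 1) =
      (∑ j ∈ Finset.range N, ((r : C) ^ (i + 1)) ^ j) * (1 - (r : C) ^ (i + 1)) := by
    rw [geom_sum_mul_neg, ← pow_mul, mul_comm, pow_mul, ← Units.val_pow_eq_pow_val r N, hr]
  have h3 : ‖1 - (q : C) ^ (i + 1)‖ ≤ N * ‖1 - (r : C) ^ (i + 1)‖ := by
    rw [h2, norm_mul]
    refine mul_le_mul_of_nonneg_right ((norm_sum_le _ _).trans ?_) (norm_nonneg _)
    simp [norm_pow, hr1]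
  have h4 : 0 < ‖1 - (q : C) ^ (i + 1)‖ := norm_pos_iff.2 (hne i)
  have h5 : 0 < ‖1 - (r : C) ^ (i + 1)‖ := by
    rw [norm_pos_iff]
    intro h0
    rw [h0, mul_zero] at h2
    exact hne i h2
  rw [← div_eq_mul_inv, le_div_iff₀ h4, inv_mul_le_iff₀ h5, mul_comm]
  exact h3

/-- Quotients in r^{ℤ≤0} are excluded from the admissibility condition; for them the divisors are 1
- r^{i-m}, controlled by the convergence assumed for q itself. Their single zero causes no trouble,
its inverse being 0. -/
theorem geoBdd_rootRatios (hq1 : ‖(q : C)‖ = 1) (hqr : ∀ n : ℕ, 0 < n → q ^ n ≠ 1)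
    (hconv : IsConvergent (PowerSeries.mk fun n => (qPochhammer (q : C) (q : C) n)⁻¹))
    {r : Cˣ} {N : ℕ} (hr : r ^ N = q) (hr1 : ‖(r : C)‖ = 1) {P : C[X]} (hP : P ≠ 0)
    (hphi : IsConvergent (phi (r : C) (rootRatios P r))) {e e' : Cˣ} (he : P.eval (e : C) = 0)
    (he' : P.eval (e' : C) = 0) :
    GeoBdd fun i : ℕ => ‖1 - ((r ^ i * (e / e') : Cˣ) : C)‖⁻¹ := by
  classical
  by_cases h : ∃ m : ℕ, ((e / e' : Cˣ) : C) = ((r ^ (-(m : ℤ)) : Cˣ) : C)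
  · obtain ⟨m, hm⟩ := h
    have h1 : GeoBdd fun i : ℕ => (fun s : ℤ => ‖1 - ((r ^ s : Cˣ) : C)‖⁻¹) i := by
      simpa using geoBdd_one_sub_pow hq1 hqr hconv hr
    refine (GeoBdd.add_int (fun s : ℤ => ‖1 - ((r ^ s : Cˣ) : C)‖⁻¹) h1 (-(m : ℤ))).mono fun i => le_max_of_le_right (le_of_eq ?_)
    rw [Units.ext hm, zpow_add, zpow_natCast]
  · have hmem : ((e / e' : Cˣ) : C) ∈ rootRatios P r := by
      rw [rootRatios, Finset.mem_filter]
      refine ⟨?_, h⟩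
      rw [Finset.mem_image]
      refine ⟨((e : C), (e' : C)), ?_, ?_⟩
      · simp [hP, he, he']
      · simp [div_eq_mul_inv]
    have h1 := isConvergent_phi_of_subset hr1 (Finset.singleton_subset_iff.2 hmem)
      (fun a ha n => qPochhammer_ne_zero (Finset.mem_filter.1 ha).2 n) hphi
    rw [phi] at h1
    simp only [Finset.prod_singleton] at h1
    have h2 := geoBdd_of_isConvergent hr1 (one_sub_ne_zero_of_not_mem h) h1
    simpa using h2

variable {K : Type*} [Field K] [Algebra (Germ C) K] [IsFractionRing (Germ C) K]

/-- The exponents occurring in P are congruent modulo n, so multiplying the variable by an n-th root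
of unity multiplies P by a constant. -/
theorem HasInit.eval_mul_eq_zero {A : K[X]} {n : ℕ} {hn : n ≠ 0} {d : ℤ} {p : Cˣ} {h : ℤ} {P : C[X]}
    (hP : HasInit A n hn d p h P) (hc : IsCoprime d (n : ℤ)) {e ζ : C} (he : P.eval e = 0)
    (hζ : ζ ^ n = 1) : P.eval (e * ζ) = 0 := by
  have hζ0 : ζ ≠ 0 := by
    rintro rfl
    rw [zero_pow hn] at hζ
    exact zero_ne_one hζ
  have h1 : P.eval (e * ζ) = ζ ^ P.natDegree * P.eval e := by
    rw [eval_eq_sum, eval_eq_sum, Polynomial.sum, Polynomial.sum, Finset.mul_sum]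
    refine Finset.sum_congr rfl fun i hi => ?_
    have h2 := hP.dvd_sub hc (leadingCoeff_ne_zero.2 hP.1) (mem_support_iff.1 hi)
    have h3 := le_natDegree_of_mem_supp i hi
    obtain ⟨k, hk⟩ : n ∣ P.natDegree - i := by
      rw [← Int.natCast_dvd_natCast, Nat.cast_sub h3]
      exact h2
    have h4 : P.natDegree = i + n * k := by omega
    rw [h4, pow_add, pow_mul, hζ, one_pow, mul_pow]
    ring
  rw [h1, he, mul_zero]

/-- The exponents of an almost admissible operator. -/
theorem exists_exponentData (hq1 : ‖(q : C)‖ = 1) (hqr : ∀ n : ℕ, 0 < n → q ^ n ≠ 1)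
    (hconv : IsConvergent (PowerSeries.mk fun n => (qPochhammer (q : C) (q : C) n)⁻¹))
    {rt : ℕ → Cˣ} (hrt : ∀ n : ℕ, 0 < n → rt n ^ n = q) {A : K[X]}
    (hA : IsAlmostAdmissiblePoly rt A) :
    ∃ X : ExponentData C q, ∀ μ h P, HasInit A μ.den μ.den_nz μ.num (X.root μ) h P →
      ∀ c : Cˣ, P.eval (c : C) = 0 → c ∈ X.set μ := by
  have key : ∀ μ : ℚ, ∃ g : ℕ, g ≠ 0 ∧ ∀ (h : ℤ) (P : C[X]),
      HasInit A μ.den μ.den_nz μ.num (rt (μ.den * g) ^ g) h P →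
        P.natTrailingDegree < P.natDegree →
          IsConvergent (phi (rt (μ.den * g) : C) (rootRatios P (rt (μ.den * g)))) := by
    intro μ
    by_cases hs : ∃ (p : Cˣ) (h : ℤ) (P : C[X]), HasInit A μ.den μ.den_nz μ.num p h P ∧
        P.natTrailingDegree < P.natDegree
    · obtain ⟨p, h, P, hP, hlt⟩ := hs
      obtain ⟨N, hN, D, hD, hconv⟩ := hA μ p h P hP hlt
      have hD' : D * μ.den = N * μ.num := by
        have : (D : ℚ) * μ.den = N * μ.num := by
          rw [hD, num_eq_den_mul μ]; ring
        exact_mod_cast this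
      -- The ramification index clearing the slope is a multiple of the denominator. The root of q
      -- attached to μ has to be the g-th power of the chosen root of index N, which may differ from
      -- the chosen root of index the denominator.
      obtain ⟨g, rfl⟩ : μ.den ∣ N := by
        have h1 : (μ.den : ℤ) ∣ N * μ.num := ⟨D, by rw [← hD', mul_comm]⟩
        exact Int.natCast_dvd_natCast.1
          ((Rat.isCoprime_num_den μ).symm.dvd_of_dvd_mul_right h1)
      have hg : g ≠ 0 := right_ne_zero_of_mul hN
      have hDg : D = μ.num * g := by
        have hd : (μ.den : ℤ) ≠ 0 := by exact_mod_cast μ.den_nz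
        apply mul_right_cancel₀ hd
        rw [hD']
        push_cast
        ring
      subst hDg
      refine ⟨g, hg, fun h' P' hP' _ => hconv _ _ (hP'.ramify hg)⟩
    · exact ⟨1, one_ne_zero, fun h P hP hlt => absurd ⟨_, h, P, hP, hlt⟩ hs⟩
  choose g hg hgc using key
  have hr : ∀ μ : ℚ, rt (μ.den * g μ) ^ (μ.den * g μ) = q := fun μ =>
    hrt _ (Nat.mul_pos μ.den_pos (Nat.pos_of_ne_zero (hg μ)))
  have hr1 : ∀ μ : ℚ, ‖(rt (μ.den * g μ) : C)‖ = 1 := by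
    intro μ
    have h1 := hq1
    rw [← hr μ, Units.val_pow_eq_pow_val, norm_pow] at h1
    exact (pow_eq_one_iff_of_nonneg (norm_nonneg _) (mul_ne_zero μ.den_nz (hg μ))).1 h1
  set root : ℚ → Cˣ := fun μ => rt (μ.den * g μ) ^ g μ with hroot
  have hrp : ∀ μ, root μ ^ μ.den = q := fun μ => by
    simp only [hroot]
    rw [← pow_mul, mul_comm (g μ), hr]
  let X : ExponentData C q :=
    { root := root
      root_pow := hrp
      -- The exponents are the nonzero roots of the initial form, translated by all powers of the
      -- root.
      set := fun μ => {c | ∃ (e : Cˣ) (m : ℤ) (h : ℤ) (P : C[X]),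
        HasInit A μ.den μ.den_nz μ.num (root μ) h P ∧ P.eval (e : C) = 0 ∧ c = e * root μ ^ m}
      closed := by
        rintro μ c c' m ⟨e, s, h, P, hP, he, rfl⟩ hc'
        set ζ : Cˣ := c' / (e * root μ ^ (s + m)) with hζ
        have hζn : ζ ^ μ.den = 1 := by
          rw [hζ, div_pow, hc', div_eq_one, zpow_add, ← mul_assoc, mul_pow _ (root μ ^ m)]
          congr 1
          conv_lhs => rw [← hrp μ]
          rw [← zpow_natCast (root μ ^ m), ← zpow_natCast (root μ), ← zpow_mul, ← zpow_mul,
            mul_comm m]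
        refine ⟨e * ζ, s + m, h, P, hP, ?_, ?_⟩
        · rw [Units.val_mul]
          refine hP.eval_mul_eq_zero (Rat.isCoprime_num_den μ) he ?_
          rw [← Units.val_pow_eq_pow_val, hζn, Units.val_one]
        · rw [hζ, mul_right_comm, mul_div_cancel]
      bdd := by
        rintro μ c c' ⟨e, s, h, P, hP, he, rfl⟩ ⟨e', s', h', P', hP', he', rfl⟩
        obtain ⟨rfl, rfl⟩ := hP.unique hP'
        have hlt := natTrailingDegree_lt_natDegree hP.1 (Units.ne_zero _) he
        have h1 := geoBdd_rootRatios hq1 hqr hconv (hr μ) (hr1 μ) hP.1 (hgc μ _ _ hP hlt) he he'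
        -- Admissibility speaks of all powers of the finer root; only those of its g-th power are
        -- needed.
        have h2 := h1.comp_mul (hg μ)
        have h3 : GeoBdd fun i : ℕ =>
            (fun t : ℤ => ‖1 - ((root μ ^ t * (e / e') : Cˣ) : C)‖⁻¹) i := by
          refine h2.mono fun i => le_max_of_le_right (le_of_eq ?_)
          simp only [hroot]
          rw [zpow_natCast, ← pow_mul]
        refine (GeoBdd.add_int (fun t : ℤ => ‖1 - ((root μ ^ t * (e / e') : Cˣ) : C)‖⁻¹) h3 (s - s')).mono fun i => le_max_of_le_right (le_of_eq ?_)
        congr 4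
        rw [zpow_add, zpow_sub, zpow_natCast, mul_assoc]
        congr 1
        rw [mul_div_mul_comm, mul_comm]
        rfl }
  exact ⟨X, fun μ h P hP c hc => ⟨c, 0, h, P, hP, hc, by rw [zpow_zero, mul_one]⟩⟩

/-- A right factor of an almost admissible operator is almost admissible. -/
theorem IsAlmostAdmissiblePoly.of_comp (hq1 : ‖(q : C)‖ = 1) {rt : ℕ → Cˣ}
    (hrt : ∀ n : ℕ, 0 < n → rt n ^ n = q) {Q R : K[X]} (hQ : Q ≠ 0) (hR : R ≠ 0)
    (hA : IsAlmostAdmissiblePoly rt (QDiff.comp (sh q) Q R)) : IsAlmostAdmissiblePoly rt R := by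
  classical
  intro μ p h P hP hlt
  obtain ⟨h₁, P₁, hP₁⟩ := exists_hasInit hQ μ.den μ.den_nz μ.num (rt μ.den)
  obtain ⟨h₂, P₂, hP₂⟩ := exists_hasInit hR μ.den μ.den_nz μ.num (rt μ.den)
  obtain ⟨h₃, P₃, hP₃⟩ := exists_hasInit (comp_ne_zero (σ := sh q) hQ hR) μ.den μ.den_nz μ.num
    (rt μ.den)
  obtain ⟨e1, e2⟩ := hP₁.natDegree_comp (hrt _ μ.den_pos) hP₂ hP₃
  obtain ⟨e3, e4⟩ := natDegree_natTrailingDegree_congr hP.1 (hP.coeff_ne_zero_iff hP₂)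
  have e5 := natTrailingDegree_le_natDegree P₁
  -- Lengths of edges add up in a product, so a slope of the right factor is a slope of the product.
  obtain ⟨N, hN, D, hD, hconv⟩ := hA μ _ _ _ hP₃ (by omega)
  refine ⟨N, hN, D, hD, fun h' P' hP' => ?_⟩
  have hp := hrt N (Nat.pos_of_ne_zero hN)
  obtain ⟨h₄, P₄, hP₄⟩ := exists_hasInit hQ N hN D (rt N)
  have h1 := hP₄.comp hp hP'
  have hr1 : ‖(rt N : C)‖ = 1 := by
    have h1 := hq1
    rw [← hp, Units.val_pow_eq_pow_val, norm_pow] at h1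
    exact (pow_eq_one_iff_of_nonneg (norm_nonneg _) hN).1 h1
  refine isConvergent_phi_of_subset hr1 ?_
    (fun a ha n => qPochhammer_ne_zero (Finset.mem_filter.1 ha).2 n) (hconv _ _ h1)
  -- The initial form of the right factor divides that of the product without rescaling, so its root
  -- quotients are among those of the product.
  refine Finset.filter_subset_filter _ (Finset.image_subset_image
    (Finset.product_subset_product ?_ ?_)) <;>
  · refine Multiset.toFinset_subset.2 fun a ha => ?_
    rw [Multiset.mem_filter] at ha ⊢
    refine ⟨?_, ha.2⟩
    rw [mem_roots h1.1, IsRoot, eval_mul, (mem_roots hP'.1).1 ha.1, mul_zero]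

end SmallDivisors

/-! ## Direct summands and transport of structures -/

section Summands

open Polynomial

/-! ### Direct sums by dimension count -/

section FiniteSums

variable {K : Type*} [Field K] {M : Type*} [AddCommGroup M] [Module K M]

theorem isInternal_of_sum_finrank_le [FiniteDimensional K M] {ι : Type*} [Fintype ι] [DecidableEq ι]
    (N : ι → Submodule K M) (hsup : ⨆ i, N i = ⊤)
    (hle : ∑ i, Module.finrank K (N i) ≤ Module.finrank K M) :
    DirectSum.IsInternal N ∧ ∑ i, Module.finrank K (N i) = Module.finrank K M := by
  have hs : Function.Surjective (DirectSum.coeLinearMap N) := by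
    rw [← LinearMap.range_eq_top, ← hsup]
    exact DirectSum.range_coeLinearMap
  have hf : Module.finrank K (DirectSum ι fun i => N i) = ∑ i, Module.finrank K (N i) :=
    Module.finrank_directSum _ _
  have h1 := LinearMap.finrank_le_finrank_of_surjective (f := DirectSum.coeLinearMap N) hs
  have h2 : Module.finrank K (DirectSum ι fun i => N i) = Module.finrank K M := by omega
  exact ⟨⟨(LinearMap.injective_iff_surjective_of_finrank_eq_finrank h2).2 hs, hs⟩, by omega⟩

end FiniteSums

variable {C : Type*} [NormedField C] {K : Type*} [Field K] [Algebra (Germ C) K]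
  [IsFractionRing (Germ C) K] {q : Cˣ}
variable {M : Type*} [AddCommGroup M] [Module K M]
  {S : M →ₛₗ[((sh q : K ≃+* K) : K →+* K)] M}
variable {W : Type*} [AddCommGroup W] [Module K W]
  {S' : W →ₛₗ[((sh q : K ≃+* K) : K →+* K)] W}

/-- The annihilator of m has a nonzero constant term, so m is a combination of Σm, Σ²m, …. -/
theorem Stable.mem_of_map_mem [FiniteDimensional K M] (hS : Function.Injective S)
    {N : Submodule K M} (hN : Stable S N) {m : M} (hm : S m ∈ N) : m ∈ N := by
  obtain ⟨B, hB⟩ := exists_isMin (S := S) ⊥ m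
  have h0 : B.coeff 0 ≠ 0 := by
    by_cases hd : B.natDegree = 0
    · rw [← hd]
      exact leadingCoeff_ne_zero.2 hB.ne_zero
    · exact hB.coeff_zero_ne_zero hS hd
  have h1 := hB.ev_eq_zero
  rw [ev_eq_sum_range S m B (Nat.lt_succ_self _), Finset.sum_range_succ', add_comm,
    Function.iterate_zero, id, add_eq_zero_iff_eq_neg] at h1
  rw [← N.smul_mem_iff h0, h1]
  refine N.neg_mem (N.sum_mem fun i _ => N.smul_mem _ ?_)
  rw [Function.iterate_succ_apply]
  exact hN.iterate i hm

variable (S) in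
/-- `N` is generated by one element whose annihilator is almost admissible. -/
def IsAAGenerated (rt : ℕ → Cˣ) (N : Submodule K M) : Prop :=
  ∃ (a : M) (B : K[X]), LinearMap.range (ev S a) = N ∧ IsMin S ⊥ a B ∧ IsAlmostAdmissiblePoly rt B

/-- The minimal annihilator is a right factor of any annihilator. -/
theorem isAAGenerated_of_ev_eq_zero [FiniteDimensional K M] (hq1 : ‖(q : C)‖ = 1) {rt : ℕ → Cˣ}
    (hrt : ∀ n : ℕ, 0 < n → rt n ^ n = q) {a : M} {A : K[X]} (hA : A ≠ 0)
    (hAA : IsAlmostAdmissiblePoly rt A) (h : ev S a A = 0) :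
    IsAAGenerated S rt (LinearMap.range (ev S a)) := by
  obtain ⟨R, hR⟩ := exists_isMin (S := S) ⊥ a
  obtain ⟨Q, rfl⟩ := hR.eq_comp stable_bot ((Submodule.mem_bot K).2 h)
  have hQ : Q ≠ 0 := by
    rintro rfl
    exact hA (comp_zero_left _)
  exact ⟨a, R, rfl, hR, hAA.of_comp hq1 hrt hQ hR.ne_zero⟩

/-- Almost admissibility passes to cyclic quotients: the image of an almost admissible generator
still generates, and the same operator kills it. -/
theorem IsAAGenerated.of_hom [FiniteDimensional K W] (hq1 : ‖(q : C)‖ = 1)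
    {rt : ℕ → Cˣ} (hrt : ∀ n : ℕ, 0 < n → rt n ^ n = q) {x : M} {y : W}
    (hx : IsAAGenerated S rt (LinearMap.range (ev S x)))
    (h : ∀ B, ev S x B = 0 → ev S' y B = 0) : IsAAGenerated S' rt (LinearMap.range (ev S' y)) := by
  obtain ⟨a, A, ha, hA, hAA⟩ := hx
  obtain ⟨B₀, rfl⟩ : a ∈ LinearMap.range (ev S x) := ha ▸ mem_range_ev a
  obtain ⟨B₁, hB₁⟩ : x ∈ LinearMap.range (ev S (ev S x B₀)) := ha ▸ mem_range_ev x
  have h1 : LinearMap.range (ev S' (ev S' y B₀)) = LinearMap.range (ev S' y) := by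
    refine le_antisymm ((stable_range y).range_le ⟨B₀, rfl⟩) ((stable_range _).range_le ⟨B₁, ?_⟩)
    rw [← ev_comp, ← sub_eq_zero]
    have := h (QDiff.comp (sh q) B₁ B₀ - 1) (by rw [map_sub, ev_one, ev_comp, hB₁, sub_self])
    rwa [map_sub, ev_one] at this
  rw [← h1]
  refine isAAGenerated_of_ev_eq_zero hq1 hrt hA.ne_zero hAA ?_
  rw [← ev_comp]
  apply h
  rw [ev_comp, hA.ev_eq_zero]

/-- The component in N of a cyclic generator of the whole generates N and is killed by the same
operator. -/
theorem IsAAGenerated.of_isCompl [FiniteDimensional K M] (hq1 : ‖(q : C)‖ = 1)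
    {rt : ℕ → Cˣ} (hrt : ∀ n : ℕ, 0 < n → rt n ^ n = q) (hM : IsAAGenerated S rt ⊤)
    {N T : Submodule K M} (hN : Stable S N) (hT : Stable S T) (hc : IsCompl N T) :
    IsAAGenerated S rt N := by
  obtain ⟨m, A, hm, hA, hAA⟩ := hM
  obtain ⟨a, ha, b, hb, rfl⟩ := Submodule.mem_sup.1
    (show m ∈ N ⊔ T by rw [hc.sup_eq_top]; trivial)
  have hmem : ∀ w ∈ N, w ∈ T → w = 0 := fun w h1 h2 => by
    rw [← Submodule.mem_bot K, ← hc.inf_eq_bot]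
    exact ⟨h1, h2⟩
  have h1 : ev S a A = 0 := by
    refine hmem _ (hN.ev_mem ha A) ?_
    have := hA.ev_eq_zero
    rw [ev_add_left, add_eq_zero_iff_eq_neg] at this
    rw [this]
    exact T.neg_mem (hT.ev_mem hb A)
  have h2 : LinearMap.range (ev S a) = N := by
    refine le_antisymm (hN.range_le ha) fun w hw => ?_
    obtain ⟨B, rfl⟩ : w ∈ LinearMap.range (ev S (a + b)) := by rw [hm]; trivial
    refine ⟨B, ?_⟩
    rw [eq_comm, ← sub_eq_zero]
    refine hmem _ (N.sub_mem hw (hN.ev_mem ha B)) ?_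
    rw [ev_add_left, add_sub_cancel_left]
    exact hT.ev_mem hb B
  rw [← h2]
  exact isAAGenerated_of_ev_eq_zero hq1 hrt hA.ne_zero hAA h1

theorem IsAAGenerated.of_isInternal [FiniteDimensional K M] (hq1 : ‖(q : C)‖ = 1)
    {rt : ℕ → Cˣ} (hrt : ∀ n : ℕ, 0 < n → rt n ^ n = q) (hM : IsAAGenerated S rt ⊤)
    {ι : Type*} [DecidableEq ι] {N : ι → Submodule K M} (hN : ∀ i, Stable S (N i))
    (hint : DirectSum.IsInternal N) (i : ι) : IsAAGenerated S rt (N i) := by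
  obtain ⟨h1, h2⟩ := (DirectSum.isInternal_submodule_iff_iSupIndep_and_iSup_eq_top N).1 hint
  refine hM.of_isCompl hq1 hrt (hN i) (T := ⨆ (j) (_ : j ≠ i), N j)
    (Stable.iSup fun j => Stable.iSup fun _ => hN j) ⟨h1 i, codisjoint_iff.2 ?_⟩
  rw [eq_top_iff, ← h2]
  refine iSup_le fun j => ?_
  by_cases hj : j = i
  · rw [hj]; exact le_sup_left
  · exact le_sup_of_le_right (le_iSup₂_of_le j hj le_rfl)

/-! ### Passing between a submodule and the ambient module -/

section Transport

variable {ι : W →ₗ[K] M} (hι : Function.Injective ι) (hS : ∀ w, ι (S' w) = S (ι w))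
include hS

theorem range_ev_map (w : W) :
    LinearMap.range (ev S (ι w)) = (LinearMap.range (ev S' w)).map ι := by
  ext x
  constructor
  · rintro ⟨B, rfl⟩
    exact ⟨ev S' w B, ⟨B, rfl⟩, map_ev S hS w B⟩
  · rintro ⟨_, ⟨B, rfl⟩, rfl⟩
    exact ⟨B, (map_ev S hS w B).symm⟩

theorem act_iterate_map (A : K[X]) (l : ℕ) (w : W) :
    ι ((act S' A)^[l] w) = (act S A)^[l] (ι w) := by
  induction l generalizing w with
  | zero => rfl
  | succ l ih =>
    rw [Function.iterate_succ_apply, Function.iterate_succ_apply, ih, act_apply, act_apply,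
      map_ev S hS]

include hι

theorem ev_eq_zero_iff_of_injective (w : W) (B : K[X]) : ev S (ι w) B = 0 ↔ ev S' w B = 0 := by
  rw [← map_ev S hS, map_eq_zero_iff _ hι]

theorem isMin_iff_of_injective (w : W) (B : K[X]) : IsMin S ⊥ (ι w) B ↔ IsMin S' ⊥ w B := by
  have := ev_eq_zero_iff_of_injective hι hS w
  constructor <;>
  · rintro ⟨h1, h2, h3⟩
    simp only [Submodule.mem_bot, this] at h2 h3
    refine ⟨h1, ?_, ?_⟩ <;> simpa only [Submodule.mem_bot, this]

theorem isAAGenerated_map_iff (rt : ℕ → Cˣ) (N : Submodule K W) :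
    IsAAGenerated S rt (N.map ι) ↔ IsAAGenerated S' rt N := by
  constructor
  · rintro ⟨a, B, h1, h2, h3⟩
    obtain ⟨w, -, rfl⟩ : a ∈ N.map ι := h1 ▸ mem_range_ev a
    rw [range_ev_map hS] at h1
    exact ⟨w, B, Submodule.map_injective_of_injective hι h1,
      (isMin_iff_of_injective hι hS w B).1 h2, h3⟩
  · rintro ⟨w, B, h1, h2, h3⟩
    exact ⟨ι w, B, by rw [range_ev_map hS, h1], (isMin_iff_of_injective hι hS w B).2 h2, h3⟩

theorem JordanSystem.of_injective {X : ExponentData C q} {N : Submodule K W} {J : Type} [Fintype J]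
    {μ : J → ℚ} {c : J → Cˣ} {v : J → W} {l : J → ℕ}
    (h : JordanSystem X S (N.map ι) μ c (fun j => ι (v j)) l) : JordanSystem X S' N μ c v l := by
  refine ⟨h.mem, h.isRep, fun j => ?_, ?_, ?_⟩
  · apply hι
    rw [act_iterate_map hS, h.iterate_eq_zero, map_zero]
  · apply Submodule.map_injective_of_injective hι
    rw [← h.iSup_range, Submodule.map_iSup]
    simp only [range_ev_map hS]
  · rw [h.finrank]
    exact (Submodule.equivMapOfInjective ι hι N).finrank_eq.symm

end Transport

namespace JordanSystem

variable {X : ExponentData C q} {N : Submodule K M} {J : Type} [Fintype J] {μ : J → ℚ} {c : J → Cˣ}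
  {v : J → M} {l : J → ℕ}

theorem pos (h : JordanSystem X S N μ c v l) :
    JordanSystem X S N (J := {j // l j ≠ 0}) (fun j => μ j) (fun j => c j) (fun j => v j)
      (fun j => l j) := by
  classical
  refine ⟨fun j => h.mem j, fun j => h.isRep j, fun j => h.iterate_eq_zero j, ?_, ?_⟩
  · rw [← h.iSup_range]
    apply le_antisymm
    · exact iSup_le fun j => le_iSup (fun j => LinearMap.range (ev S (v j))) (j : J)
    · refine iSup_le fun j => ?_
      by_cases hj : l j = 0
      · have := h.iterate_eq_zero j
        rw [hj, Function.iterate_zero, id] at this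
        rintro _ ⟨B, rfl⟩
        rw [this, ev_zero_left]
        exact Submodule.zero_mem _
      · exact le_iSup (fun j : {j // l j ≠ 0} => LinearMap.range (ev S (v j))) ⟨j, hj⟩
  · rw [← h.finrank, ← Finset.sum_subtype (Finset.univ.filter fun j => l j ≠ 0) (by simp)
      (fun j => (μ j).den * l j)]
    exact Finset.sum_filter_of_ne fun j _ hj => right_ne_zero_of_mul hj

theorem finrank_range_le [FiniteDimensional K M] (h : JordanSystem X S N μ c v l) (j : J) :
    Module.finrank K (LinearMap.range (ev S (v j))) ≤ (μ j).den * l j := by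
  have := finrank_range_ev_le _ (X.op_ne_zero (K := K) (μ j) (c j)) (l j) (v j)
    (h.iterate_eq_zero j)
  rwa [X.natDegree_op] at this

/-- The blocks generate a space whose dimension is the sum of their maximal possible dimensions, so
each block attains its maximum. -/
theorem isMin [FiniteDimensional K M] (h : JordanSystem X S N μ c v l) (j : J) :
    IsMin S ⊥ (v j) (powOp q (X.op K (μ j) (c j)) (l j)) := by
  have h1 := powOp_ne_zero_natDegree (q := q) (X.op_ne_zero (K := K) (μ j) (c j)) (l j)
  refine isMin_of_natDegree_le h1.1 (by rw [ev_powOp, h.iterate_eq_zero]) ?_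
  rw [h1.2, X.natDegree_op]
  have h2 : ∑ j, (μ j).den * l j ≤ ∑ j, Module.finrank K (LinearMap.range (ev S (v j))) := by
    rw [h.finrank, ← h.iSup_range]
    exact finrank_iSup_le _
  have h3 := (Finset.sum_eq_sum_iff_of_le fun j _ => h.finrank_range_le j).1
    (le_antisymm (Finset.sum_le_sum fun j _ => h.finrank_range_le j) h2) j (Finset.mem_univ j)
  exact h3.ge

theorem sum_subtype_slope (μ : J → ℚ) (s : ℚ) (f : J → ℕ) [Fintype {j // μ j = s}] :
    ∑ j : {j // μ j = s}, f j = ∑ j, if μ j = s then f j else 0 := by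
  classical
  rw [← Finset.sum_subtype (Finset.univ.filter fun j => μ j = s) (by simp) f, Finset.sum_filter]

/-- The isoclinic decomposition of a module with a Jordan system. -/
theorem isInternal_slopes [FiniteDimensional K M] (h : JordanSystem X S ⊤ μ c v l) {k : ℕ}
    {ν : Fin k → ℚ} (hν : Function.Injective ν) (hmem : ∀ j, ∃ i, ν i = μ j) :
    DirectSum.IsInternal (fun i => ⨆ j : {j // μ j = ν i}, LinearMap.range (ev S (v j))) ∧
      ∀ i, JordanSystem X S (⨆ j : {j // μ j = ν i}, LinearMap.range (ev S (v j)))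
        (J := {j // μ j = ν i}) (fun j => μ j) (fun j => c j) (fun j => v j) (fun j => l j) := by
  classical
  have hle : ∀ i, Module.finrank K
      (⨆ j : {j // μ j = ν i}, LinearMap.range (ev S (v j)) : Submodule K M) ≤
        ∑ j : {j // μ j = ν i}, (μ j).den * l j := fun i =>
    (finrank_iSup_le _).trans (Finset.sum_le_sum fun j _ => h.finrank_range_le j)
  have hsum : ∑ i, ∑ j : {j // μ j = ν i}, (μ j).den * l j = Module.finrank K M := by
    rw [← finrank_top K M, ← h.finrank]
    simp only [fun i => sum_subtype_slope μ (ν i) fun j => (μ j).den * l j]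
    rw [Finset.sum_comm]
    refine Finset.sum_congr rfl fun j _ => ?_
    obtain ⟨i, hi⟩ := hmem j
    rw [Finset.sum_eq_single i, if_pos hi.symm]
    · intro i' _ hi'
      rw [if_neg]
      intro h'
      exact hi' (hν (h'.symm.trans hi.symm))
    · simp
  have hsup : ⨆ i, ⨆ j : {j // μ j = ν i}, LinearMap.range (ev S (v j)) = ⊤ := by
    rw [eq_top_iff, ← h.iSup_range]
    refine iSup_le fun j => ?_
    obtain ⟨i, hi⟩ := hmem j
    exact le_iSup_of_le i (le_iSup (fun j : {j // μ j = ν i} => LinearMap.range (ev S (v j)))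
      ⟨j, hi.symm⟩)
  obtain ⟨h1, h2⟩ := isInternal_of_sum_finrank_le _ hsup
    ((Finset.sum_le_sum fun i _ => hle i).trans_eq hsum)
  have h3 := (Finset.sum_eq_sum_iff_of_le fun i _ => hle i).1 (h2.trans hsum.symm)
  exact ⟨h1, fun i => ⟨fun j => h.mem j, fun j => h.isRep j, fun j => h.iterate_eq_zero j, rfl,
    (h3 i (Finset.mem_univ i)).symm⟩⟩

/-- The decomposition of a module with a Jordan system in Jordan blocks. -/
theorem isInternal_blocks [FiniteDimensional K M] (h : JordanSystem X S ⊤ μ c v l) {k : ℕ}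
    (e : Fin k ≃ J) : DirectSum.IsInternal fun i => LinearMap.range (ev S (v (e i))) := by
  refine (isInternal_of_sum_finrank_le _ ?_ ?_).1
  · rw [← h.iSup_range]
    exact e.iSup_comp (g := fun j => LinearMap.range (ev S (v j)))
  · rw [← finrank_top K M, ← h.finrank, e.sum_comp fun j =>
      Module.finrank K (LinearMap.range (ev S (v j)))]
    exact Finset.sum_le_sum fun j _ => h.finrank_range_le j

end JordanSystem

end Summands

/-! ## Application to `q`-difference modules -/

namespace DiffModule

open Polynomial

variable {C : Type*} [NormedField C] {q : Cˣ}
variable {M : Type*} [AddCommGroup M] [Module (MeroGerm C) M]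

/-- The semilinear map of a `q`-difference module. -/
noncomputable def sig (D : DiffModule q M) :
    M →ₛₗ[((sh q : MeroGerm C ≃+* MeroGerm C) : MeroGerm C →+* MeroGerm C)] M := D.Sig

theorem sig_injective (D : DiffModule q M) : Function.Injective D.sig := D.bijective.1

theorem isSub_iff [FiniteDimensional (MeroGerm C) M] (D : DiffModule q M)
    {N : Submodule (MeroGerm C) M} : D.IsSub N ↔ Stable D.sig N :=
  ⟨fun h m hm => (h m).2 hm, fun h m => ⟨fun hm => h.mem_of_map_mem D.sig_injective hm, h m⟩⟩

/-! ### Cyclic bases and minimal annihilators -/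

section Aux

variable {K : Type*} [Field K] {σ : K ≃+* K}
variable {M : Type*} [AddCommGroup M] [Module K M] {S : M →ₛₗ[(σ : K →+* K)] M}

theorem isMin_iff_linearIndependent {m : M} {R : K[X]} (hR : R ≠ 0) {n : ℕ}
    (hn : R.natDegree = n) :
    IsMin S ⊥ m R ∧ LinearMap.range (ev S m) = ⊤ ↔
      LinearIndependent K (fun i : Fin n => S^[i] m) ∧
        Submodule.span K (Set.range fun i : Fin n => S^[i] m) = ⊤ ∧ ev S m R = 0 := by
  subst hn
  constructor
  · rintro ⟨h1, h2⟩
    exact ⟨h1.linearIndependent, by rw [← range_ev_eq_span hR h1.ev_eq_zero, h2], h1.ev_eq_zero⟩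
  · rintro ⟨h1, h2, h3⟩
    exact ⟨isMin_of_linearIndependent hR h3 h1, by rw [range_ev_eq_span hR h3, h2]⟩

theorem _root_.QDiff.IsMin.C_mul {N : Submodule K M} {m : M} {R : K[X]} (h : IsMin S N m R) {f : K}
    (hf : f ≠ 0) : IsMin S N m (Polynomial.C f * R) := by
  refine ⟨mul_ne_zero (C_ne_zero.2 hf) h.ne_zero, ?_, fun B hB hB0 => ?_⟩
  · rw [← smul_eq_C_mul, map_smul]
    exact N.smul_mem f h.mem
  · rw [natDegree_C_mul hf]
    exact h.le B hB hB0

end Aux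

theorem isAssociated_iff (D : DiffModule q M) (L : Operator C) :
    D.IsAssociated L ↔ ∃ m, IsMin D.sig ⊥ m (L.toPoly (MeroGerm C)) ∧
      LinearMap.range (ev D.sig m) = ⊤ := by
  have h : ∀ m, ev D.sig m (L.toPoly (MeroGerm C)) = ∑ i ∈ Finset.range (L.order + 1),
      algebraMap (Germ C) (MeroGerm C) (L.coeff i) • D.Sig^[i] m := by
    intro m
    rw [ev_eq_sum_range D.sig m _ (by rw [L.natDegree_toPoly]; exact Nat.lt_succ_self _)]
    refine Finset.sum_congr rfl fun i _ => ?_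
    rw [L.coeff_toPoly]
    rfl
  refine exists_congr fun m => ?_
  rw [isMin_iff_linearIndependent L.toPoly_ne_zero L.natDegree_toPoly, h]
  rfl

/-- Clearing denominators rescales the annihilator by an element of the field; the original is a
left multiple of the rescaled one, so `of_comp` applies. -/
theorem isAlmostAdmissible_iff (hq1 : ‖(q : C)‖ = 1) {rt : ℕ → Cˣ}
    (hrt : ∀ n : ℕ, 0 < n → rt n ^ n = q) (D : DiffModule q M) :
    D.IsAlmostAdmissible rt ↔ IsAAGenerated D.sig rt ⊤ := by
  constructor
  · rintro ⟨L, h1, h2⟩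
    obtain ⟨m, h3, h4⟩ := (D.isAssociated_iff L).1 h1
    exact ⟨m, _, h4, h3, (L.isAlmostAdmissible_iff rt).1 h2⟩
  · rintro ⟨a, B, h1, h2, h3⟩
    obtain ⟨L, f, hf, hL⟩ := exists_operator (C := C) h2.ne_zero
    refine ⟨L, (D.isAssociated_iff L).2 ⟨a, by rw [hL]; exact h2.C_mul hf, h1⟩, ?_⟩
    rw [L.isAlmostAdmissible_iff (K := MeroGerm C) rt, hL]
    refine IsAlmostAdmissiblePoly.of_comp hq1 hrt (Q := Polynomial.C f⁻¹)
      (C_ne_zero.2 (inv_ne_zero hf)) (mul_ne_zero (C_ne_zero.2 hf) h2.ne_zero) ?_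
    rw [comp_C_left, ← mul_assoc, ← C_mul, inv_mul_cancel₀ hf, C_1, one_mul]
    exact h3

theorem sig_restrict (D : DiffModule q M) (N : Submodule (MeroGerm C) M) (h : D.IsSub N) (w : N) :
    N.subtype ((D.restrict N h).sig w) = D.sig (N.subtype w) := rfl

theorem isAlmostAdmissible_restrict_iff (hq1 : ‖(q : C)‖ = 1) {rt : ℕ → Cˣ}
    (hrt : ∀ n : ℕ, 0 < n → rt n ^ n = q) (D : DiffModule q M) (N : Submodule (MeroGerm C) M)
    (h : D.IsSub N) : (D.restrict N h).IsAlmostAdmissible rt ↔ IsAAGenerated D.sig rt N := by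
  rw [isAlmostAdmissible_iff hq1 hrt,
    ← isAAGenerated_map_iff N.subtype_injective (D.sig_restrict N h), Submodule.map_top,
    Submodule.range_subtype]

/-! ### Jordan blocks as `q`-difference modules -/

section Block

variable [FiniteDimensional (MeroGerm C) M] (D : DiffModule q M) {X : ExponentData C q} {μ : ℚ}
  {c : Cˣ}

theorem isSub_range (m : M) : D.IsSub (LinearMap.range (ev D.sig m)) :=
  D.isSub_iff.2 (stable_range m)

theorem iterate_act_ne_zero {l : ℕ} {v : M}
    (h : IsMin D.sig ⊥ v (powOp q (X.op (MeroGerm C) μ c) (l + 1))) :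
    (act D.sig (X.op (MeroGerm C) μ c))^[l] v ≠ 0 := by
  intro h0
  rw [← ev_powOp] at h0
  obtain ⟨h1, h2⟩ := powOp_ne_zero_natDegree (q := q) (X.op_ne_zero (K := MeroGerm C) μ c) l
  obtain ⟨-, h3⟩ := powOp_ne_zero_natDegree (q := q) (X.op_ne_zero (K := MeroGerm C) μ c) (l + 1)
  have h4 := h.le _ ((Submodule.mem_bot _).2 h0) h1
  rw [h2, h3, X.natDegree_op, mul_add, mul_one] at h4
  have := μ.den_pos
  omega

/-- The map sends the generator v to the generator s of the socle; its kernel is the next smaller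
block because socle and top layer have the same annihilator. -/
theorem isExtension_block {l : ℕ} {v s : M}
    (h : IsMin D.sig ⊥ v (powOp q (X.op (MeroGerm C) μ c) (l + 1)))
    (hs : (act D.sig (X.op (MeroGerm C) μ c))^[l] v = s) :
    D.IsExtension (D.restrict _ (D.isSub_range s))
      (LinearMap.range (ev D.sig (act D.sig (X.op (MeroGerm C) μ c) v)))
      (LinearMap.range (ev D.sig v)) := by
  refine ⟨(stable_range v).range_le ⟨_, rfl⟩, D.isSub_range v, ?_⟩
  set s' : LinearMap.range (ev D.sig s) := ⟨s, mem_range_ev s⟩ with hs'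
  have hs0 : ∀ B, ev (D.restrict _ (D.isSub_range s)).sig s' B = 0 ↔
      ev D.sig v B ∈ LinearMap.range (ev D.sig (act D.sig (X.op (MeroGerm C) μ c) v)) := by
    intro B
    rw [← ev_iterate_eq_zero_iff h, hs]
    exact (ev_eq_zero_iff_of_injective (Submodule.subtype_injective _)
      (D.sig_restrict _ (D.isSub_range s)) s' B).symm
  obtain ⟨φ, hφ⟩ := exists_hom_of_range_ev (S := D.sig) (x := v)
    (S' := (D.restrict _ (D.isSub_range s)).sig) (y := s')
    (fun B hB => (hs0 B).2 (hB ▸ Submodule.zero_mem _))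
  refine ⟨φ, ?_, ?_, ?_⟩
  · rintro ⟨_, B, rfl⟩
    refine ⟨⟨_, B, rfl⟩, ?_⟩
    rw [hφ B _ rfl]
    apply Subtype.ext
    exact map_ev D.sig (φ := Submodule.subtype _) (D.sig_restrict _ (D.isSub_range s)) s' B
  · rintro ⟨_, B, rfl⟩
    have e1 := hφ B ⟨ev D.sig v B, B, rfl⟩ rfl
    have e2 := hφ (skewX (sh q) B) ((D.restrict _ (D.isSub_range v)).Sig ⟨ev D.sig v B, B, rfl⟩)
      (ev_skewX D.sig v B).symm
    rw [e1, e2, ev_skewX]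
    rfl
  · rintro ⟨_, B, rfl⟩
    rw [hφ B _ rfl, hs0]

theorem isIteratedSub_block (s : M) (l : ℕ) : ∀ v : M,
    IsMin D.sig ⊥ v (powOp q (X.op (MeroGerm C) μ c) (l + 1)) →
    (act D.sig (X.op (MeroGerm C) μ c))^[l] v = s →
    D.IsIteratedSub (D.restrict _ (D.isSub_range s)) (LinearMap.range (ev D.sig v)) := by
  induction l with
  | zero =>
    intro v h hs
    refine IsIteratedSub.base _ ?_
    have h1 := D.isExtension_block h hs
    have hv : act D.sig (X.op (MeroGerm C) μ c) v = 0 := by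
      have := h.ev_eq_zero
      rwa [ev_powOp] at this
    have hr : LinearMap.range (ev D.sig (act D.sig (X.op (MeroGerm C) μ c) v)) = ⊥ := by
      rw [eq_bot_iff]
      rintro _ ⟨B, rfl⟩
      rw [hv, ev_zero_left]
      exact Submodule.zero_mem _
    rwa [hr] at h1
  | succ l ih =>
    intro v h hs
    refine IsIteratedSub.step _ _ (ih _ (h.act (X.op_ne_zero μ c)) hs) (D.isExtension_block h hs) ?_
    rintro ⟨T, hT, h1, h2⟩
    exact inf_ne_bot_of_sup_eq h (D.isSub_iff.1 hT) h1 h2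

theorem isIndecomposable_block {l : ℕ} {v : M}
    (h : IsMin D.sig ⊥ v (powOp q (X.op (MeroGerm C) μ c) (l + 1)))
    (htop : LinearMap.range (ev D.sig v) = ⊤) : D.IsIndecomposable := by
  have hne := D.iterate_act_ne_zero h
  refine ⟨⟨_, _, hne⟩, fun A B hA hB hAB => ?_⟩
  by_contra! hAB'
  have hmem : ∀ N : Submodule (MeroGerm C) M, D.IsSub N → N ≠ ⊥ →
      (act D.sig (X.op (MeroGerm C) μ c))^[l] v ∈ N := fun N hN hN' =>
    iterate_act_mem l v h N (D.isSub_iff.1 hN) (by rwa [htop, inf_top_eq])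
  apply hne
  rw [← Submodule.mem_bot (MeroGerm C), ← hAB.inf_eq_bot]
  exact ⟨hmem A hA hAB'.1, hmem B hB hAB'.2⟩

theorem isIteratedSelfExtension_block (hq1 : ‖(q : C)‖ = 1) {rt : ℕ → Cˣ}
    (hrt : ∀ n : ℕ, 0 < n → rt n ^ n = q) {l : ℕ} {v : M}
    (h : IsMin D.sig ⊥ v (powOp q (X.op (MeroGerm C) μ c) (l + 1)))
    (htop : LinearMap.range (ev D.sig v) = ⊤) (hAA : IsAAGenerated D.sig rt ⊤) :
    D.IsIteratedSelfExtension rt := by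
  have hne := D.iterate_act_ne_zero h
  set s := (act D.sig (X.op (MeroGerm C) μ c))^[l] v with hs
  refine ⟨LinearMap.range (ev D.sig s), D.isSub_range s, ⟨?_, fun N hN => ?_⟩, ?_, ?_⟩
  · exact ⟨⟨s, mem_range_ev s⟩, 0, fun h0 => hne (congrArg Subtype.val h0)⟩
  · refine or_iff_not_imp_left.2 fun hN0 => ?_
    have hst : Stable D.sig (N.map (Submodule.subtype _)) := by
      rintro _ ⟨w, hw, rfl⟩
      exact ⟨(D.restrict _ (D.isSub_range s)).sig w, (hN w).2 hw, rfl⟩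
    have h1 := iterate_act_mem l v h _ hst (by
      rw [htop, inf_top_eq]
      intro h0
      apply hN0
      exact Submodule.map_injective_of_injective (Submodule.subtype_injective _)
        (h0.trans (Submodule.map_bot _).symm))
    have h2 := hst.range_le h1
    rw [eq_top_iff]
    intro w _
    obtain ⟨w', hw', hww'⟩ := h2 w.2
    have : w' = w := Subtype.ext hww'
    exact this ▸ hw'
  · rw [isAlmostAdmissible_restrict_iff hq1 hrt]
    rw [← htop] at hAA
    -- The socle is a quotient of the block, through v ↦ s, and so inherits almost admissibility.
    refine hAA.of_hom hq1 hrt fun B hB => ?_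
    rw [hs, ev_iterate_eq_zero_iff h, hB]
    exact Submodule.zero_mem _
  · rw [← htop]
    exact D.isIteratedSub_block s l v h hs.symm

end Block

/-! ### Slopes and blocks of a `q`-difference module with a Jordan system -/

section Isoclinic

variable [FiniteDimensional (MeroGerm C) M] (D : DiffModule q M) {X : ExponentData C q}
  {J : Type} [Fintype J] {μ : J → ℚ} {c : J → Cˣ} {v : J → M} {l : J → ℕ}

theorem isSlope_iff_of_jordanSystem (h : JordanSystem X D.sig ⊤ μ c v l) {L : Operator C}
    (hL : D.IsAssociated L) (s : ℚ) (r : ℕ) :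
    (s, r) ∈ L.newtonPolygon ↔ 0 < r ∧ r = ∑ j, if μ j = s then (μ j).den * l j else 0 := by
  obtain ⟨m, hm, htop⟩ := (D.isAssociated_iff L).1 hL
  obtain ⟨h', P, hP⟩ := exists_hasInit hm.ne_zero s.den s.den_nz s.num (X.root s)
  rw [← htop] at h
  rw [Operator.mem_newtonPolygon_iff hP (num_eq_den_mul s),
    JordanSystem.natDegree_eq _ v l m _ s h' P rfl h hm hP, add_right_inj, eq_comm (a := r)]

theorem isPure_of_jordanSystem (h : JordanSystem X D.sig ⊤ μ c v l) {rt : ℕ → Cˣ} {μ₀ : ℚ}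
    (hμ : ∀ j, μ j = μ₀) (hpos : 0 < ∑ j, (μ j).den * l j) (hAA : D.IsAlmostAdmissible rt) :
    D.IsPure μ₀ := by
  obtain ⟨L, hL, -⟩ := hAA
  refine ⟨L, hL, fun s => ?_⟩
  rw [Operator.IsSlope]
  simp only [D.isSlope_iff_of_jordanSystem h hL, hμ]
  constructor
  · rintro ⟨r, hr, hr'⟩
    by_contra hs
    rw [Finset.sum_eq_zero fun j _ => if_neg (Ne.symm hs)] at hr'
    omega
  · rintro rfl
    simp only [hμ] at hpos
    exact ⟨_, hpos, by simp⟩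

theorem exists_blocks (hq1 : ‖(q : C)‖ = 1) {rt : ℕ → Cˣ}
    (hrt : ∀ n : ℕ, 0 < n → rt n ^ n = q) (h : JordanSystem X D.sig ⊤ μ c v l)
    (hl : ∀ j, l j ≠ 0) (hAA : D.IsAlmostAdmissible rt) :
    ∃ (k : ℕ) (P : Fin k → Submodule (MeroGerm C) M), DirectSum.IsInternal P ∧
      ∀ j, ∃ hj : D.IsSub (P j), (D.restrict (P j) hj).IsAlmostAdmissible rt ∧
        (D.restrict (P j) hj).IsIndecomposable ∧
        (D.restrict (P j) hj).IsIteratedSelfExtension rt := by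
  have e : Fin (Fintype.card J) ≃ J := (Fintype.equivFin J).symm
  have hint := h.isInternal_blocks e
  refine ⟨_, _, hint, fun i => ⟨D.isSub_range _, ?_⟩⟩
  rw [isAlmostAdmissible_iff hq1 hrt] at hAA
  have hAAi := (isAlmostAdmissible_restrict_iff hq1 hrt D _ (D.isSub_range (v (e i)))).2
    (hAA.of_isInternal hq1 hrt (fun i => stable_range (v (e i))) hint i)
  set D' := D.restrict _ (D.isSub_range (v (e i)))
  set v' : LinearMap.range (ev D.sig (v (e i))) := ⟨v (e i), mem_range_ev _⟩
  obtain ⟨l', hl'⟩ := Nat.exists_eq_succ_of_ne_zero (hl (e i))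
  have hmin := h.isMin (e i)
  rw [hl'] at hmin
  have hinj := Submodule.subtype_injective (LinearMap.range (ev D.sig (v (e i))))
  have hS := D.sig_restrict _ (D.isSub_range (v (e i)))
  have hmin' := (isMin_iff_of_injective hinj hS v' _).1 hmin
  have htop : LinearMap.range (ev D'.sig v') = ⊤ := by
    apply Submodule.map_injective_of_injective hinj
    rw [← range_ev_map hS, Submodule.map_top, Submodule.range_subtype]
    rfl
  exact ⟨hAAi, D'.isIndecomposable_block hmin' htop, D'.isIteratedSelfExtension_block hq1 hrt hmin'
    htop ((isAlmostAdmissible_iff hq1 hrt D').1 hAAi)⟩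

end Isoclinic

end DiffModule

end QDiff

/-! ### The decomposition theorem -/

theorem mainTheorem6 {C : Type*} [NormedField C] [IsAlgClosed C]
    (hC : IsUltrametricDist C ∨ ∃ e : C ≃+* ℂ, ∀ z, ‖e z‖ = ‖z‖)
    (q : Cˣ) (hq_norm : ‖(q : C)‖ = 1) (hq_root : ∀ n : ℕ, 0 < n → q ^ n ≠ 1)
    (rt : ℕ → Cˣ) (hrt : ∀ n : ℕ, 0 < n → rt n ^ n = q)
    (hq_conv : QDiff.IsConvergent
      (PowerSeries.mk fun n => (QDiff.qPochhammer (q : C) (q : C) n)⁻¹))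
    {M : Type*} [AddCommGroup M] [Module (QDiff.MeroGerm C) M]
    [FiniteDimensional (QDiff.MeroGerm C) M]
    (D : QDiff.DiffModule q M) (hD : D.IsAlmostAdmissible rt)
    (k : ℕ) (μ : Fin k → ℚ) (r : Fin k → ℕ) (hμ : StrictMono μ)
    (hNP : D.HasNewtonPolygon (Set.range fun i => (μ i, r i))) :
    ∃ N : Fin k → Submodule (QDiff.MeroGerm C) M,
      DirectSum.IsInternal N ∧
      ∀ i, ∃ h : D.IsSub (N i),
        (D.restrict (N i) h).IsAlmostAdmissible rt ∧
        (D.restrict (N i) h).IsPure (μ i) ∧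
        Module.finrank (QDiff.MeroGerm C) (N i) = r i ∧
        ∃ (l : ℕ) (P : Fin l → Submodule (QDiff.MeroGerm C) (N i)),
          DirectSum.IsInternal P ∧
          ∀ j, ∃ hj : (D.restrict (N i) h).IsSub (P j),
            ((D.restrict (N i) h).restrict (P j) hj).IsAlmostAdmissible rt ∧
            ((D.restrict (N i) h).restrict (P j) hj).IsIndecomposable ∧
            ((D.restrict (N i) h).restrict (P j) hj).IsIteratedSelfExtension rt := by
  classical
  obtain ⟨a, B, ha, hB, hAA⟩ := (QDiff.DiffModule.isAlmostAdmissible_iff hq_norm hrt D).1 hD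
  obtain ⟨X, hX⟩ := QDiff.exists_exponentData hq_norm hq_root hq_conv hrt hAA
  obtain ⟨J₀, _, μ₀, c₀, v₀, l₀, h₀⟩ := QDiff.exists_jordanSystem D.sig_injective hq_norm hq_root _
    a B rfl hB hX
  rw [ha] at h₀
  obtain ⟨J, _, μJ, c, v, l, hJ, hl⟩ : ∃ (J : Type) (_ : Fintype J) (μJ : J → ℚ) (c : J → Cˣ)
      (v : J → M) (l : J → ℕ), QDiff.JordanSystem X D.sig ⊤ μJ c v l ∧ ∀ j, l j ≠ 0 :=
    ⟨_, _, _, _, _, _, h₀.pos, fun j => j.2⟩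
  obtain ⟨L, hL, hLP⟩ := hNP
  -- The width formula holds for every associated operator, so the operator with the given Newton
  -- polygon need not be the almost admissible one used to build the Jordan system.
  have hr : ∀ i, 0 < r i ∧ r i = ∑ j, if μJ j = μ i then (μJ j).den * l j else 0 := fun i => by
    rw [← D.isSlope_iff_of_jordanSystem hJ hL, hLP]
    exact ⟨i, rfl⟩
  -- Blocks of length zero have been discarded, so the slope of each block has a positive length and
  -- appears in the given polygon.
  have hmem : ∀ j, ∃ i, μ i = μJ j := by
    intro j
    have hpos : 0 < ∑ i, if μJ i = μJ j then (μJ i).den * l i else 0 :=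
      Finset.sum_pos' (fun _ _ => Nat.zero_le _) ⟨j, Finset.mem_univ j, by
        rw [if_pos rfl]
        exact Nat.mul_pos (μJ j).den_pos (Nat.pos_of_ne_zero (hl j))⟩
    have h1 := (D.isSlope_iff_of_jordanSystem hJ hL (μJ j) _).2 ⟨hpos, rfl⟩
    rw [hLP] at h1
    obtain ⟨i, hi⟩ := h1
    exact ⟨i, congrArg Prod.fst hi⟩
  obtain ⟨hint, hN⟩ := hJ.isInternal_slopes hμ.injective hmem
  refine ⟨_, hint, fun i => ?_⟩
  have hsub : ∀ i, D.IsSub (⨆ j : {j // μJ j = μ i}, LinearMap.range (QDiff.ev D.sig (v j))) :=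
    fun i => D.isSub_iff.2 (QDiff.Stable.iSup fun j => QDiff.stable_range _)
  have hAAi := (QDiff.DiffModule.isAlmostAdmissible_restrict_iff hq_norm hrt D _ (hsub i)).2
    (((QDiff.DiffModule.isAlmostAdmissible_iff hq_norm hrt D).1 hD).of_isInternal hq_norm hrt
      (fun i => D.isSub_iff.1 (hsub i)) hint i)
  have hJi : QDiff.JordanSystem X (D.restrict _ (hsub i)).sig ⊤ (J := {j // μJ j = μ i})
      (fun j => μJ j) (fun j => c j) (fun j => ⟨v j, (hN i).v_mem j⟩) (fun j => l j) := by
    apply QDiff.JordanSystem.of_injective (Submodule.subtype_injective _)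
      (D.sig_restrict _ (hsub i))
    rw [Submodule.map_top, Submodule.range_subtype]
    exact hN i
  have hsum : ∑ j : {j // μJ j = μ i}, (μJ j).den * l j = r i := by
    rw [(hr i).2]
    exact QDiff.JordanSystem.sum_subtype_slope μJ (μ i) fun j => (μJ j).den * l j
  refine ⟨hsub i, hAAi, ?_, ?_, ?_⟩
  · exact QDiff.DiffModule.isPure_of_jordanSystem _ hJi (fun j => j.2)
      (by rw [hsum]; exact (hr i).1) hAAi
  · rw [← (hN i).finrank, hsum]
  · exact QDiff.DiffModule.exists_blocks _ hq_norm hrt hJi (fun j => hl j) hAAi
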